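/- **Setting.** Let $\mathcal P(n)$ be the set of subsets of $\{1,\dots,n\}$ and $\mathbb S=\{J\in\mathbb H: J^2=-1\}$. Let $D\subset\mathbb C^n$ be an open set which is invariant under the conjugation $z\mapsto\overline z^h$ of each single coordinate $z_h=\alpha_h+i\beta_h$, and let $\Omega_D=\{(\alpha_1+J_1\beta_1,\dots,\alpha_n+J_n\beta_n): (\alpha_1+i\beta_1,\dots,\alpha_n+i\beta_n)\in D,\ J_1,\dots,J_n\in\mathbb S\}\subset\mathbb H^n$. A *stem function* on $D$ is a map $F=\sum_{K\in\mathcal P(n)}e_KF_K:D\to\mathbb H\otimes\mathbb R^{2^n}$ with $F_K(\overline z^h)=(-1)^{|K\cap\{h\}|}F_K(z)$ for all $K,h$ and all $z\in D$. It induces the *slice function* $f=\mathcal I(F):\Omega_D\to\mathbb H$, $$f(\alpha_1+J_1\beta_1,\dots,\alpha_n+J_n\beta_n)=\sum_{K}J_{k_1}\cdots J_{k_p}F_K(z)\qquad(K=\{k_1<\dots<k_p\}),$$ and $F$ is uniquely determined by $f$. The function $f$ is *slice regular* on $\Omega_D$ if $F$ is of class $C^1$ and $\frac12\big(\partial F/\partial\alpha_h+\mathcal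 J_h\,\partial F/\partial\beta_h\big)=0$ on $D$ for every $h$, where $\mathcal J_h(q\otimes e_K)=(-1)^{|K\cap\{h\}|}q\otimes e_{K\Delta\{h\}}$. A slice function $g$ on $\Omega_D$ is *slice regular with respect to $x_h$* if for every $y\in\Omega_D$ the restriction $x\mapsto g(y_1,\dots,y_{h-1},x,y_{h+1},\dots,y_n)$ is a slice regular function of one variable on $\{x\in\mathbb H:(y_1,\dots,y_{h-1},x,y_{h+1},\dots,y_n)\in\Omega_D\}$. Stem functions are multiplied by $F\otimes G=\sum_{H,K}(-1)^{|H\cap K|}e_{K\Delta H}F_KG_H$. Put $Z_j(z)=\alpha_j+e_{\{j\}}\beta_j$ and $Z_K=Z_{k_1}\otimes\cdots\otimes Z_{k_p}$ for $K=\{k_1<\dots<k_p\}$ ($Z_\emptyset=1$). Let $F'_h=\sum_{K\not\ni h}e_K\,\beta_h^{-1}F_{K\cup\{h\}}$, extended to the points with $\beta_h=0$ by the limit of $\beta^{-1}F_{K\cup\{h\}}$ as the imaginary part $\beta$ of the $h$-th coordinate tends to $0$ with everything else fixed, i.e. by $\partial F_{K\cup\{h\}}/\partial\beta_h$ (by convention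 the value is $0$ at points where this derivative does not exist). For $0\le m\le n$ and $K\subset\{1,\dots,m\}$ the *ordered component* $\mathcal S^m_K(f)$ of $f=\mathcal I(F)$ is the slice function on $\Omega_D$ induced by $(\cdots((Z_K\otimes F)'_1)'_2\cdots)'_m$; so $\mathcal S^0_\emptyset(f)=f$. Finally, with $x_h=\alpha_h+i\beta_h+j\gamma_h+k\delta_h$, let $$\overline\partial_{x_h}=\tfrac12\Big(\tfrac{\partial}{\partial\alpha_h}+i\tfrac{\partial}{\partial\beta_h}+j\tfrac{\partial}{\partial\gamma_h}+k\tfrac{\partial}{\partial\delta_h}\Big),$$ and let $\chi_K$ be the characteristic function of $K$. **Proposition.** Let $f$ be a slice function on $\Omega_D$. Then $f$ is slice regular on $\Omega_D$ if and only if, for every $m=0,\dots,n-1$ and every $K\subset\{1,\dots,m\}$, the component $\mathcal S^m_K(f)$ is slice regular on $\Omega_D$ with respect to $x_{m+1}$. In that case, for every $0\le m\le n$ and every $K\subset\{1,\dots,m\}$, $$\mathcal S^m_K(f)=(-1)^m\,\overline\partial_{x_m}\big(x_m^{\chi_K(m)}\cdots\overline\partial_{x_1}(x_1^{\chi_K(1)}f)\cdots\big)\quad\text{on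 }\Omega_D,$$ where each function to which an operator $\overline\partial_{x_h}$ is applied is real differentiable in the variable $x_h$ at every point of $\Omega_D$. -/

import Mathlib

open scoped Quaternion

noncomputable section

namespace SliceAnalysis

/-- The set of square roots of `-1` in the quaternions. -/
def sphereUnits : Set ℍ[ℝ] := {J | J * J = -1}

/-- The quaternion `i`. -/
def unitI : ℍ[ℝ] := ⟨0, 1, 0, 0⟩

/-- The quaternion `j`. -/
def unitJ : ℍ[ℝ] := ⟨0, 0, 1, 0⟩

/-- The quaternion `k`. -/
def unitK : ℍ[ℝ] := ⟨0, 0, 0, 1⟩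

/-- The quaternion `α + J β` attached to `z = α + i β` and to an imaginary unit `J`. -/
def slicePoint (z : ℂ) (J : ℍ[ℝ]) : ℍ[ℝ] := (z.re : ℍ[ℝ]) + J * (z.im : ℍ[ℝ])

/-- The point obtained from `z` by conjugating the `h`-th coordinate only. -/
def conjAt {n : ℕ} (h : Fin n) (z : Fin n → ℂ) : Fin n → ℂ :=
  Function.update z h ((starRingEnd ℂ) (z h))

/-- `D` is invariant under the conjugation of each single coordinate. -/
def ConjInvariant {n : ℕ} (D : Set (Fin n → ℂ)) : Prop :=
  ∀ (h : Fin n) (z : Fin n → ℂ), z ∈ D ↔ conjAt h z ∈ D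

/-- The circularization `Ω_D` of `D`. -/
def circularization {n : ℕ} (D : Set (Fin n → ℂ)) : Set (Fin n → ℍ[ℝ]) :=
  {x | ∃ z ∈ D, ∃ J : Fin n → ℍ[ℝ], (∀ h, J h ∈ sphereUnits) ∧
    x = fun h => slicePoint (z h) (J h)}

/-- Maps `F = ∑_K e_K F_K` with values in `ℍ ⊗ ℝ^(2^n)`, given by their components:
`F K z` is `F_K(z)`. -/
abbrev StemMap (n : ℕ) := Finset (Fin n) → (Fin n → ℂ) → ℍ[ℝ]

/-- `F` is a stem function on `D`. -/
def IsStem {n : ℕ} (D : Set (Fin n → ℂ)) (F : StemMap n) : Prop :=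
  ConjInvariant D ∧
    ∀ z ∈ D, ∀ (K : Finset (Fin n)) (h : Fin n),
      F K (conjAt h z) = (-1) ^ (K ∩ {h}).card * F K z

/-- The product `J_K` of the `J h`, `h ∈ K`, in increasing order of the indices. -/
def orderedProd {n : ℕ} (J : Fin n → ℍ[ℝ]) (K : Finset (Fin n)) : ℍ[ℝ] :=
  (List.ofFn fun h => if h ∈ K then J h else 1).prod

/-- The value `∑_K [J_K, F_K(z)]`. -/
def stemValue {n : ℕ} (F : StemMap n) (z : Fin n → ℂ) (J : Fin n → ℍ[ℝ]) : ℍ[ℝ] :=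
  ∑ K : Finset (Fin n), orderedProd J K * F K z

/-- `f = 𝓘(F)` on `Ω_D`.  Functions on `Ω_D` are represented by total functions of which only
the values on `Ω_D` matter. -/
def Induces {n : ℕ} (D : Set (Fin n → ℂ)) (F : StemMap n) (f : (Fin n → ℍ[ℝ]) → ℍ[ℝ]) : Prop :=
  ∀ z ∈ D, ∀ J : Fin n → ℍ[ℝ], (∀ h, J h ∈ sphereUnits) →
    f (fun h => slicePoint (z h) (J h)) = stemValue F z J

/-- `f` is a slice function on `Ω_D`. -/
def IsSlice {n : ℕ} (D : Set (Fin n → ℂ)) (f : (Fin n → ℍ[ℝ]) → ℍ[ℝ]) : Prop :=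
  ∃ F : StemMap n, IsStem D F ∧ Induces D F f

/-- The coordinate `z = α + i β`, `β ≥ 0`, of a quaternion `q = α + J β`. -/
def stdCoord (q : ℍ[ℝ]) : ℂ := ⟨q.re, ‖q.im‖⟩

open Classical in
/-- An imaginary unit `J` with `q = α + J β`, `β ≥ 0` (the choice `J = i` for real `q` is
arbitrary and irrelevant). -/
def stdUnit (q : ℍ[ℝ]) : ℍ[ℝ] := if q.im = 0 then unitI else ‖q.im‖⁻¹ • q.im

/-- The slice function `𝓘(F)` induced by a stem function `F`. -/
def inducedFun {n : ℕ} (F : StemMap n) (x : Fin n → ℍ[ℝ]) : ℍ[ℝ] :=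
  stemValue F (fun h => stdCoord (x h)) (fun h => stdUnit (x h))

/-- The stem function `𝓘⁻¹(f)` inducing a slice function `f` on `Ω_D`. -/
def stemOf {n : ℕ} (D : Set (Fin n → ℂ)) (f : (Fin n → ℍ[ℝ]) → ℍ[ℝ]) : StemMap n :=
  Classical.epsilon fun F => IsStem D F ∧ Induces D F f

/-! ### Slice regularity -/

/-- The complex structure `𝓙_h`, with `𝓙_h (q ⊗ e_K) = (-1)^|K ∩ {h}| q ⊗ e_(K Δ {h})`,
written on components. -/
def complexStr {n : ℕ} (h : Fin n) (F : StemMap n) : StemMap n := fun L z =>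
  ∑ K : Finset (Fin n),
    if symmDiff K {h} = L then (-1) ^ (K ∩ {h}).card * F K z else 0

/-- `∂F/∂α_h`, componentwise. -/
def dAlpha {n : ℕ} (h : Fin n) (F : StemMap n) : StemMap n := fun K z =>
  fderiv ℝ (F K) z (Pi.single h 1)

/-- `∂F/∂β_h`, componentwise. -/
def dBeta {n : ℕ} (h : Fin n) (F : StemMap n) : StemMap n := fun K z =>
  fderiv ℝ (F K) z (Pi.single h Complex.I)

/-- The operator `∂̄_h = (∂/∂α_h + 𝓙_h ∂/∂β_h) / 2`. -/
def dbarStem {n : ℕ} (h : Fin n) (F : StemMap n) : StemMap n := fun K z =>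
  (1 / 2 : ℝ) • (dAlpha h F K z + complexStr h (dBeta h F) K z)

/-- `F` is of class `C¹` on (the open set) `D` and `h`-holomorphic for every `h`. -/
def IsHolomorphicStem {n : ℕ} (D : Set (Fin n → ℂ)) (F : StemMap n) : Prop :=
  (∀ K, ContDiffOn ℝ 1 (F K) D) ∧ ∀ h, ∀ K, ∀ z ∈ D, dbarStem h F K z = 0

/-- `f` is slice regular on `Ω_D`. -/
def IsSliceRegular {n : ℕ} (D : Set (Fin n → ℂ)) (f : (Fin n → ℍ[ℝ]) → ℍ[ℝ]) : Prop :=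
  ∃ F : StemMap n, IsStem D F ∧ IsHolomorphicStem D F ∧ Induces D F f

/-- The subset of `ℂ` (seen as `ℂ¹`) whose circularization is
`Ω_(D,h)(y) = {q | (y_1, …, y_(h-1), q, y_(h+1), …, y_n) ∈ Ω_D}`;
see `circularization_sectionBase`. -/
def sectionBase {n : ℕ} (D : Set (Fin n → ℂ)) (h : Fin n) (y : Fin n → ℍ[ℝ]) :
    Set (Fin 1 → ℂ) :=
  {w | Function.update (fun j => stdCoord (y j)) h (w 0) ∈ D}

/-- `f` is slice regular on `Ω_D` with respect to the single variable `x_h`: it is a slice function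
and all its restrictions to the variable `x_h` are slice regular functions of one variable. -/
def IsSliceRegularIn {n : ℕ} (D : Set (Fin n → ℂ)) (h : Fin n)
    (f : (Fin n → ℍ[ℝ]) → ℍ[ℝ]) : Prop :=
  IsSlice D f ∧ ∀ y ∈ circularization D,
    IsSliceRegular (sectionBase D h y) fun q : Fin 1 → ℍ[ℝ] => f (Function.update y h (q 0))

/-! ### Products, spherical derivatives and components -/

/-- The product `F ⊗ G = ∑_(H,K) (-1)^|H ∩ K| e_(K Δ H) F_K G_H`. -/
def stemMul {n : ℕ} (F G : StemMap n) : StemMap n := fun L z =>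
  ∑ K : Finset (Fin n), ∑ H : Finset (Fin n),
    if symmDiff K H = L then (-1) ^ (H ∩ K).card * (F K z * G H z) else 0

/-- The constant stem function `1 = e_∅`. -/
def stemOne (n : ℕ) : StemMap n := fun K _ => if K = ∅ then 1 else 0

/-- The stem function `Z_j(z) = α_j + e_j β_j`, which induces the monomial `x_j`. -/
def stemVar {n : ℕ} (j : Fin n) : StemMap n := fun K z =>
  if K = ∅ then ((z j).re : ℍ[ℝ]) else if K = {j} then ((z j).im : ℍ[ℝ]) else 0

/-- `Z_K = Z_(k_1) ⊗ ⋯ ⊗ Z_(k_p)` for `K = {k_1 < ⋯ < k_p}`, which induces `x_K`. -/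
def stemMonomial {n : ℕ} (K : Finset (Fin n)) : StemMap n :=
  ((K.sort (· ≤ ·)).map stemVar).foldr stemMul (stemOne n)

/-- The stem function `F'_h = ∑_(h ∉ K) e_K β_h⁻¹ F_(K ∪ {h})` of the spherical derivative with
respect to `x_h`.  Where `β_h = 0`, it is extended by the limit of `β⁻¹ F_(K ∪ {h})` as
the imaginary part `β` of the `h`-th coordinate tends to `0`; as `F_(K ∪ {h})` vanishes for `β = 0`,
this limit is the derivative `∂F_(K ∪ {h})/∂β_h`. -/
def stemSphDeriv {n : ℕ} (h : Fin n) (F : StemMap n) : StemMap n := fun K z =>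
  if h ∈ K then 0
  else if (z h).im = 0 then
    deriv (fun t : ℝ => F (insert h K) (Function.update z h ⟨(z h).re, t⟩)) 0
  else ((z h).im)⁻¹ • F (insert h K) z

/-- `F'_H = (⋯(F'_(h_1))'_(h_2)⋯)'_(h_p)` for `H = {h_1 < ⋯ < h_p}`. -/
def stemSphDerivs {n : ℕ} (H : Finset (Fin n)) (F : StemMap n) : StemMap n :=
  (H.sort (· ≤ ·)).foldl (fun G h => stemSphDeriv h G) F

/-- The component `𝓢^H_K(f) = (x_K ⊙ f)'_(s,H)` of the slice function `f`, that is, the function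
induced by `G^H_K(F) = (Z_K ⊗ F)'_H` where `f = 𝓘(F)`. -/
def component {n : ℕ} (D : Set (Fin n → ℂ)) (H K : Finset (Fin n))
    (f : (Fin n → ℍ[ℝ]) → ℍ[ℝ]) : (Fin n → ℍ[ℝ]) → ℍ[ℝ] :=
  inducedFun (stemSphDerivs H (stemMul (stemMonomial K) (stemOf D f)))

/-- The first `m` indices: the set `{1, …, m}`, written with indices starting from `0`. -/
def firstIndices (n m : ℕ) : Finset (Fin n) := Finset.univ.filter fun h => (h : ℕ) < m

/-- The ordered component `𝓢^m_K(f)`. -/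
def orderedComponent {n : ℕ} (D : Set (Fin n → ℂ)) (m : ℕ) (K : Finset (Fin n))
    (f : (Fin n → ℍ[ℝ]) → ℍ[ℝ]) : (Fin n → ℍ[ℝ]) → ℍ[ℝ] :=
  component D (firstIndices n m) K f

/-! ### The Cauchy-Riemann-Fueter operators -/

/-- The operator `∂̄_(x_h) = (∂/∂α_h + i ∂/∂β_h + j ∂/∂γ_h + k ∂/∂δ_h) / 2`. -/
def crfBar {n : ℕ} (h : Fin n) (g : (Fin n → ℍ[ℝ]) → ℍ[ℝ]) (x : Fin n → ℍ[ℝ]) : ℍ[ℝ] :=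
  (1 / 2 : ℝ) •
    (lineDeriv ℝ g x (Pi.single h 1) + unitI * lineDeriv ℝ g x (Pi.single h unitI)
      + unitJ * lineDeriv ℝ g x (Pi.single h unitJ) + unitK * lineDeriv ℝ g x (Pi.single h unitK))

/-- The function `x ↦ x_h^(χ_K(h)) g(x)`. -/
def mulVar {n : ℕ} (K : Finset (Fin n)) (h : Fin n) (g : (Fin n → ℍ[ℝ]) → ℍ[ℝ])
    (x : Fin n → ℍ[ℝ]) : ℍ[ℝ] :=
  x h ^ (if h ∈ K then 1 else 0) * g x

/-- The iterated operator
`∂̄_(x_m)(x_m^(χ_K(m)) ⋯ ∂̄_(x_1)(x_1^(χ_K(1)) f) ⋯)`, for `m ≤ n`. -/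
def crfIter {n : ℕ} (K : Finset (Fin n)) (f : (Fin n → ℍ[ℝ]) → ℍ[ℝ]) :
    ℕ → (Fin n → ℍ[ℝ]) → ℍ[ℝ]
  | 0 => f
  | m + 1 => if hm : m < n then crfBar ⟨m, hm⟩ (mulVar K ⟨m, hm⟩ (crfIter K f m))
      else crfIter K f m

/-! ### Well-definedness -/

theorem stdUnit_mem (q : ℍ[ℝ]) : stdUnit q ∈ sphereUnits := by
  unfold stdUnit sphereUnits
  split_ifs with h
  · change unitI * unitI = -1
    have h0 : unitI.re = 0 := rfl
    have h1 : unitI.imI = 1 := rfl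
    have h2 : unitI.imJ = 0 := rfl
    have h3 : unitI.imK = 0 := rfl
    ext <;> simp [h0, h1, h2, h3]
  · have h1 : ‖q.im‖ ≠ 0 := norm_ne_zero_iff.2 h
    have h2 : q.im * q.im = -((‖q.im‖ * ‖q.im‖ : ℝ) : ℍ[ℝ]) := by
      rw [← Quaternion.normSq_eq_norm_mul_self, Quaternion.normSq_def']
      apply Quaternion.ext
      · rw [Quaternion.re_neg, Quaternion.re_coe]
        simp
        ring
      · rw [Quaternion.imI_neg, Quaternion.imI_coe]
        simp
        ring
      · rw [Quaternion.imJ_neg, Quaternion.imJ_coe]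
        simp
        ring
      · rw [Quaternion.imK_neg, Quaternion.imK_coe]
        simp
        ring
    change (‖q.im‖⁻¹ • q.im) * (‖q.im‖⁻¹ • q.im) = -1
    rw [smul_mul_smul_comm, h2, smul_neg, Quaternion.smul_coe]
    have : ‖q.im‖⁻¹ * ‖q.im‖⁻¹ * (‖q.im‖ * ‖q.im‖) = 1 := by field_simp
    rw [this, Quaternion.coe_one]

theorem slicePoint_std (q : ℍ[ℝ]) : slicePoint (stdCoord q) (stdUnit q) = q := by
  unfold slicePoint stdCoord stdUnit
  split_ifs with h
  · simp only [h, norm_zero]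
    have := Quaternion.re_add_im q
    rw [h] at this
    simpa using this
  · have h1 : ‖q.im‖ ≠ 0 := norm_ne_zero_iff.2 h
    simp only
    rw [Quaternion.mul_coe_eq_smul, smul_smul, mul_inv_cancel₀ h1, one_smul]
    exact Quaternion.re_add_im q

theorem stdCoord_slicePoint {J : ℍ[ℝ]} (hJ : J ∈ sphereUnits) (z : ℂ) :
    (stdCoord (slicePoint z J) = z ∧ (z.im = 0 ∨ stdUnit (slicePoint z J) = J)) ∨
      (stdCoord (slicePoint z J) = (starRingEnd ℂ) z ∧ stdUnit (slicePoint z J) = -J) := by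
  have hJ' : J * J = -1 := hJ
  have hn : ‖J‖ = 1 := by
    have : ‖J‖ * ‖J‖ = 1 := by rw [← norm_mul, hJ']; simp
    nlinarith [norm_nonneg J]
  have hre : J.re = 0 := by
    by_contra h0
    have e0 := congrArg (fun q : ℍ[ℝ] => q.re) hJ'
    have e1 := congrArg (fun q : ℍ[ℝ] => q.imI) hJ'
    have e2 := congrArg (fun q : ℍ[ℝ] => q.imJ) hJ'
    have e3 := congrArg (fun q : ℍ[ℝ] => q.imK) hJ'
    simp at e0 e1 e2 e3
    have i1 : J.imI = 0 := by
      have : J.re * J.imI = 0 := by linarith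
      simpa [h0] using this
    have i2 : J.imJ = 0 := by
      have : J.re * J.imJ = 0 := by linarith
      simpa [h0] using this
    have i3 : J.imK = 0 := by
      have : J.re * J.imK = 0 := by linarith
      simpa [h0] using this
    rw [i1, i2, i3] at e0
    nlinarith [mul_self_nonneg J.re]
  have him : (slicePoint z J).im = z.im • J := by
    ext <;> simp [slicePoint, hre, mul_comm]
  have hr : (slicePoint z J).re = z.re := by simp [slicePoint, hre]
  have hno : ‖(slicePoint z J).im‖ = |z.im| := by rw [him, norm_smul, hn, mul_one, Real.norm_eq_abs]
  have hJ0 : J ≠ 0 := by rintro rfl; simp at hn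
  rcases lt_trichotomy z.im 0 with h | h | h
  · right
    constructor
    · apply Complex.ext <;> simp [stdCoord, hr, hno, abs_of_neg h]
    · unfold stdUnit
      rw [if_neg (by rw [him]; exact smul_ne_zero h.ne hJ0), hno, him, smul_smul, abs_of_neg h]
      rw [inv_neg, neg_mul, inv_mul_cancel₀ h.ne, neg_one_smul]
  · left
    refine ⟨?_, Or.inl h⟩
    apply Complex.ext <;> simp [stdCoord, hr, hno, h]
  · left
    constructor
    · apply Complex.ext <;> simp [stdCoord, hr, hno, abs_of_pos h]
    · right
      unfold stdUnit
      rw [if_neg (by rw [him]; exact smul_ne_zero h.ne' hJ0), hno, him, smul_smul, abs_of_pos h]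
      rw [inv_mul_cancel₀ h.ne', one_smul]

theorem prod_ofFn_update_neg {n : ℕ} (g : Fin n → ℍ[ℝ]) (h : Fin n) :
    (List.ofFn (Function.update g h (-(g h)))).prod = -(List.ofFn g).prod := by
  induction n with
  | zero => exact h.elim0
  | succ n ih =>
    rw [List.ofFn_succ, List.ofFn_succ, List.prod_cons, List.prod_cons]
    induction h using Fin.cases with
    | zero =>
      have : (fun i : Fin n => Function.update g 0 (-(g 0)) i.succ) = fun i => g i.succ := by
        funext i; simp
      rw [this]; simp
    | succ k =>
      have : (fun i : Fin n => Function.update g k.succ (-(g k.succ)) i.succ)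
          = Function.update (fun i : Fin n => g i.succ) k (-(g k.succ)) := by
        funext i
        by_cases hik : i = k
        · subst hik; simp
        · rw [Function.update_of_ne hik, Function.update_of_ne (by simpa using hik)]
      rw [this, ih (fun i => g i.succ) k,
        Function.update_of_ne (Fin.succ_ne_zero k).symm, mul_neg]

theorem orderedProd_update_neg {n : ℕ} (J : Fin n → ℍ[ℝ]) (K : Finset (Fin n)) (h : Fin n) :
    orderedProd (Function.update J h (-J h)) K
      = if h ∈ K then -orderedProd J K else orderedProd J K := by
  split_ifs with hK
  · have := prod_ofFn_update_neg (fun i => if i ∈ K then J i else 1) h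
    unfold orderedProd
    rw [← this]
    congr 2
    funext i
    by_cases hi : i = h
    · subst hi; simp [hK]
    · rw [Function.update_of_ne hi, Function.update_of_ne hi]
  · unfold orderedProd
    congr 2
    funext i
    by_cases hi : i = h
    · subst hi; simp [hK]
    · rw [Function.update_of_ne hi]

/-- One step of the independence of the representation `x_h = α_h + J_h β_h`. -/
theorem stemValue_step {n : ℕ} {D : Set (Fin n → ℂ)} {F : StemMap n} (hF : IsStem D F)
    {z : Fin n → ℂ} (hz : z ∈ D) (J : Fin n → ℍ[ℝ]) (h : Fin n) (w : ℂ) (J' : ℍ[ℝ])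
    (hw : (w = z h ∧ ((z h).im = 0 ∨ J' = J h)) ∨ (w = (starRingEnd ℂ) (z h) ∧ J' = -J h)) :
    Function.update z h w ∈ D ∧
      stemValue F (Function.update z h w) (Function.update J h J') = stemValue F z J := by
  rcases hw with ⟨rfl, h0 | rfl⟩ | ⟨rfl, rfl⟩
  · rw [Function.update_eq_self]
    refine ⟨hz, Finset.sum_congr rfl fun K _ => ?_⟩
    by_cases hK : h ∈ K
    · have h1 := hF.2 z hz K h
      have h2 : conjAt h z = z := by
        unfold conjAt
        rw [Complex.conj_eq_iff_im.2 h0, Function.update_eq_self]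
      rw [h2, Finset.inter_singleton_of_mem hK] at h1
      have h3 : F K z = 0 := by
        have : F K z = -F K z := by simpa using h1
        exact by
          have h4 : (2 : ℝ) • F K z = 0 := by rw [two_smul]; nth_rewrite 1 [this]; simp
          simpa using h4
      rw [h3, mul_zero, mul_zero]
    · congr 1
      unfold orderedProd
      congr 2
      funext i
      by_cases hi : i = h
      · subst hi; simp [hK]
      · rw [Function.update_of_ne hi]
  · rw [Function.update_eq_self, Function.update_eq_self]
    exact ⟨hz, rfl⟩
  · refine ⟨(hF.1 h z).1 hz, Finset.sum_congr rfl fun K _ => ?_⟩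
    have h1 := hF.2 z hz K h
    unfold conjAt at h1
    rw [h1]
    by_cases hK : h ∈ K
    · rw [orderedProd_update_neg, if_pos hK, Finset.inter_singleton_of_mem hK]
      simp
    · rw [orderedProd_update_neg, if_neg hK, Finset.inter_singleton_of_notMem hK]
      simp

theorem stemValue_congr {n : ℕ} {D : Set (Fin n → ℂ)} {F : StemMap n} (hF : IsStem D F)
    {z w : Fin n → ℂ} (hz : z ∈ D) (J J' : Fin n → ℍ[ℝ])
    (hw : ∀ h, (w h = z h ∧ ((z h).im = 0 ∨ J' h = J h)) ∨
      (w h = (starRingEnd ℂ) (z h) ∧ J' h = -J h)) :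
    w ∈ D ∧ stemValue F w J' = stemValue F z J := by
  have key : ∀ S : Finset (Fin n), S.piecewise w z ∈ D ∧
      stemValue F (S.piecewise w z) (S.piecewise J' J) = stemValue F z J := by
    intro S
    induction S using Finset.induction_on with
    | empty => simpa using hz
    | insert a S ha ih =>
      rw [Finset.piecewise_insert, Finset.piecewise_insert]
      have := stemValue_step hF ih.1 (S.piecewise J' J) a (w a) (J' a)
        (by simpa [ha] using hw a)
      exact ⟨this.1, this.2.trans ih.2⟩
  simpa using key Finset.univ

/-- A stem function `F` on `D` does induce the function `inducedFun F` on `Ω_D`. -/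
theorem induces_inducedFun {n : ℕ} {D : Set (Fin n → ℂ)} {F : StemMap n} (hF : IsStem D F) :
    Induces D F (inducedFun F) := fun z hz J hJ =>
  (stemValue_congr hF hz J _ fun h => stdCoord_slicePoint (hJ h) (z h)).2

theorem mem_circularization_iff {n : ℕ} {D : Set (Fin n → ℂ)} (hD : ConjInvariant D)
    (x : Fin n → ℍ[ℝ]) : x ∈ circularization D ↔ (fun h => stdCoord (x h)) ∈ D := by
  constructor
  · rintro ⟨z, hz, J, hJ, rfl⟩
    have h0 : IsStem D (0 : StemMap n) := ⟨hD, fun z _ K h => by simp⟩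
    exact (stemValue_congr h0 hz J _ fun h => stdCoord_slicePoint (hJ h) (z h)).1
  · intro hx
    exact ⟨_, hx, fun h => stdUnit (x h), fun h => stdUnit_mem _,
      funext fun h => (slicePoint_std (x h)).symm⟩

theorem conjInvariant_sectionBase {n : ℕ} {D : Set (Fin n → ℂ)} (hD : ConjInvariant D)
    (h : Fin n) (y : Fin n → ℍ[ℝ]) : ConjInvariant (sectionBase D h y) := by
  intro i w
  have hi : i = 0 := Subsingleton.elim _ _
  subst hi
  have := hD h (Function.update (fun j => stdCoord (y j)) h (w 0))
  simpa [sectionBase, conjAt] using this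

theorem circularization_sectionBase {n : ℕ} {D : Set (Fin n → ℂ)} (hD : ConjInvariant D)
    (h : Fin n) (y : Fin n → ℍ[ℝ]) :
    circularization (sectionBase D h y)
      = {q : Fin 1 → ℍ[ℝ] | Function.update y h (q 0) ∈ circularization D} := by
  ext q
  rw [mem_circularization_iff (conjInvariant_sectionBase hD h y), Set.mem_ofPred_eq,
    mem_circularization_iff hD]
  have : (fun j => stdCoord (Function.update y h (q 0) j))
      = Function.update (fun j => stdCoord (y j)) h (stdCoord (q 0)) := by
    funext j
    by_cases hj : j = h
    · subst hj; simp
    · simp [hj]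
  rw [this]
  rfl

/-- The stem function inducing a slice function is unique. -/
theorem Induces.unique {n : ℕ} {D : Set (Fin n → ℂ)} {F G : StemMap n}
    {f : (Fin n → ℍ[ℝ]) → ℍ[ℝ]} (hF : Induces D F f) (hG : Induces D G f) :
    ∀ z ∈ D, ∀ K, F K z = G K z := by
  intro z hz T
  have key : ∀ S : Finset (Fin n), ∀ J : Fin n → ℍ[ℝ], (∀ h, J h ∈ sphereUnits) →
      ∑ K : Finset (Fin n), (if K ∩ S = T ∩ S then orderedProd J K * (F K z - G K z) else 0)
        = 0 := by
    intro S
    induction S using Finset.induction_on with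
    | empty =>
      intro J hJ
      have h1 := (hF z hz J hJ).symm.trans (hG z hz J hJ)
      simp only [Finset.inter_empty, if_true, mul_sub, Finset.sum_sub_distrib]
      exact sub_eq_zero.2 h1
    | insert a S ha ih =>
      intro J hJ
      have e1 := ih J hJ
      have e2 := ih (Function.update J a (-J a)) (fun h => by
        by_cases hh : h = a
        · subst hh
          have : J h * J h = -1 := hJ h
          rw [Function.update_self]
          change -J h * -J h = -1
          rw [neg_mul_neg, this]
        · rw [Function.update_of_ne hh]; exact hJ h)
      have hiff : ∀ K : Finset (Fin n), K ∩ insert a S = T ∩ insert a S ↔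
          K ∩ S = T ∩ S ∧ (a ∈ K ↔ a ∈ T) := by
        intro K
        simp only [Finset.ext_iff, Finset.mem_inter, Finset.mem_insert]
        constructor
        · intro hK
          refine ⟨fun i => ?_, by simpa using hK a⟩
          have := hK i
          tauto
        · rintro ⟨h1, h2⟩ i
          have := h1 i
          by_cases hi : i = a
          · subst hi; tauto
          · tauto
      have h2 : (2 : ℝ) • ∑ K : Finset (Fin n), (if K ∩ insert a S = T ∩ insert a S then
          orderedProd J K * (F K z - G K z) else 0) = 0 := by
        by_cases haT : a ∈ T
        · have e3 := congrArg₂ (· - ·) e1 e2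
          simp only [sub_zero] at e3
          rw [← Finset.sum_sub_distrib] at e3
          refine Eq.trans ?_ e3
          rw [Finset.smul_sum]
          refine Finset.sum_congr rfl fun K _ => ?_
          rw [orderedProd_update_neg]
          simp only [hiff, haT, iff_true]
          by_cases hK : a ∈ K <;> by_cases hS : K ∩ S = T ∩ S <;> simp [hK, hS, two_smul]
        · have e3 := congrArg₂ (· + ·) e1 e2
          simp only [add_zero] at e3
          rw [← Finset.sum_add_distrib] at e3
          refine Eq.trans ?_ e3
          rw [Finset.smul_sum]
          refine Finset.sum_congr rfl fun K _ => ?_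
          rw [orderedProd_update_neg]
          simp only [hiff, haT, iff_false]
          by_cases hK : a ∈ K <;> by_cases hS : K ∩ S = T ∩ S <;> simp [hK, hS, two_smul]
      simpa using h2
  have hk := key Finset.univ (fun _ => stdUnit 0) (fun _ => stdUnit_mem 0)
  simp only [Finset.inter_univ, Finset.sum_ite_eq', Finset.mem_univ, if_true] at hk
  rcases mul_eq_zero.1 hk with h0 | h0
  · exfalso
    unfold orderedProd at h0
    rw [List.prod_eq_zero_iff, List.mem_ofFn] at h0
    obtain ⟨i, hi⟩ := h0
    have h1 : stdUnit 0 * stdUnit 0 = -1 := stdUnit_mem 0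
    split_ifs at hi
    · have hi' : stdUnit 0 = 0 := hi
      rw [hi'] at h1; simp at h1
    · simp at hi
  · exact sub_eq_zero.1 h0

end SliceAnalysis

end

noncomputable section

open Complex Metric MeasureTheory Set Filter Topology

namespace SliceAnalysis

/-! ### Subharmonicity of `log ‖g‖` -/

/-! Everything is moved to the stem function `F`, where regularity means that each pair `F_L + e_h
F_{L ∪ h}` satisfies the Cauchy-Riemann equations in `z_h` (`HolIn`). The ordered components are
generated by the recursion `ordStem`: at step `m`, multiply by `Z_m` or not, then take the spherical
derivative in `x_m`.

The equivalence rests on three facts. (a) A spherical derivative in `x_h` kills every component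
whose index contains `h`. After `m` steps only indices avoiding `{1, …, m}` survive, so the unit of
the next variable is the leftmost factor wherever it occurs; the function has the form `A + J B` in
that variable, and one-variable regularity is exactly holomorphy of its stem function there
(`isSliceRegularIn_iff`). (b) The spherical derivative in `x_h` preserves holomorphy in `z_j`, `j ≠
h` (`HolIn.stemSphDeriv`). (c) Since `F_{L ∪ h} = β_h F'_h` and `F_L = (Z_h F)'_h - α_h F'_h` on
components with `h ∉ L`, holomorphy in `z_j` of both derivatives returns to `F`
(`HolIn.of_stemSphDeriv`). Fact (b) gives the forward implication; fact (c), applied repeatedly,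
gives holomorphy of `F` in every variable separately.

Hartogs' theorem enters twice. Class `C¹` has to be deduced from separate holomorphy
(`contDiffOn_of_holIn`). In (b), at points with `β_h = 0`, the spherical derivative is `∂F_L/∂α_h`
by Cauchy-Riemann, and its holomorphy in `z_j` comes from Cauchy's formula, which needs joint
continuity. Hartogs' theorem is obtained classically: Baire's theorem gives a bound on a smaller
product, Hartogs' lemma on sequences of holomorphic functions spreads the bound through the Taylor
coefficients, and Osgood's lemma turns boundedness into holomorphy.

For the formula, a function `A + J B` with a holomorphic pair has Cauchy-Riemann-Fueter derivative
`-B/β`, minus its spherical derivative. By (a), `Z_m ⊗` induces multiplication by `x_m` at step `m`.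
Each step therefore contributes one sign. -/

theorem log_norm_le_circleAverage {g : ℂ → ℂ} {c : ℂ} {R : ℝ} (hR : 0 < R)
    (hg : AnalyticOnNhd ℂ g (closedBall c R)) (h0 : g c ≠ 0) :
    Real.log ‖g c‖ ≤ Real.circleAverage (fun z => Real.log ‖g z‖) c R := by
  have habs : |R| = R := abs_of_pos hR
  have hg' : AnalyticOnNhd ℂ g (closedBall c |R|) := by rwa [habs]
  rw [hg'.circleAverage_log_norm hR.ne' h0]
  -- In Jensen's formula the zeros contribute `log (R / ‖c - u‖) ≥ 0`, with nonnegative multiplicity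
  -- because `g` has no poles.
  refine le_add_of_nonneg_left (finsum_nonneg fun u => ?_)
  by_cases hu : u ∈ closedBall c |R|
  · refine mul_nonneg (mod_cast MeromorphicOn.AnalyticOnNhd.divisor_nonneg hg' u) ?_
    rcases eq_or_ne u c with rfl | huc
    · simp
    · have hpos : 0 < ‖c - u‖ := norm_pos_iff.2 (sub_ne_zero.2 huc.symm)
      apply Real.log_nonneg
      rw [← div_eq_mul_inv, one_le_div hpos, ← dist_eq_norm, dist_comm]
      simpa [habs] using hu
  · simp [hu]

/-- A set of small area meets some circle in a set of small angular measure. -/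
theorem exists_radius_volume_le {S : Set ℂ} (hS : MeasurableSet S) (c : ℂ) {r₁ r₂ ε : ℝ}
    (hr₁ : 0 < r₁) (hε : 0 < ε)
    (hvol : volume S < ENNReal.ofReal (r₁ * (r₂ - r₁) * ε)) :
    ∃ ρ ∈ Ioo r₁ r₂,
      volume (Ioo (-Real.pi) Real.pi ∩ circleMap c ρ ⁻¹' S) ≤ ENNReal.ofReal ε := by
  by_contra! hcon
  set S' : Set ℂ := (fun z => c + z) ⁻¹' S with hS'
  have hS'm : MeasurableSet S' := hS.preimage (by fun_prop)
  have hvol' : volume S' = volume S := measure_preimage_add volume c S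
  have hpolar := Complex.lintegral_comp_polarCoord_symm (S'.indicator 1)
  rw [lintegral_indicator_one hS'm, hvol'] at hpolar
  have hsub : Ioo r₁ r₂ ×ˢ Ioo (-Real.pi) Real.pi ⊆ polarCoord.target := by
    rintro ⟨a, b⟩ ⟨ha, hb⟩
    exact ⟨hr₁.trans ha.1, hb⟩
  have hmono := lintegral_mono_set (μ := volume) (f := fun p : ℝ × ℝ =>
    ENNReal.ofReal p.1 • (S'.indicator 1 (Complex.polarCoord.symm p) : ENNReal)) hsub
  have hmeas : Measurable fun p : ℝ × ℝ =>
      ENNReal.ofReal p.1 • (S'.indicator 1 (Complex.polarCoord.symm p) : ENNReal) := by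
    have h1 : Measurable fun p : ℝ × ℝ => Complex.polarCoord.symm p := by
      simp only [Complex.polarCoord_symm_apply]; fun_prop
    exact (ENNReal.measurable_ofReal.comp measurable_fst).smul
      ((measurable_one.indicator hS'm).comp h1)
  have hprod : (volume : Measure (ℝ × ℝ)).restrict (Ioo r₁ r₂ ×ˢ Ioo (-Real.pi) Real.pi)
      = (volume.restrict (Ioo r₁ r₂)).prod (volume.restrict (Ioo (-Real.pi) Real.pi)) := by
    rw [Measure.prod_restrict]; rfl
  rw [hprod, lintegral_prod _ hmeas.aemeasurable] at hmono
  -- The polar density `x` is at least `r₁` on the annulus. If every circle met `S` in angular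
  -- measure above `ε`, the area of `S` would be at least `r₁ (r₂ - r₁) ε`.
  have hlow : ENNReal.ofReal (r₁ * (r₂ - r₁) * ε) ≤ ∫⁻ x in Ioo r₁ r₂,
      ∫⁻ y in Ioo (-Real.pi) Real.pi,
        ENNReal.ofReal x • (S'.indicator 1 (Complex.polarCoord.symm (x, y)) : ENNReal) := by
    have : ENNReal.ofReal (r₁ * (r₂ - r₁) * ε)
        = ∫⁻ _ in Ioo r₁ r₂, ENNReal.ofReal (r₁ * ε) := by
      rw [lintegral_const, Measure.restrict_apply_univ, Real.volume_Ioo,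
        ← ENNReal.ofReal_mul (by positivity)]
      congr 1; ring
    rw [this]
    refine setLIntegral_mono' measurableSet_Ioo fun x hx => ?_
    have hcm : ∀ y : ℝ, (S'.indicator 1 (Complex.polarCoord.symm (x, y)) : ENNReal)
        = (circleMap c x ⁻¹' S).indicator 1 y := by
      intro y
      have : c + Complex.polarCoord.symm (x, y) = circleMap c x y := by
        rw [Complex.polarCoord_symm_apply, circleMap, Complex.exp_mul_I]
        push_cast; ring
      have hiff : Complex.polarCoord.symm (x, y) ∈ S' ↔ y ∈ circleMap c x ⁻¹' S := by
        rw [hS', mem_preimage, mem_preimage, this]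
      by_cases hy : y ∈ circleMap c x ⁻¹' S
      · rw [indicator_of_mem hy, indicator_of_mem (hiff.2 hy)]; rfl
      · rw [indicator_of_notMem hy, indicator_of_notMem (mt hiff.1 hy)]
    simp only [hcm, smul_eq_mul]
    have hcmm : MeasurableSet (circleMap c x ⁻¹' S) := hS.preimage (continuous_circleMap c x).measurable
    rw [lintegral_const_mul _ (measurable_one.indicator hcmm), lintegral_indicator_one hcmm,
      Measure.restrict_apply hcmm, inter_comm, ENNReal.ofReal_mul hr₁.le]
    exact mul_le_mul' (ENNReal.ofReal_le_ofReal hx.1.le) (hcon x hx).le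
  exact absurd (hlow.trans (hmono.trans hpolar.le)) (not_le.2 hvol)

/-- A two-constants estimate: some circle around `c` meets `S` in angular measure at most `2πε`.
There `log ‖g‖ ≤ log B`, elsewhere on the circle it is at most `0`, so its mean, which dominates
`log ‖g c‖`, is at most `ε log B`. -/
theorem norm_le_rpow_of_norm_le_one_off {g : ℂ → ℂ} {c : ℂ} {r₁ r₂ B ε : ℝ} {S : Set ℂ}
    (hr₁ : 0 < r₁) (hε : 0 < ε) (hB : 1 ≤ B) (hS : MeasurableSet S)
    (hg : AnalyticOnNhd ℂ g (closedBall c r₂))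
    (hgB : ∀ w ∈ closedBall c r₂, ‖g w‖ ≤ B) (hg1 : ∀ w ∈ closedBall c r₂, w ∉ S → ‖g w‖ ≤ 1)
    (hvol : volume S < ENNReal.ofReal (r₁ * (r₂ - r₁) * (2 * Real.pi * ε))) :
    ‖g c‖ ≤ B ^ ε := by
  have hπ := Real.pi_pos
  have hB0 : 0 < B := by linarith
  rcases eq_or_ne (g c) 0 with h0 | h0
  · rw [h0, norm_zero]; positivity
  obtain ⟨ρ, hρ, hm⟩ := exists_radius_volume_le hS c hr₁ (by positivity) hvol
  have hρ0 : 0 < ρ := hr₁.trans hρ.1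
  have hgρ : AnalyticOnNhd ℂ g (closedBall c ρ) := hg.mono (closedBall_subset_closedBall hρ.2.le)
  have key := log_norm_le_circleAverage hρ0 hgρ h0
  have hint : CircleIntegrable (fun z => Real.log ‖g z‖) c ρ := by
    refine MeromorphicOn.circleIntegrable_log_norm fun z hz => (hgρ z ?_).meromorphicAt
    rw [abs_of_pos hρ0] at hz
    exact sphere_subset_closedBall hz
  -- The average is recentred on `(-π, π)`, the range of the angle in polar coordinates.
  rw [Real.circleAverage_eq_integral_add (-Real.pi)] at key
  have hset : MeasurableSet (circleMap c ρ ⁻¹' S) := hS.preimage (continuous_circleMap c ρ).measurable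
  set φ : ℝ → ℝ := (circleMap c ρ ⁻¹' S).indicator fun _ => Real.log B with hφ
  have hle : ∀ θ, Real.log ‖g (circleMap c ρ θ)‖ ≤ φ θ := by
    intro θ
    have hmem : circleMap c ρ θ ∈ closedBall c r₂ :=
      closedBall_subset_closedBall hρ.2.le
        (sphere_subset_closedBall (circleMap_mem_sphere c hρ0.le θ))
    by_cases hθ : circleMap c ρ θ ∈ S
    · have : φ θ = Real.log B := indicator_of_mem (s := circleMap c ρ ⁻¹' S) hθ _
      rw [this]
      rcases eq_or_ne (g (circleMap c ρ θ)) 0 with hz | hz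
      · simp [hz, Real.log_nonneg hB]
      · exact Real.log_le_log (norm_pos_iff.2 hz) (hgB _ hmem)
    · have : φ θ = 0 := indicator_of_notMem (s := circleMap c ρ ⁻¹' S) hθ _
      rw [this]
      exact Real.log_nonpos (norm_nonneg _) (hg1 _ hmem hθ)
  have hφint : IntervalIntegrable φ volume (-Real.pi) Real.pi := by
    rw [intervalIntegrable_iff_integrableOn_Ioc_of_le (by linarith)]
    exact (integrableOn_const (by simp)).indicator hset
  have hshift : (∫ θ in (0 : ℝ)..2 * Real.pi, Real.log ‖g (circleMap c ρ (θ + -Real.pi))‖)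
      = ∫ θ in (-Real.pi)..Real.pi, Real.log ‖g (circleMap c ρ θ)‖ := by
    rw [intervalIntegral.integral_comp_add_right
      (fun θ => Real.log ‖g (circleMap c ρ θ)‖) (-Real.pi)]
    congr 1 <;> ring
  have hint' : IntervalIntegrable (fun θ => Real.log ‖g (circleMap c ρ θ)‖) volume
      (-Real.pi) Real.pi := by
    have hper : Function.Periodic (fun θ => Real.log ‖g (circleMap c ρ θ)‖) (2 * Real.pi) :=
      fun θ => by simp only [periodic_circleMap c ρ θ]
    exact hper.intervalIntegrable₀ (by positivity) hint _ _
  rw [hshift] at key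
  have hI : (∫ θ in (-Real.pi)..Real.pi, Real.log ‖g (circleMap c ρ θ)‖)
      ≤ (2 * Real.pi * ε) * Real.log B := by
    refine (intervalIntegral.integral_mono (by linarith) hint' hφint hle).trans ?_
    rw [intervalIntegral.integral_of_le (by linarith), integral_Ioc_eq_integral_Ioo,
      integral_indicator_const _ hset, smul_eq_mul]
    refine mul_le_mul_of_nonneg_right ?_ (Real.log_nonneg hB)
    rw [Measure.real, Measure.restrict_apply hset, inter_comm]
    exact ENNReal.toReal_le_of_le_ofReal (by positivity) hm
  rw [← Real.log_le_log_iff (norm_pos_iff.2 h0) (by positivity), Real.log_rpow hB0]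
  refine key.trans ?_
  rw [smul_eq_mul, inv_mul_le_iff₀ (by positivity)]
  linarith

end SliceAnalysis

/-! ### Hartogs' lemma on sequences and Osgood's lemma -/

noncomputable section

open Complex Metric MeasureTheory Set Filter Topology

namespace SliceAnalysis

/-- **Hartogs' lemma** on sequences of holomorphic functions, in a form where the functions are
indexed by an arbitrary type with a weight `d`. -/
theorem exists_uniform_bound_of_pointwise_bound {ι : Type*} {g : ι → ℂ → ℂ} {d : ι → ℕ} {c : ℂ}
    {R M A A' B : ℝ} (hR : 0 < R) (hA : 0 < A) (hAB : A ≤ B) (hA' : A < A') (hM : 1 ≤ M)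
    (hg : ∀ i, DifferentiableOn ℂ (g i) (ball c R))
    (hB : ∀ i, ∀ w ∈ ball c R, ‖g i w‖ ≤ M * B ^ d i)
    (hpt : ∀ w ∈ ball c R, ∃ C : ℝ, ∀ i, ‖g i w‖ ≤ C * A ^ d i) :
    ∃ C : ℝ, ∀ i, ∀ w ∈ ball c (R / 2), ‖g i w‖ ≤ C * A' ^ d i := by
  -- `S N` is where the pointwise bound fails with constant `N + 1`. These open sets decrease to the
  -- empty set, so their areas tend to `0`. Using `N + 1` keeps the normalising constant `K` below
  -- positive.
  set S : ℕ → Set ℂ := fun N => {w ∈ ball c R | ∃ i, (N + 1) * A ^ d i < ‖g i w‖} with hSdef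
  have hSopen : ∀ N, IsOpen (S N) := by
    intro N
    have : S N = ⋃ i, ball c R ∩ (fun w => ‖g i w‖) ⁻¹' Ioi ((N + 1) * A ^ d i) := by
      ext w; simp [hSdef]
    rw [this]
    exact isOpen_iUnion fun i =>
      (hg i).continuousOn.norm.isOpen_inter_preimage isOpen_ball isOpen_Ioi
  have hanti : Antitone S := by
    rintro N N' hN w ⟨hw, i, hi⟩
    refine ⟨hw, i, lt_of_le_of_lt ?_ hi⟩
    gcongr
  have hempty : ⋂ N, S N = ∅ := by
    rw [eq_empty_iff_forall_notMem]
    intro w hw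
    rw [mem_iInter] at hw
    obtain ⟨C, hC⟩ := hpt w (hw 0).1
    obtain ⟨N, hN⟩ := exists_nat_ge C
    obtain ⟨-, i, hi⟩ := hw N
    have h1 : ‖g i w‖ ≤ (N + 1) * A ^ d i :=
      (hC i).trans (mul_le_mul_of_nonneg_right (by linarith) (by positivity))
    exact absurd hi (not_lt.2 h1)
  have hlim : Tendsto (fun N => volume (S N)) atTop (𝓝 0) := by
    have := tendsto_measure_iInter_atTop (μ := volume)
      (fun N => (hSopen N).measurableSet.nullMeasurableSet) hanti
      ⟨0, ((measure_mono (fun w hw => hw.1)).trans_lt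
        (measure_ball_lt_top (x := c) (r := R))).ne⟩
    rwa [hempty, measure_empty] at this
  have hAp : 1 ≤ B / A := (one_le_div hA).2 hAB
  have hq : 0 < B / A := by linarith
  -- The exponent is chosen so that the a priori rate `B`, damped by `ε`, costs only the factor `A'
  -- / A` per degree; `ε ≤ 1` gives `M ^ ε ≤ M`.
  obtain ⟨ε, hε0, hε1, hε⟩ : ∃ ε : ℝ, 0 < ε ∧ ε ≤ 1 ∧ (B / A) ^ ε ≤ A' / A := by
    have hcont : Tendsto (fun ε : ℝ => (B / A) ^ ε) (𝓝[>] 0) (𝓝 1) := by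
      have := (Real.continuousAt_const_rpow (b := 0) hq.ne').tendsto
      rw [Real.rpow_zero] at this
      exact this.mono_left nhdsWithin_le_nhds
    have h1 := hcont.eventually_lt_const ((one_lt_div hA).2 hA')
    have h2 : ∀ᶠ ε : ℝ in 𝓝[>] 0, ε < 1 :=
      nhdsWithin_le_nhds (gt_mem_nhds one_pos)
    obtain ⟨ε, ⟨h3, h4⟩, h5⟩ := ((h1.and h2).and self_mem_nhdsWithin).exists
    exact ⟨ε, h5, h4.le, h3.le⟩
  have hpos : (0 : ENNReal) <
      ENNReal.ofReal (R / 8 * (R / 4 - R / 8) * (2 * Real.pi * ε)) := by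
    rw [ENNReal.ofReal_pos]
    have : 0 < R / 4 - R / 8 := by linarith
    positivity
  obtain ⟨N, hN⟩ := (hlim.eventually_lt_const hpos).exists
  refine ⟨(N + 1) * M, fun i z hz => ?_⟩
  have hsub : closedBall z (R / 4) ⊆ ball c R := by
    intro w hw
    rw [mem_ball] at hz ⊢
    rw [mem_closedBall] at hw
    linarith [dist_triangle w z c]
  set K : ℝ := (N + 1) * A ^ d i with hK
  have hK0 : 0 < K := by positivity
  have hnorm : ∀ w, ‖(K : ℂ)⁻¹ * g i w‖ = K⁻¹ * ‖g i w‖ := fun w => by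
    rw [norm_mul, norm_inv, Complex.norm_real, Real.norm_eq_abs, abs_of_pos hK0]
  have hM0 : 0 < M := by linarith
  have key := norm_le_rpow_of_norm_le_one_off (g := fun w => (K : ℂ)⁻¹ * g i w) (c := z)
    (r₁ := R / 8) (r₂ := R / 4) (B := M * (B / A) ^ d i) (ε := ε) (by positivity) hε0
    (one_le_mul_of_one_le_of_one_le hM (one_le_pow₀ hAp)) (hSopen N).measurableSet
    (fun w hw => analyticAt_const.mul
      ((hg i).analyticAt (isOpen_ball.mem_nhds (hsub hw))))
    (fun w hw => by
      rw [hnorm, inv_mul_le_iff₀ hK0]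
      refine (hB i w (hsub hw)).trans ?_
      have : K * (M * (B / A) ^ d i) = (N + 1) * (M * B ^ d i) := by
        rw [hK, div_pow]; field_simp
      rw [this]
      have hBp : 0 < M * B ^ d i := by
        have : 0 < B := by linarith
        positivity
      nlinarith [Nat.cast_nonneg (α := ℝ) N])
    (fun w hw hwS => by
      rw [hnorm, inv_mul_le_iff₀ hK0, mul_one]
      by_contra hcon
      exact hwS ⟨hsub hw, i, not_le.1 hcon⟩)
    hN
  rw [hnorm, inv_mul_le_iff₀ hK0] at key
  refine key.trans ?_
  have h1 : (M * (B / A) ^ d i) ^ ε ≤ M * (A' / A) ^ d i := by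
    rw [Real.mul_rpow hM0.le (by positivity), ← Real.rpow_natCast, ← Real.rpow_mul hq.le,
      mul_comm (d i : ℝ), Real.rpow_mul hq.le, Real.rpow_natCast]
    gcongr
    exact Real.rpow_le_self_of_one_le hM hε1
  calc K * (M * (B / A) ^ d i) ^ ε ≤ K * (M * (A' / A) ^ d i) := by gcongr
    _ = (N + 1) * M * A' ^ d i := by rw [hK, div_pow]; field_simp

/-! ### Osgood's lemma -/

section Osgood

variable {E₁ E₂ G : Type*} [NormedAddCommGroup E₁] [NormedSpace ℂ E₁] [NormedAddCommGroup E₂]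
  [NormedSpace ℂ E₂] [NormedAddCommGroup G] [NormedSpace ℂ G]

/-- `f` is holomorphic in each of the two variables and bounded by `M` on a product of balls. -/
structure BddSepHol (f : E₁ → E₂ → G) (a : E₁) (b : E₂) (R M : ℝ) : Prop where
  left : ∀ w ∈ ball b R, DifferentiableOn ℂ (fun x => f x w) (ball a R)
  right : ∀ x ∈ ball a R, DifferentiableOn ℂ (f x) (ball b R)
  bdd : ∀ x ∈ ball a R, ∀ w ∈ ball b R, ‖f x w‖ ≤ M

theorem BddSepHol.swap {f : E₁ → E₂ → G} {a : E₁} {b : E₂} {R M : ℝ} (h : BddSepHol f a b R M) :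
    BddSepHol (fun w x => f x w) b a R M :=
  ⟨h.right, h.left, fun w hw x hx => h.bdd x hx w hw⟩

/-- Schwarz's lemma: `g` maps the ball of radius `R / 2` around `x'` into a ball of radius `2 M`
around `g x'`, whence the Lipschitz constant `2 M / (R / 2)`. -/
theorem norm_sub_le_of_bounded {g : E₁ → G} {a x x' : E₁} {R M : ℝ}
    (hg : DifferentiableOn ℂ g (ball a R)) (hM : ∀ x ∈ ball a R, ‖g x‖ ≤ M)
    (hx : x ∈ ball a (R / 4)) (hx' : x' ∈ ball a (R / 4)) :
    ‖g x - g x'‖ ≤ 4 * M / R * ‖x - x'‖ := by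
  rw [mem_ball] at hx hx'
  have hsub : ball x' (R / 2) ⊆ ball a R := fun y hy => by
    rw [mem_ball] at hy ⊢
    have := dist_nonneg (x := x) (y := a)
    linarith [dist_triangle y x' a]
  have hx'm : x' ∈ ball x' (R / 2) := mem_ball_self (by
    have := dist_nonneg (x := x) (y := a); linarith)
  have := Complex.dist_le_div_mul_dist_of_mapsTo_ball (f := g) (c := x') (z := x) (R₁ := R / 2)
    (R₂ := 2 * M) (hg.mono hsub) (fun y hy => by
      rw [mem_closedBall, dist_eq_norm]
      refine (norm_sub_le _ _).trans ?_
      linarith [hM y (hsub hy), hM x' (hsub hx'm)])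
    (by rw [mem_ball]; linarith [dist_triangle_right x x' a])
  rw [dist_eq_norm, dist_eq_norm] at this
  refine this.trans (le_of_eq ?_)
  congr 1
  have hR : R ≠ 0 := by
    rintro rfl
    have := dist_nonneg (x := x) (y := a)
    simp at hx
    linarith
  field_simp; ring

theorem BddSepHol.norm_sub_le {f : E₁ → E₂ → G} {a : E₁} {b : E₂} {R M : ℝ}
    (h : BddSepHol f a b R M) {x x' : E₁} {w w' : E₂} (hx : x ∈ ball a (R / 4))
    (hx' : x' ∈ ball a (R / 4)) (hw : w ∈ ball b (R / 4)) (hw' : w' ∈ ball b (R / 4)) :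
    ‖f x w - f x' w'‖ ≤ 4 * M / R * (‖x - x'‖ + ‖w - w'‖) := by
  have hR : R / 4 ≤ R := by
    have := dist_nonneg (x := x) (y := a); rw [mem_ball] at hx; linarith
  have h1 := norm_sub_le_of_bounded (h.left w (ball_subset_ball hR hw))
    (fun x hx => h.bdd x hx w (ball_subset_ball hR hw)) hx hx'
  have h2 := norm_sub_le_of_bounded (h.right x' (ball_subset_ball hR hx'))
    (fun w hw => h.bdd x' (ball_subset_ball hR hx') w hw) hw hw'
  calc ‖f x w - f x' w'‖ = ‖(f x w - f x' w) + (f x' w - f x' w')‖ := by congr 1; abel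
    _ ≤ _ := norm_add_le _ _
    _ ≤ _ := by rw [mul_add]; exact add_le_add h1 h2

/-- The difference of two translates, `v ↦ f (x + v) w - f (a + v) b`, is uniformly small by the
Lipschitz bound, and Cauchy's estimate passes the smallness to its derivative at `0`. Continuity of
both partial derivatives is what Osgood's lemma needs. -/
theorem BddSepHol.continuousAt_fderiv_left {f : E₁ → E₂ → G} {a : E₁} {b : E₂} {R M : ℝ}
    (hR : 0 < R) (h : BddSepHol f a b R M) :
    ContinuousAt (fun p : E₁ × E₂ => fderiv ℂ (fun x => f x p.2) p.1) (a, b) := by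
  have hM : 0 ≤ M := (norm_nonneg _).trans (h.bdd a (mem_ball_self hR) b (mem_ball_self hR))
  have hnhds : ball a (R / 8) ×ˢ ball b (R / 8) ∈ 𝓝 (a, b) :=
    prod_mem_nhds (ball_mem_nhds _ (by positivity)) (ball_mem_nhds _ (by positivity))
  have hbound : ∀ p ∈ ball a (R / 8) ×ˢ ball b (R / 8),
      ‖fderiv ℂ (fun x => f x p.2) p.1 - fderiv ℂ (fun x => f x b) a‖
        ≤ 2 * (4 * M / R * (‖p.1 - a‖ + ‖p.2 - b‖)) / (R / 8) := by
    rintro ⟨x, w⟩ ⟨hx, hw⟩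
    simp only at hx hw ⊢
    set u : E₁ → G := fun v => f (x + v) w - f (a + v) b with hu
    have hmem : ∀ v ∈ ball (0 : E₁) (R / 8), x + v ∈ ball a (R / 4) ∧ a + v ∈ ball a (R / 4) := by
      intro v hv
      rw [mem_ball_zero_iff] at hv
      rw [mem_ball, dist_eq_norm] at hx
      constructor <;> rw [mem_ball, dist_eq_norm]
      · calc ‖x + v - a‖ = ‖(x - a) + v‖ := by congr 1; abel
          _ ≤ _ := norm_add_le _ _
          _ < _ := by linarith
      · rw [add_sub_cancel_left]; linarith
    have hsub : ball a (R / 4) ⊆ ball a R := ball_subset_ball (by linarith)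
    have hw4 : w ∈ ball b (R / 4) := ball_subset_ball (by linarith) hw
    have hb4 : b ∈ ball b (R / 4) := mem_ball_self (by linarith)
    have hwR : w ∈ ball b R := ball_subset_ball (by linarith) hw
    have hd1 : ∀ v ∈ ball (0 : E₁) (R / 8),
        DifferentiableAt ℂ (fun v => f (x + v) w) v := fun v hv =>
      DifferentiableAt.comp (g := fun x => f x w) v ((h.left w hwR).differentiableAt
        (isOpen_ball.mem_nhds (hsub (hmem v hv).1))) (by fun_prop)
    have hd2 : ∀ v ∈ ball (0 : E₁) (R / 8),
        DifferentiableAt ℂ (fun v => f (a + v) b) v := fun v hv =>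
      DifferentiableAt.comp (g := fun x => f x b) v ((h.left b (mem_ball_self hR)).differentiableAt
        (isOpen_ball.mem_nhds (hsub (hmem v hv).2))) (by fun_prop)
    have h0 : (0 : E₁) ∈ ball (0 : E₁) (R / 8) := mem_ball_self (by positivity)
    have hub : ∀ v ∈ ball (0 : E₁) (R / 8), ‖u v‖ ≤ 4 * M / R * (‖x - a‖ + ‖w - b‖) := by
      intro v hv
      have := h.norm_sub_le (hmem v hv).1 (hmem v hv).2 hw4 hb4
      simpa using this
    have hfd : fderiv ℂ u 0 = fderiv ℂ (fun x => f x w) x - fderiv ℂ (fun x => f x b) a := by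
      rw [hu, fderiv_fun_sub (hd1 0 h0) (hd2 0 h0),
        fderiv_comp_add_left (f := fun x => f x w), fderiv_comp_add_left (f := fun x => f x b),
        add_zero, add_zero]
    rw [← hfd]
    refine Complex.norm_fderiv_le_div_of_mapsTo_ball (R₁ := R / 8)
      (fun v hv => ((hd1 v hv).sub (hd2 v hv)).differentiableWithinAt) (fun v hv => ?_)
      (by positivity)
    rw [mem_closedBall, dist_eq_norm]
    refine (_root_.norm_sub_le _ _).trans ?_
    linarith [hub v hv, hub 0 h0]
  rw [ContinuousAt, tendsto_iff_norm_sub_tendsto_zero]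
  refine squeeze_zero' (Eventually.of_forall fun _ => norm_nonneg _)
    (eventually_of_mem hnhds hbound) ?_
  have : Continuous fun p : E₁ × E₂ =>
    2 * (4 * M / R * (‖p.1 - a‖ + ‖p.2 - b‖)) / (R / 8) := by fun_prop
  have h2 := this.tendsto (a, b)
  simpa using h2

/-- **Osgood's lemma**. -/
theorem BddSepHol.differentiableAt {f : E₁ → E₂ → G} {a : E₁} {b : E₂} {R M : ℝ} (hR : 0 < R)
    (h : BddSepHol f a b R M) : DifferentiableAt ℂ (fun p : E₁ × E₂ => f p.1 p.2) (a, b) := by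
  have hnhds : ball a R ×ˢ ball b R ∈ 𝓝 (a, b) :=
    prod_mem_nhds (ball_mem_nhds _ hR) (ball_mem_nhds _ hR)
  refine HasFDerivAt.differentiableAt (HasStrictFDerivAt.hasFDerivAt
    (hasStrictFDerivAt_uncurry_coprod (u := (a, b)) (f := f)
      (f₁ := fun x w => fderiv ℂ (fun x => f x w) x) (f₂ := fun x w => fderiv ℂ (f x) w)
      ?_ ?_ ?_ ?_))
  · filter_upwards [hnhds] with p hp
    exact ((h.left p.2 hp.2).differentiableAt (isOpen_ball.mem_nhds hp.1)).hasFDerivAt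
  · filter_upwards [hnhds] with p hp
    exact ((h.right p.1 hp.1).differentiableAt (isOpen_ball.mem_nhds hp.2)).hasFDerivAt
  · exact h.continuousAt_fderiv_left hR
  · exact ContinuousAt.comp (f := Prod.swap) (x := (a, b)) (h.swap.continuousAt_fderiv_left hR)
      continuous_swap.continuousAt

theorem contDiffOn_one_of_differentiableOn {g : E₁ → G} {U : Set E₁} (hU : IsOpen U)
    (hg : DifferentiableOn ℂ g U) : ContDiffOn ℂ 1 g U := by
  rw [show (1 : WithTop ℕ∞) = 0 + 1 from rfl, contDiffOn_succ_iff_fderiv_of_isOpen hU,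
    contDiffOn_zero]
  refine ⟨hg, by simp, fun a ha => ContinuousAt.continuousWithinAt ?_⟩
  have hc : ContinuousAt g a := hg.continuousOn.continuousAt (hU.mem_nhds ha)
  obtain ⟨R, hR, hball⟩ := Metric.mem_nhds_iff.1 (inter_mem (hU.mem_nhds ha)
    (hc.norm.eventually (gt_mem_nhds (lt_add_one ‖g a‖))))
  -- A dummy second variable makes the continuity of partial derivatives applicable to a function of
  -- one group of variables.
  have hB : BddSepHol (fun x (_ : ℂ) => g x) a 0 R (‖g a‖ + 1) :=
    ⟨fun w _ => hg.mono fun x hx => (hball hx).1, fun x _ => differentiableOn_const _,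
      fun x hx w _ => (hball hx).2.le⟩
  exact ContinuousAt.comp (f := fun x : E₁ => (x, (0 : ℂ))) (hB.continuousAt_fderiv_left hR)
    (by fun_prop)

end Osgood

end SliceAnalysis

noncomputable section

open Complex Metric MeasureTheory Set Filter Topology

namespace SliceAnalysis

/-! ### Hartogs' theorem -/

/-- A circle integral depends holomorphically on a parameter. -/
theorem differentiableAt_circleIntegral {φ : ℂ → ℂ → ℂ} {c w₀ : ℂ} {r s : ℝ} (hr : 0 ≤ r)
    (hs : 0 < s)
    (hcont : ContinuousOn (fun p : ℂ × ℂ => φ p.1 p.2) (sphere c r ×ˢ ball w₀ s))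
    (hol : ∀ z ∈ sphere c r, DifferentiableOn ℂ (φ z) (ball w₀ s)) :
    DifferentiableAt ℂ (fun w => ∮ z in C(c, r), φ z w) w₀ := by
  have hsub : closedBall w₀ (s / 2) ⊆ ball w₀ s := closedBall_subset_ball (by linarith)
  obtain ⟨M, hM⟩ := ((isCompact_sphere c r).prod (isCompact_closedBall w₀ (s / 2))).exists_bound_of_continuousOn
    (hcont.mono (prod_mono_right hsub))
  have hcm : ∀ θ, circleMap c r θ ∈ sphere c r := circleMap_mem_sphere c hr
  have hslice : ∀ w ∈ ball w₀ s, Continuous fun θ => φ (circleMap c r θ) w := fun w hw =>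
    hcont.comp_continuous (f := fun θ : ℝ => (circleMap c r θ, w))
      (by fun_prop) fun θ => ⟨hcm θ, hw⟩
  have hd : ∀ θ, ∀ w ∈ ball w₀ s, HasDerivAt (φ (circleMap c r θ))
      (deriv (φ (circleMap c r θ)) w) w := fun θ w hw =>
    ((hol _ (hcm θ)).differentiableAt (isOpen_ball.mem_nhds hw)).hasDerivAt
  have hw₀ : w₀ ∈ ball w₀ s := mem_ball_self hs
  -- The derivative is a pointwise limit of difference quotients continuous in `θ`. The increments
  -- `s / (N + 2)` are smaller than `s`, so the points stay in the ball.
  have hderiv_meas : Measurable fun θ => deriv (φ (circleMap c r θ)) w₀ := by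
    have hseq : Tendsto (fun N : ℕ => w₀ + (s / (N + 2) : ℝ)) atTop (𝓝[≠] w₀) := by
      rw [tendsto_nhdsWithin_iff]
      constructor
      · have h1 : Tendsto (fun N : ℕ => s / ((N : ℝ) + 2)) atTop (𝓝 0) :=
          tendsto_const_nhds.div_atTop (tendsto_atTop_add_const_right _ _ tendsto_natCast_atTop_atTop)
        have h2 := (Complex.continuous_ofReal.tendsto 0).comp h1
        simpa using tendsto_const_nhds.add h2
      · refine Eventually.of_forall fun N => ?_
        have : s / ((N : ℝ) + 2) ≠ 0 := by positivity
        rw [mem_compl_singleton_iff, Ne, add_eq_left, Complex.ofReal_eq_zero]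
        exact this
    refine measurable_of_tendsto_metrizable
      (f := fun (N : ℕ) θ => slope (φ (circleMap c r θ)) w₀ (w₀ + (s / (N + 2) : ℝ)))
      (fun N => ?_) (tendsto_pi_nhds.2 fun θ =>
        (hasDerivAt_iff_tendsto_slope.1 (hd θ w₀ hw₀)).comp hseq)
    have hmem : w₀ + ((s / (N + 2) : ℝ) : ℂ) ∈ ball w₀ s := by
      rw [mem_ball, dist_eq_norm, add_sub_cancel_left, Complex.norm_real, Real.norm_eq_abs,
        abs_of_pos (by positivity)]
      rw [div_lt_iff₀ (by positivity)]
      nlinarith [Nat.cast_nonneg (α := ℝ) N]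
    simp only [slope, vsub_eq_sub]
    exact Continuous.measurable
      (Continuous.fun_const_smul (Continuous.fun_sub (hslice _ hmem) (hslice _ hw₀)) _)
  have hbound : ∀ θ, ∀ w ∈ ball w₀ (s / 4),
      ‖deriv (φ (circleMap c r θ)) w‖ ≤ M / (s / 4) := by
    intro θ w hw
    have hcb : closedBall w (s / 4) ⊆ closedBall w₀ (s / 2) := by
      intro y hy
      rw [mem_closedBall] at hy ⊢
      rw [mem_ball] at hw
      linarith [dist_triangle y w w₀]
    refine norm_deriv_le_of_forall_mem_sphere_norm_le (by positivity)
      (((hol _ (hcm θ)).mono (hcb.trans hsub)).diffContOnCl_ball Subset.rfl) fun z hz => ?_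
    exact hM (circleMap c r θ, z) ⟨hcm θ, hcb (sphere_subset_closedBall hz)⟩
  have hcmd : Continuous fun θ => deriv (circleMap c r) θ := by
    simp only [deriv_circleMap]; fun_prop
  have key := intervalIntegral.hasDerivAt_integral_of_dominated_loc_of_deriv_le (μ := volume)
    (a := 0) (b := 2 * Real.pi) (x₀ := w₀) (s := ball w₀ (s / 4))
    (F := fun w θ => deriv (circleMap c r) θ • φ (circleMap c r θ) w)
    (F' := fun w θ => deriv (circleMap c r) θ • deriv (φ (circleMap c r θ)) w)
    (bound := fun θ => ‖deriv (circleMap c r) θ‖ * (M / (s / 4)))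
    (ball_mem_nhds w₀ (by positivity)) ?_ ?_ ?_ ?_ ?_ ?_
  · exact key.2.differentiableAt
  · filter_upwards [ball_mem_nhds w₀ hs] with w hw
    exact (hcmd.smul (hslice w hw)).aestronglyMeasurable
  · exact (hcmd.smul (hslice w₀ hw₀)).intervalIntegrable _ _
  · exact (hcmd.measurable.smul hderiv_meas).aestronglyMeasurable
  · refine Eventually.of_forall fun θ _ w hw => ?_
    rw [norm_smul]
    exact mul_le_mul_of_nonneg_left (hbound θ w hw) (norm_nonneg _)
  · exact (hcmd.norm.mul continuous_const).intervalIntegrable _ _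
  · exact Eventually.of_forall fun θ _ w hw =>
      (hd θ w (ball_subset_ball (by linarith) hw)).fun_const_smul _

/-- By Cauchy's formula the derivative at the centre is a circle integral whose integrand depends
holomorphically on `w`. -/
theorem differentiableAt_deriv_param {φ : ℂ → ℂ → ℂ} {c w₀ : ℂ} {r s : ℝ} (k : ℕ) (hr : 0 < r)
    (hs : 0 < s)
    (hcont : ContinuousOn (fun p : ℂ × ℂ => φ p.1 p.2) (closedBall c r ×ˢ ball w₀ s))
    (hol₁ : ∀ w ∈ ball w₀ s, DifferentiableOn ℂ (fun z => φ z w) (ball c r))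
    (hol₂ : ∀ z ∈ sphere c r, DifferentiableOn ℂ (φ z) (ball w₀ s)) :
    DifferentiableAt ℂ (fun w => iteratedDeriv k (fun z => φ z w) c) w₀ := by
  have h1 : DifferentiableAt ℂ (fun w => ∮ z in C(c, r), (1 / (z - c) ^ (k + 1)) • φ z w) w₀ := by
    refine differentiableAt_circleIntegral (φ := fun z w => (1 / (z - c) ^ (k + 1)) • φ z w)
      hr.le hs ?_ fun z hz => (hol₂ z hz).fun_const_smul _
    refine ContinuousOn.fun_smul (f := fun p : ℂ × ℂ => 1 / (p.1 - c) ^ (k + 1)) ?_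
      (hcont.mono (prod_mono_left sphere_subset_closedBall))
    refine ContinuousOn.div continuousOn_const (by fun_prop) ?_
    rintro ⟨z, w⟩ ⟨hz, -⟩
    have : z - c ≠ 0 := by
      rw [← norm_pos_iff, mem_sphere_iff_norm.1 hz]; exact hr
    exact pow_ne_zero _ this
  have h2 : (fun w => iteratedDeriv k (fun z => φ z w) c) =ᶠ[𝓝 w₀]
      fun w => (2 * Real.pi * I / k.factorial : ℂ)⁻¹ •
        ∮ z in C(c, r), (1 / (z - c) ^ (k + 1)) • φ z w := by
    filter_upwards [ball_mem_nhds w₀ hs] with w hw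
    have hdc : DiffContOnCl ℂ (fun z => φ z w) (ball c r) := by
      refine ⟨hol₁ w hw, ?_⟩
      rw [closure_ball c hr.ne']
      exact hcont.comp (f := fun z => (z, w)) (by fun_prop) fun z hz => ⟨hz, hw⟩
    rw [hdc.circleIntegral_one_div_sub_center_pow_smul hr k, smul_smul, inv_mul_cancel₀, one_smul]
    simp [Nat.factorial_ne_zero]
  exact (h1.fun_const_smul _).congr_of_eventuallyEq h2

/-- Baire's theorem: compactness of `closedBall b s` bounds each `f x`, so the sets of `x` with
bound `N` are closed and cover; one of them has interior. The centre `a'` cannot be prescribed,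
which is why Hartogs' lemma is needed afterwards. -/
theorem exists_ball_bounded_of_separately_holomorphic {E : Type*} [NormedAddCommGroup E]
    [NormedSpace ℂ E] [CompleteSpace E] {f : E → ℂ → ℂ} {a : E} {b : ℂ} {ρ s : ℝ} (hρ : 0 < ρ)
    (h1 : ∀ w ∈ closedBall b s, ContinuousOn (fun x => f x w) (closedBall a ρ))
    (h2 : ∀ x ∈ ball a ρ, ContinuousOn (f x) (closedBall b s)) :
    ∃ a' ∈ ball a ρ, ∃ r > 0, ∃ M, ∀ x ∈ ball a' r, ∀ w ∈ closedBall b s, ‖f x w‖ ≤ M := by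
  -- The complement of the ball is added so that the closed sets cover all of `E`.
  set T : ℕ → Set E := fun N =>
    {x ∈ closedBall a ρ | ∀ w ∈ closedBall b s, ‖f x w‖ ≤ N} ∪ (ball a ρ)ᶜ with hT
  have hclosed : ∀ N, IsClosed (T N) := by
    intro N
    refine IsClosed.union ?_ isOpen_ball.isClosed_compl
    have : {x ∈ closedBall a ρ | ∀ w ∈ closedBall b s, ‖f x w‖ ≤ N}
        = closedBall a ρ ∩ ⋂ w ∈ closedBall b s,
          (closedBall a ρ ∩ (fun x => ‖f x w‖) ⁻¹' Iic (N : ℝ)) := by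
      ext x
      simp only [mem_ofPred_eq, mem_inter_iff, mem_iInter, mem_preimage, mem_Iic]
      exact and_congr_right fun hx => forall₂_congr fun w _ => (and_iff_right hx).symm
    rw [this]
    exact isClosed_closedBall.inter (isClosed_biInter fun w hw =>
      (h1 w hw).norm.preimage_isClosed_of_isClosed isClosed_closedBall isClosed_Iic)
  have huniv : ⋃ N, T N = univ := by
    refine eq_univ_of_forall fun x => mem_iUnion.2 ?_
    by_cases hx : x ∈ ball a ρ
    · obtain ⟨C, hC⟩ := (isCompact_closedBall b s).exists_bound_of_continuousOn (h2 x hx)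
      obtain ⟨N, hN⟩ := exists_nat_ge C
      exact ⟨N, Or.inl ⟨ball_subset_closedBall hx, fun w hw => (hC w hw).trans hN⟩⟩
    · exact ⟨0, Or.inr hx⟩
  obtain ⟨a', ha', hint⟩ := (dense_iUnion_interior_of_closed hclosed huniv).inter_open_nonempty
    (ball a ρ) isOpen_ball ⟨a, mem_ball_self hρ⟩
  obtain ⟨N, hN⟩ := mem_iUnion.1 hint
  obtain ⟨r, hr, hball⟩ := Metric.isOpen_iff.1 (isOpen_interior.inter isOpen_ball) a' ⟨hN, ha'⟩
  refine ⟨a', ha', r, hr, N, fun x hx w hw => ?_⟩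
  rcases interior_subset (hball hx).1 with h | h
  · exact h.2 w hw
  · exact absurd (hball hx).2 h

/-- **Hartogs' theorem** for two groups of variables, the second one consisting of a single
variable. -/
theorem differentiableAt_of_separately_holomorphic {E : Type*} [NormedAddCommGroup E]
    [NormedSpace ℂ E] [ProperSpace E] {f : E → ℂ → ℂ} {a : E} {b : ℂ} {R : ℝ} (hR : 0 < R)
    (h1 : ∀ w ∈ ball b R, DifferentiableOn ℂ (fun x => f x w) (ball a R))
    (h2 : ∀ x ∈ ball a R, DifferentiableOn ℂ (f x) (ball b R)) :
    DifferentiableAt ℂ (fun p : E × ℂ => f p.1 p.2) (a, b) := by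
  have hsb : closedBall b (R / 2) ⊆ ball b R := closedBall_subset_ball (by linarith)
  have hsa : closedBall a (R / 4) ⊆ ball a R := closedBall_subset_ball (by linarith)
  obtain ⟨a', ha', r₀, hr₀, M₀, hM₀⟩ := exists_ball_bounded_of_separately_holomorphic
    (f := f) (a := a) (b := b) (ρ := R / 4) (s := R / 2) (by positivity)
    (fun w hw => (h1 w (hsb hw)).continuousOn.mono hsa)
    (fun x hx => (h2 x (hsa (ball_subset_closedBall hx))).continuousOn.mono hsb)
  obtain ⟨r, hr, hrr₀, hrR⟩ : ∃ r > 0, r ≤ r₀ ∧ r ≤ R / 4 :=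
    ⟨min r₀ (R / 4), lt_min hr₀ (by positivity), min_le_left _ _, min_le_right _ _⟩
  obtain ⟨M, hM1, hM⟩ : ∃ M, 1 ≤ M ∧ ∀ x ∈ ball a' r, ∀ w ∈ closedBall b (R / 2), ‖f x w‖ ≤ M :=
    ⟨max M₀ 1, le_max_right _ _, fun x hx w hw =>
      (hM₀ x (ball_subset_ball hrr₀ hx) w hw).trans (le_max_left _ _)⟩
  have hballa' : ball a' (3 * R / 4) ⊆ ball a R := by
    intro x hx
    rw [mem_ball] at hx ha' ⊢
    linarith [dist_triangle x a' a]
  have hline : ∀ v : E, ‖v‖ ≤ 1 → ∀ t : ℂ, ∀ q : ℝ, ‖t‖ < q → a' + t • v ∈ ball a' q := by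
    intro v hv t q ht
    rw [mem_ball, dist_eq_norm, add_sub_cancel_left, norm_smul]
    nlinarith [norm_nonneg t, norm_nonneg v]
  have hu : ∀ v : E, ‖v‖ ≤ 1 → ∀ w ∈ ball b R,
      DifferentiableOn ℂ (fun t : ℂ => f (a' + t • v) w) (ball 0 (3 * R / 4)) := by
    intro v hv w hw
    refine (h1 w hw).comp (f := fun t : ℂ => a' + t • v) (by fun_prop) fun t ht => ?_
    exact hballa' (hline v hv t _ (mem_ball_zero_iff.1 ht))
  -- Taylor coefficients at `a'` along all complex lines. Indexing by degree and direction replaces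
  -- a power series in several variables; the weight in Hartogs' lemma is the degree.
  set g : ℕ × {v : E // ‖v‖ ≤ 1} → ℂ → ℂ := fun i w =>
    (i.1.factorial : ℂ)⁻¹ * iteratedDeriv i.1 (fun t : ℂ => f (a' + t • (i.2 : E)) w) 0 with hg
  have hcauchy : ∀ i, ∀ w ∈ ball b R, ∀ q C : ℝ, 0 < q → q < 3 * R / 4 →
      (∀ t ∈ sphere (0 : ℂ) q, ‖f (a' + t • (i.2 : E)) w‖ ≤ C) → ‖g i w‖ ≤ C * q⁻¹ ^ i.1 := by
    intro i w hw q C hq hqR hC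
    have hcb : closedBall (0 : ℂ) q ⊆ ball 0 (3 * R / 4) := closedBall_subset_ball hqR
    have := norm_iteratedDeriv_le_of_forall_mem_sphere_norm_le i.1 hq
      (((hu i.2 i.2.2 w hw).mono hcb).diffContOnCl_ball Subset.rfl) hC
    rw [hg, norm_mul, norm_inv, Complex.norm_natCast, inv_mul_le_iff₀ (by positivity)]
    refine this.trans (le_of_eq ?_)
    rw [inv_pow]; field_simp
  -- Where `f` is bounded, Osgood's lemma already applies; this makes the coefficients holomorphic
  -- in `w`.
  have hcont : ContinuousOn (fun p : E × ℂ => f p.1 p.2) (ball a' r ×ˢ ball b (R / 2)) := by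
    rintro ⟨x, w⟩ ⟨hx, hw⟩
    obtain ⟨δ₁, hδ₁, hb₁⟩ := Metric.isOpen_iff.1 isOpen_ball x hx
    obtain ⟨δ₂, hδ₂, hb₂⟩ := Metric.isOpen_iff.1 isOpen_ball w hw
    have hB : BddSepHol f x w (min δ₁ δ₂) M := by
      have e1 : ball x (min δ₁ δ₂) ⊆ ball a' r := (ball_subset_ball (min_le_left _ _)).trans hb₁
      have e2 : ball w (min δ₁ δ₂) ⊆ ball b (R / 2) :=
        (ball_subset_ball (min_le_right _ _)).trans hb₂
      have e3 : ball a' r ⊆ ball a R := (ball_subset_ball (by linarith)).trans hballa'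
      have e4 : ball b (R / 2) ⊆ ball b R := ball_subset_ball (by linarith)
      exact ⟨fun y hy => (h1 y (e4 (e2 hy))).mono (e1.trans e3),
        fun y hy => (h2 y (e3 (e1 hy))).mono (e2.trans e4),
        fun y hy y' hy' => hM y (e1 hy) y' (ball_subset_closedBall (e2 hy'))⟩
    exact (hB.differentiableAt (lt_min hδ₁ hδ₂)).continuousAt.continuousWithinAt
  have hgd : ∀ i, DifferentiableOn ℂ (g i) (ball b (R / 2)) := by
    intro i w hw
    obtain ⟨δ, hδ, hb⟩ := Metric.isOpen_iff.1 isOpen_ball w hw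
    have e4 : ball b (R / 2) ⊆ ball b R := ball_subset_ball (by linarith)
    have hv := i.2.2
    have hmem : ∀ z ∈ closedBall (0 : ℂ) (r / 2), a' + z • (i.2 : E) ∈ ball a' r := fun z hz =>
      hline i.2 hv z r (by rw [mem_closedBall_zero_iff] at hz; linarith)
    refine DifferentiableAt.differentiableWithinAt (DifferentiableAt.const_mul ?_ _)
    refine differentiableAt_deriv_param (φ := fun t w => f (a' + t • (i.2 : E)) w) (r := r / 2)
      i.1 (by positivity) hδ ?_ (fun y hy => ?_) fun z hz => ?_
    · refine hcont.comp (f := fun p : ℂ × ℂ => (a' + p.1 • (i.2 : E), p.2)) (by fun_prop) ?_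
      rintro ⟨z, y⟩ ⟨hz, hy⟩
      exact ⟨hmem z hz, hb hy⟩
    · exact (hu i.2 hv y (e4 (hb hy))).mono (ball_subset_ball (by linarith))
    · refine (h2 _ (hballa' (ball_subset_ball ?_ (hmem z (sphere_subset_closedBall hz))))).mono
        (hb.trans e4)
      linarith
  -- Cauchy's estimates give the rate `(r / 2)⁻¹` uniformly in `w` from the Baire bound, and the
  -- better rate `(R / 2)⁻¹` for each fixed `w`, where compactness of `closedBall a' (R / 2)` makes
  -- the constant independent of the direction. Hartogs' lemma yields any slightly worse rate
  -- uniformly, here `(3 R / 8)⁻¹`.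
  obtain ⟨C, hC⟩ := exists_uniform_bound_of_pointwise_bound (g := g) (d := Prod.fst) (c := b)
    (R := R / 2) (M := M) (A := (R / 2)⁻¹) (A' := (3 * R / 8)⁻¹) (B := (r / 2)⁻¹)
    (by positivity) (by positivity) (inv_anti₀ (by positivity) (by linarith))
    (inv_strictAnti₀ (by positivity) (by linarith)) hM1 hgd
    (fun i w hw => hcauchy i w (ball_subset_ball (by linarith) hw) (r / 2) M (by positivity)
      (by linarith) fun t ht => hM _ (hline i.2 i.2.2 t r (by
        rw [mem_sphere_zero_iff_norm] at ht; linarith)) w (ball_subset_closedBall hw))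
    (fun w hw => by
      have hwR : w ∈ ball b R := ball_subset_ball (by linarith) hw
      obtain ⟨C, hC⟩ := (isCompact_closedBall a' (R / 2)).exists_bound_of_continuousOn
        ((h1 w hwR).continuousOn.mono
          ((closedBall_subset_ball (by linarith)).trans hballa'))
      refine ⟨C, fun i => hcauchy i w hwR (R / 2) C (by positivity) (by linarith) fun t ht => ?_⟩
      refine hC _ ?_
      rw [mem_closedBall, dist_eq_norm, add_sub_cancel_left, norm_smul]
      rw [mem_sphere_zero_iff_norm] at ht
      have := i.2.2
      rw [ht]
      nlinarith)
  -- Such `x` lie within `R / 4 + R / 16 = 5 R / 16` of `a'`, so the Taylor series is dominated by a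
  -- geometric series of ratio `(5 R / 16) / (3 R / 8) = 5 / 6`.
  have hfin : ∀ x ∈ ball a (R / 16), ∀ w ∈ ball b (R / 16), ‖f x w‖ ≤ C * (1 - 5 / 6)⁻¹ := by
    intro x hx w hw
    have hw4 : w ∈ ball b (R / 2 / 2) := ball_subset_ball (by linarith) hw
    have hwR : w ∈ ball b R := ball_subset_ball (by linarith) hw
    set v : E := (‖x - a'‖ : ℂ)⁻¹ • (x - a') with hvdef
    have hnn : ‖((‖x - a'‖ : ℝ) : ℂ)‖ = ‖x - a'‖ := by
      rw [Complex.norm_real, norm_norm]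
    have hv : ‖v‖ ≤ 1 := by
      rw [hvdef, norm_smul, norm_inv, hnn]
      exact inv_mul_le_one
    have hxv : a' + (‖x - a'‖ : ℂ) • v = x := by
      rcases eq_or_ne x a' with rfl | hne
      · simp
      · have : (‖x - a'‖ : ℂ) ≠ 0 := by
          exact_mod_cast (norm_pos_iff.2 (sub_ne_zero.2 hne)).ne'
        rw [hvdef, smul_smul, mul_inv_cancel₀ this, one_smul, add_sub_cancel]
    have hdist : ‖x - a'‖ ≤ 5 * R / 16 := by
      rw [mem_ball] at hx ha'
      rw [← dist_eq_norm]
      linarith [dist_triangle_right x a' a]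
    have hsum := hasSum_taylorSeries_on_ball (hu v hv w hwR) (z := (‖x - a'‖ : ℂ))
      (by rw [mem_ball_zero_iff, hnn]; linarith)
    simp only [hxv] at hsum
    have hC0 : 0 ≤ C := by
      have := hC (0, ⟨v, hv⟩) w hw4
      simpa using (norm_nonneg _).trans this
    have hgeo := (hasSum_geometric_of_lt_one (r := 5 / 6) (by norm_num) (by norm_num)).mul_left C
    refine hsum.norm_le_of_bounded hgeo fun k => ?_
    have hgk := hC (k, ⟨v, hv⟩) w hw4
    have : ‖((k.factorial : ℂ)⁻¹ • ((‖x - a'‖ : ℂ) - 0) ^ k •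
        iteratedDeriv k (fun t : ℂ => f (a' + t • v) w) 0)‖
        = ‖x - a'‖ ^ k * ‖g (k, ⟨v, hv⟩) w‖ := by
      rw [hg]
      simp only [smul_eq_mul, norm_mul, sub_zero, norm_pow, hnn]
      ring
    rw [this]
    calc ‖x - a'‖ ^ k * ‖g (k, ⟨v, hv⟩) w‖
        ≤ (5 * R / 16) ^ k * (C * (3 * R / 8)⁻¹ ^ k) := by gcongr
      _ = C * ((5 * R / 16) * (3 * R / 8)⁻¹) ^ k := by rw [mul_pow]; ring
      _ = C * (5 / 6) ^ k := by congr 2; field_simp; norm_num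
  exact BddSepHol.differentiableAt (R := R / 16) (by positivity)
    ⟨fun w hw => (h1 w (ball_subset_ball (by linarith) hw)).mono (ball_subset_ball (by linarith)),
      fun x hx => (h2 x (ball_subset_ball (by linarith) hx)).mono (ball_subset_ball (by linarith)),
      hfin⟩

/-- **Hartogs' theorem**: a separately holomorphic function of several variables is
holomorphic. -/
theorem differentiableOn_of_separately_holomorphic {n : ℕ} {D : Set (Fin n → ℂ)} (hD : IsOpen D)
    {G : (Fin n → ℂ) → ℂ}
    (hG : ∀ z ∈ D, ∀ h, DifferentiableAt ℂ (fun w => G (Function.update z h w)) (z h)) :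
    DifferentiableOn ℂ G D := by
  classical
  -- Only the variables in `S` are released; they are added one at a time, for all base points at
  -- once.
  have key : ∀ S : Finset (Fin n), ∀ z ∈ D, DifferentiableAt ℂ (fun x => G (S.piecewise x z)) z := by
    intro S
    induction S using Finset.induction_on with
    | empty => intro z _; simp
    | insert h S hS ih =>
      intro z hz
      set f : (Fin n → ℂ) → ℂ → ℂ := fun x w => G (Function.update (S.piecewise x z) h w) with hf
      have hcont : Continuous fun p : (Fin n → ℂ) × ℂ =>
          Function.update (S.piecewise p.1 z) h p.2 := by
        refine continuous_pi fun j => ?_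
        by_cases hj : j = h
        · subst hj; simpa using continuous_snd
        · by_cases hjS : j ∈ S
          · simp only [Function.update_of_ne hj, Finset.piecewise_eq_of_mem _ _ _ hjS]
            fun_prop
          · simpa [hj, hjS] using continuous_const
      have hmem : (fun p : (Fin n → ℂ) × ℂ => Function.update (S.piecewise p.1 z) h p.2) ⁻¹' D
          ∈ 𝓝 (z, z h) := by
        refine (hD.preimage hcont).mem_nhds ?_
        rw [mem_preimage]
        simpa [Finset.piecewise_same] using hz
      obtain ⟨R, hR, hball⟩ := Metric.mem_nhds_iff.1 hmem
      rw [← ball_prod_same] at hball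
      have hd := differentiableAt_of_separately_holomorphic (f := f) hR
        (fun w hw x hx => by
          have hz1 : Function.update (S.piecewise x z) h w ∈ D :=
            hball (show (x, w) ∈ _ from ⟨hx, hw⟩)
          set z1 := Function.update (S.piecewise x z) h w with hz1def
          -- The translation by `z1 - x` is trivial on the coordinates in `S`, and it moves `x` to
          -- the base point `z1` of the induction hypothesis.
          have heq : (fun y => f y w) = (fun y => G (S.piecewise y z1)) ∘ fun y => y + (z1 - x) := by
            funext y
            simp only [hf, Function.comp]
            congr 1
            funext j
            by_cases hj : j = h
            · subst hj; simp [hS, hz1def]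
            · by_cases hjS : j ∈ S <;> simp [hj, hjS, hz1def]
          rw [heq]
          refine DifferentiableAt.differentiableWithinAt
            (DifferentiableAt.comp x ?_ (by fun_prop))
          rw [add_sub_cancel]
          exact ih z1 hz1)
        (fun x hx w hw => by
          have hz1 : Function.update (S.piecewise x z) h w ∈ D :=
            hball (show (x, w) ∈ _ from ⟨hx, hw⟩)
          have := hG _ hz1 h
          simp only [Function.update_idem, Function.update_self] at this
          exact this.differentiableWithinAt)
      have hcomp := DifferentiableAt.comp (f := fun x : Fin n → ℂ => (x, x h)) z
        (show DifferentiableAt ℂ (fun p : (Fin n → ℂ) × ℂ => f p.1 p.2) (z, z h) from hd)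
        (by fun_prop)
      refine hcomp.congr_of_eventuallyEq (Eventually.of_forall fun x => ?_)
      simp only [hf, Function.comp, Finset.piecewise_insert]
  intro z hz
  have := key Finset.univ z hz
  simp only [Finset.piecewise_univ] at this
  exact this.differentiableWithinAt

end SliceAnalysis

noncomputable section

open Set Filter Topology

namespace SliceAnalysis

/-! ### Multiplication of stem functions by the variables -/

section Algebra

variable {n : ℕ}

/-- The product `Z_j ⊗ F`. -/
def varMul (j : Fin n) (F : StemMap n) : StemMap n := fun L z =>
  (z j).re • F L z + ((if j ∈ L then 1 else -1) * (z j).im) • F (symmDiff L {j}) z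

theorem symmDiff_singleton_of_notMem {L : Finset (Fin n)} {h : Fin n} (hL : h ∉ L) :
    symmDiff L {h} = insert h L := by
  ext i
  simp only [Finset.mem_symmDiff, Finset.mem_singleton, Finset.mem_insert]
  by_cases hi : i = h
  · subst hi; simp [hL]
  · simp [hi]

theorem symmDiff_singleton_insert {L : Finset (Fin n)} {h : Fin n} (hL : h ∉ L) :
    symmDiff (insert h L) {h} = L := by
  rw [← symmDiff_singleton_of_notMem hL, symmDiff_symmDiff_cancel_right]

theorem mem_symmDiff_singleton_of_ne {L : Finset (Fin n)} {h j : Fin n} (hj : h ≠ j) :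
    h ∈ symmDiff L {j} ↔ h ∈ L := by
  simp [Finset.mem_symmDiff, hj]

theorem mem_symmDiff_singleton_self {L : Finset (Fin n)} {j : Fin n} :
    j ∈ symmDiff L {j} ↔ j ∉ L := by
  simp [Finset.mem_symmDiff]

theorem varMul_of_notMem {F : StemMap n} {L : Finset (Fin n)} {h : Fin n} (hL : h ∉ L)
    (z : Fin n → ℂ) :
    varMul h F L z = (z h).re • F L z - (z h).im • F (insert h L) z := by
  rw [varMul, if_neg hL, symmDiff_singleton_of_notMem hL, neg_one_mul, neg_smul, sub_eq_add_neg]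

theorem varMul_insert {F : StemMap n} {L : Finset (Fin n)} {h : Fin n} (hL : h ∉ L)
    (z : Fin n → ℂ) :
    varMul h F (insert h L) z = (z h).re • F (insert h L) z + (z h).im • F L z := by
  rw [varMul, if_pos (Finset.mem_insert_self _ _), symmDiff_singleton_insert hL, one_mul]

theorem stemMul_apply (F G : StemMap n) (L : Finset (Fin n)) (z : Fin n → ℂ) :
    stemMul F G L z = ∑ K : Finset (Fin n),
      (-1) ^ (symmDiff K L ∩ K).card * (F K z * G (symmDiff K L) z) := by
  unfold stemMul
  refine Finset.sum_congr rfl fun K _ => ?_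
  rw [Finset.sum_eq_single (symmDiff K L)]
  · rw [if_pos (symmDiff_symmDiff_cancel_left K L)]
  · intro H _ hH
    rw [if_neg]
    rintro rfl
    exact hH (symmDiff_symmDiff_cancel_left K H).symm
  · simp

theorem neg_one_pow_inter_symmDiff_singleton (H K : Finset (Fin n)) (j : Fin n) :
    (-1 : ℍ[ℝ]) ^ (H ∩ symmDiff K {j}).card
      = (if j ∈ H then -1 else 1) * (-1) ^ (H ∩ K).card := by
  by_cases hH : j ∈ H
  · rw [if_pos hH]
    by_cases hK : j ∈ K
    · have : H ∩ K = insert j (H ∩ symmDiff K {j}) := by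
        ext i
        simp only [Finset.mem_inter, Finset.mem_symmDiff, Finset.mem_singleton, Finset.mem_insert]
        by_cases hi : i = j
        · subst hi; simp [hH, hK]
        · simp [hi]
      rw [this, Finset.card_insert_of_notMem (by simp [Finset.mem_symmDiff, hK]), pow_succ]
      simp
    · have : H ∩ symmDiff K {j} = insert j (H ∩ K) := by
        ext i
        simp only [Finset.mem_inter, Finset.mem_symmDiff, Finset.mem_singleton, Finset.mem_insert]
        by_cases hi : i = j
        · subst hi; simp [hH, hK]
        · simp [hi]
      rw [this, Finset.card_insert_of_notMem (by simp [hK]), pow_succ]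
      simp
  · rw [if_neg hH, one_mul]
    congr 2
    ext i
    simp only [Finset.mem_inter, Finset.mem_symmDiff, Finset.mem_singleton]
    by_cases hi : i = j
    · subst hi; simp [hH]
    · simp [hi]

theorem stemMul_stemVar (j : Fin n) (F : StemMap n) : stemMul (stemVar j) F = varMul j F := by
  funext L z
  rw [stemMul_apply]
  have hne : (∅ : Finset (Fin n)) ≠ {j} := (Finset.singleton_ne_empty j).symm
  rw [Finset.sum_eq_add_of_mem ∅ {j} (Finset.mem_univ _) (Finset.mem_univ _) hne
    (fun K _ hK => by simp [stemVar, hK.1, hK.2])]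
  have h1 : symmDiff ∅ L = L := bot_symmDiff L
  have h2 : ((-1 : ℍ[ℝ])) ^ (symmDiff {j} L ∩ {j}).card = if j ∈ L then 1 else -1 := by
    rw [symmDiff_comm]
    by_cases hj : j ∈ L
    · rw [if_pos hj, Finset.inter_singleton_of_notMem (by simp [Finset.mem_symmDiff, hj])]; simp
    · rw [if_neg hj, Finset.inter_singleton_of_mem (by simp [Finset.mem_symmDiff, hj])]; simp
  rw [h1, h2, symmDiff_comm {j} L]
  simp only [stemVar, if_true, Finset.inter_empty, Finset.card_empty, pow_zero, one_mul, hne.symm,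
    if_false, varMul, Quaternion.coe_mul_eq_smul]
  split_ifs <;> simp

/-- Associativity for a left factor `Z_j`, enough to unfold `Z_K ⊗ F` one variable at a time. The
sums are matched by reindexing with `K ↦ K Δ {j}`. -/
theorem stemMul_varMul (j : Fin n) (M F : StemMap n) :
    stemMul (varMul j M) F = varMul j (stemMul M F) := by
  funext L z
  rw [varMul, stemMul_apply, stemMul_apply, stemMul_apply]
  set e : Finset (Fin n) ≃ Finset (Fin n) :=
    (symmDiff_right_involutive ({j} : Finset (Fin n))).toPerm with he
  have hre : ∑ K : Finset (Fin n), (-1 : ℍ[ℝ]) ^ (symmDiff K (symmDiff L {j}) ∩ K).card *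
        (M K z * F (symmDiff K (symmDiff L {j})) z)
      = ∑ K : Finset (Fin n), (-1 : ℍ[ℝ]) ^ (symmDiff K L ∩ symmDiff K {j}).card *
        (M (symmDiff K {j}) z * F (symmDiff K L) z) := by
    rw [← Equiv.sum_comp e]
    refine Finset.sum_congr rfl fun K _ => ?_
    have h1 : e K = symmDiff K {j} := symmDiff_comm _ _
    rw [h1, symmDiff_symmDiff_symmDiff_comm, symmDiff_self, symmDiff_bot]
  rw [hre, Finset.smul_sum, Finset.smul_sum, ← Finset.sum_add_distrib]
  refine Finset.sum_congr rfl fun K _ => ?_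
  rw [neg_one_pow_inter_symmDiff_singleton, varMul, add_mul, mul_add]
  congr 1
  · rw [smul_mul_assoc, mul_smul_comm]
  · by_cases hK : j ∈ K <;> by_cases hL : j ∈ L <;> simp [hK, hL, Finset.mem_symmDiff]

theorem stemMul_stemOne (F : StemMap n) : stemMul (stemOne n) F = F := by
  funext L z
  rw [stemMul_apply, Finset.sum_eq_single ∅ (fun K _ hK => by simp [stemOne, hK]) (by simp)]
  have h1 : symmDiff ∅ L = L := bot_symmDiff L
  simp [stemOne, h1]

/-- The coefficients of the `Z_j` are real and the basis elements `e_K` commute, so the order of the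
factors is immaterial. -/
theorem varMul_comm (i j : Fin n) (F : StemMap n) :
    varMul i (varMul j F) = varMul j (varMul i F) := by
  rcases eq_or_ne i j with rfl | hij
  · rfl
  funext L z
  simp only [varMul, mem_symmDiff_singleton_of_ne hij, mem_symmDiff_singleton_of_ne hij.symm,
    symmDiff_right_comm L {i} {j}]
  module

instance : LeftCommutative (varMul (n := n)) := ⟨varMul_comm⟩

/-- The product `Z_K ⊗ F`. -/
def monMul (K : Finset (Fin n)) (F : StemMap n) : StemMap n := K.val.foldr varMul F

theorem stemMul_stemMonomial (K : Finset (Fin n)) (F : StemMap n) :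
    stemMul (stemMonomial K) F = monMul K F := by
  have key : ∀ l : List (Fin n),
      stemMul ((l.map stemVar).foldr stemMul (stemOne n)) F = l.foldr varMul F := by
    intro l
    induction l with
    | nil => exact stemMul_stemOne F
    | cons a l ih => rw [List.map_cons, List.foldr_cons, List.foldr_cons, stemMul_stemVar,
        stemMul_varMul, ih]
  rw [stemMonomial, key, monMul, ← Multiset.coe_foldr, Finset.sort_eq]

theorem monMul_empty (F : StemMap n) : monMul ∅ F = F := rfl

theorem monMul_insert {K : Finset (Fin n)} {h : Fin n} (hK : h ∉ K) (F : StemMap n) :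
    monMul (insert h K) F = varMul h (monMul K F) := by
  rw [monMul, Finset.insert_val_of_notMem hK, Multiset.foldr_cons]; rfl

theorem monMul_varMul (K : Finset (Fin n)) (h : Fin n) (F : StemMap n) :
    monMul K (varMul h F) = varMul h (monMul K F) := by
  induction K using Finset.induction_on with
  | empty => rfl
  | insert a K ha ih => rw [monMul_insert ha, monMul_insert ha, ih, varMul_comm]

/-! ### Spherical derivatives in increasing order -/

theorem firstIndices_succ {m : ℕ} (hm : m < n) :
    firstIndices n (m + 1) = insert ⟨m, hm⟩ (firstIndices n m) := by
  ext i
  simp only [firstIndices, Finset.mem_filter, Finset.mem_univ, true_and, Finset.mem_insert,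
    Fin.ext_iff]
  omega

theorem mem_firstIndices {m : ℕ} {i : Fin n} : i ∈ firstIndices n m ↔ (i : ℕ) < m := by
  simp [firstIndices]

theorem stemSphDerivs_firstIndices_zero (F : StemMap n) :
    stemSphDerivs (firstIndices n 0) F = F := by
  have : firstIndices n 0 = ∅ := by ext i; simp [mem_firstIndices]
  rw [this, stemSphDerivs, Finset.sort_empty]; rfl

theorem stemSphDerivs_firstIndices_succ {m : ℕ} (hm : m < n) (F : StemMap n) :
    stemSphDerivs (firstIndices n (m + 1)) F
      = stemSphDeriv ⟨m, hm⟩ (stemSphDerivs (firstIndices n m) F) := by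
  have hnot : (⟨m, hm⟩ : Fin n) ∉ firstIndices n m := by simp [mem_firstIndices]
  have hsort : (firstIndices n (m + 1)).sort (· ≤ ·)
      = (firstIndices n m).sort (· ≤ ·) ++ [⟨m, hm⟩] := by
    refine List.Perm.eq_of_pairwise (le := (· ≤ ·)) (fun a b _ _ hab hba => le_antisymm hab hba) (Finset.pairwise_sort _ _)
      ?_ ?_
    · rw [List.pairwise_append]
      refine ⟨Finset.pairwise_sort _ _, List.pairwise_singleton _ _, fun a ha b hb => ?_⟩
      rw [Finset.mem_sort, mem_firstIndices] at ha
      rw [List.mem_singleton] at hb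
      rw [hb, Fin.le_def]
      exact ha.le
    · rw [← Multiset.coe_eq_coe, Finset.sort_eq, ← Multiset.coe_add, Finset.sort_eq,
        firstIndices_succ hm, Finset.insert_val_of_notMem hnot, add_comm]
      rfl
  rw [stemSphDerivs, hsort, List.foldl_append]; rfl

end Algebra

end SliceAnalysis

noncomputable section

open Set Filter Topology

namespace SliceAnalysis

/-! ### Holomorphic pairs and holomorphy in one variable -/

section HolPair

variable {V W : Type*} [NormedAddCommGroup V] [NormedSpace ℝ V] [NormedAddCommGroup W]
  [NormedSpace ℝ W]

/-- `A + e B` is real differentiable at `w` and satisfies the Cauchy-Riemann equations there. -/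
def HolPair (A B : ℂ → V) (w : ℂ) : Prop :=
  ∃ A' B' : ℂ →L[ℝ] V, HasFDerivAt A A' w ∧ HasFDerivAt B B' w ∧
    A' 1 = B' Complex.I ∧ A' Complex.I = -B' 1

variable {A B A₁ B₁ : ℂ → V} {w : ℂ}

theorem HolPair.add (h : HolPair A B w) (h₁ : HolPair A₁ B₁ w) :
    HolPair (fun x => A x + A₁ x) (fun x => B x + B₁ x) w := by
  obtain ⟨a, b, ha, hb, e1, e2⟩ := h
  obtain ⟨a₁, b₁, ha₁, hb₁, e3, e4⟩ := h₁
  refine ⟨a + a₁, b + b₁, ha.add ha₁, hb.add hb₁, ?_, ?_⟩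
  · simp [e1, e3]
  · simp [e2, e4, add_comm]

theorem HolPair.comp (l : V →L[ℝ] W) (h : HolPair A B w) :
    HolPair (fun x => l (A x)) (fun x => l (B x)) w := by
  obtain ⟨a, b, ha, hb, e1, e2⟩ := h
  refine ⟨l.comp a, l.comp b, l.hasFDerivAt.comp w ha, l.hasFDerivAt.comp w hb, ?_, ?_⟩
  · simp [e1]
  · simp [e2]

theorem HolPair.smul (c : ℝ) (h : HolPair A B w) :
    HolPair (fun x => c • A x) (fun x => c • B x) w :=
  h.comp (c • ContinuousLinearMap.id ℝ V)

theorem HolPair.sub (h : HolPair A B w) (h₁ : HolPair A₁ B₁ w) :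
    HolPair (fun x => A x - A₁ x) (fun x => B x - B₁ x) w := by
  simpa [sub_eq_add_neg] using h.add (h₁.smul (-1))

theorem holPair_zero : HolPair (fun _ => (0 : V)) (fun _ => (0 : V)) w :=
  ⟨0, 0, hasFDerivAt_const _ _, hasFDerivAt_const _ _, by simp, by simp⟩

theorem HolPair.congr (h : HolPair A B w) (hA : A₁ =ᶠ[𝓝 w] A) (hB : B₁ =ᶠ[𝓝 w] B) :
    HolPair A₁ B₁ w := by
  obtain ⟨a, b, ha, hb, e⟩ := h
  exact ⟨a, b, ha.congr_of_eventuallyEq hA, hb.congr_of_eventuallyEq hB, e⟩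

theorem HolPair.differentiableAt_left (h : HolPair A B w) : DifferentiableAt ℝ A w := by
  obtain ⟨a, b, ha, -⟩ := h
  exact ha.differentiableAt

theorem HolPair.differentiableAt_right (h : HolPair A B w) : DifferentiableAt ℝ B w := by
  obtain ⟨a, b, -, hb, -⟩ := h
  exact hb.differentiableAt

/-- Multiplication of a holomorphic pair by the variable. -/
theorem HolPair.mul_self (h : HolPair A B w) :
    HolPair (fun x => x.re • A x - x.im • B x) (fun x => x.re • B x + x.im • A x) w := by
  obtain ⟨a, b, ha, hb, e1, e2⟩ := h
  have hre : HasFDerivAt (fun x : ℂ => x.re) Complex.reCLM w := Complex.reCLM.hasFDerivAt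
  have him : HasFDerivAt (fun x : ℂ => x.im) Complex.imCLM w := Complex.imCLM.hasFDerivAt
  refine ⟨_, _, (hre.smul ha).sub (him.smul hb), (hre.smul hb).add (him.smul ha), ?_, ?_⟩
  · simp [e1, e2]; abel
  · simp [e1, e2]; abel

theorem HolPair.differentiableAt_complex {A B : ℂ → ℝ} (h : HolPair A B w) :
    DifferentiableAt ℂ (fun x => (A x : ℂ) + Complex.I * (B x : ℂ)) w := by
  obtain ⟨a, b, ha, hb, e1, e2⟩ := h
  have hd : HasFDerivAt (fun x => (A x : ℂ) + Complex.I * (B x : ℂ))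
      (Complex.ofRealCLM.comp a + Complex.I • Complex.ofRealCLM.comp b) w :=
    (Complex.ofRealCLM.hasFDerivAt.comp w ha).add
      ((Complex.ofRealCLM.hasFDerivAt.comp w hb).const_smul Complex.I)
  rw [differentiableAt_complex_iff_differentiableAt_real]
  refine ⟨hd.differentiableAt, ?_⟩
  rw [hd.fderiv]
  simp [e1, e2]
  apply Complex.ext <;> simp

theorem holPair_of_differentiableAt_complex {A B : ℂ → ℝ}
    (h : DifferentiableAt ℂ (fun x => (A x : ℂ) + Complex.I * (B x : ℂ)) w) : HolPair A B w := by
  rw [differentiableAt_complex_iff_differentiableAt_real] at h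
  obtain ⟨h1, h2⟩ := h
  set f : ℂ → ℂ := fun x => (A x : ℂ) + Complex.I * (B x : ℂ) with hf
  have hA : (fun x => Complex.reCLM (f x)) = A := by funext x; simp [hf]
  have hB : (fun x => Complex.imCLM (f x)) = B := by funext x; simp [hf]
  have hfA : HasFDerivAt (fun x => Complex.reCLM (f x)) _ w :=
    Complex.reCLM.hasFDerivAt.comp w h1.hasFDerivAt
  have hfB : HasFDerivAt (fun x => Complex.imCLM (f x)) _ w :=
    Complex.imCLM.hasFDerivAt.comp w h1.hasFDerivAt
  rw [hA] at hfA
  rw [hB] at hfB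
  refine ⟨_, _, hfA, hfB, ?_, ?_⟩
  · simp [h2]
  · simp [h2]

/-- Holomorphic pairs with values in the quaternions can be tested on real functionals. -/
theorem holPair_of_forall_functional {A B : ℂ → ℍ[ℝ]} {w : ℂ}
    (h : ∀ l : ℍ[ℝ] →L[ℝ] ℝ, HolPair (fun x => l (A x)) (fun x => l (B x)) w) : HolPair A B w := by
  set b := Module.finBasis ℝ ℍ[ℝ]
  have hsum := fun i => (h (b.coord i).toContinuousLinearMap).comp
    ((ContinuousLinearMap.id ℝ ℝ).smulRight (b i))
  have key : ∀ s : Finset (Fin (Module.finrank ℝ ℍ[ℝ])), HolPair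
      (fun x => ∑ i ∈ s, b.coord i (A x) • b i) (fun x => ∑ i ∈ s, b.coord i (B x) • b i) w := by
    intro s
    induction s using Finset.induction_on with
    | empty => simpa using holPair_zero
    | insert i s hi ih =>
      simp only [Finset.sum_insert hi]
      exact HolPair.add (hsum i) ih
  have := key Finset.univ
  simpa only [Module.Basis.coord_apply, Module.Basis.sum_repr] using this

end HolPair

/-! ### Holomorphy in one variable and the recursion for ordered components -/

section Stem

variable {n : ℕ} {D : Set (Fin n → ℂ)}

/-- The stem map `F` is holomorphic in the `h`-th variable on `D`. -/
def HolIn (D : Set (Fin n → ℂ)) (h : Fin n) (F : StemMap n) : Prop :=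
  ∀ z ∈ D, ∀ L, h ∉ L → HolPair (fun w => F L (Function.update z h w))
    (fun w => F (insert h L) (Function.update z h w)) (z h)

/-- Equality of stem maps on `D`. -/
def StemEqOn (D : Set (Fin n → ℂ)) (F G : StemMap n) : Prop := ∀ K, ∀ z ∈ D, F K z = G K z

theorem StemEqOn.trans {F G H : StemMap n} (h₁ : StemEqOn D F G) (h₂ : StemEqOn D G H) :
    StemEqOn D F H := fun K z hz => (h₁ K z hz).trans (h₂ K z hz)

theorem eventually_update_mem (hD : IsOpen D) {z : Fin n → ℂ} (hz : z ∈ D) (h : Fin n) :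
    ∀ᶠ w in 𝓝 (z h), Function.update z h w ∈ D := by
  have hc : Continuous fun w => Function.update z h w := continuous_const.update h continuous_id
  refine (hD.preimage hc).mem_nhds ?_
  rw [mem_preimage, Function.update_eq_self]; exact hz

theorem tendsto_mk_of_im_eq_zero {w : ℂ} (hw : w.im = 0) :
    Tendsto (fun t : ℝ => (⟨w.re, t⟩ : ℂ)) (𝓝 0) (𝓝 w) := by
  have h1 : Continuous fun t : ℝ => (⟨w.re, t⟩ : ℂ) := by
    have : (fun t : ℝ => (⟨w.re, t⟩ : ℂ)) = fun t : ℝ => (w.re : ℂ) + t * Complex.I := by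
      funext t; apply Complex.ext <;> simp
    rw [this]; fun_prop
  have h2 := h1.tendsto 0
  have h3 : (⟨w.re, 0⟩ : ℂ) = w := Complex.ext rfl hw.symm
  rwa [h3] at h2

theorem HolIn.congr (hD : IsOpen D) {h : Fin n} {F G : StemMap n} (hF : HolIn D h F)
    (hFG : StemEqOn D G F) : HolIn D h G := by
  intro z hz L hL
  refine (hF z hz L hL).congr ?_ ?_
  · filter_upwards [eventually_update_mem hD hz h] with w hw using hFG _ _ hw
  · filter_upwards [eventually_update_mem hD hz h] with w hw using hFG _ _ hw

theorem IsStem.congr {F G : StemMap n} (hF : IsStem D F) (hFG : StemEqOn D G F) : IsStem D G :=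
  ⟨hF.1, fun z hz K h => by rw [hFG K _ ((hF.1 h z).1 hz), hFG K z hz, hF.2 z hz K h]⟩

theorem varMul_congr {F G : StemMap n} (h : StemEqOn D F G) (j : Fin n) :
    StemEqOn D (varMul j F) (varMul j G) := fun K z hz => by
  simp only [varMul, h _ z hz]

/-- Openness of `D` matters: where the imaginary part vanishes, the spherical derivative depends on
values near the point. -/
theorem stemSphDeriv_congr (hD : IsOpen D) {F G : StemMap n} (hFG : StemEqOn D F G) (h : Fin n) :
    StemEqOn D (stemSphDeriv h F) (stemSphDeriv h G) := by
  intro K z hz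
  unfold stemSphDeriv
  split_ifs with h1 h2
  · rfl
  · refine EventuallyEq.deriv_eq ?_
    filter_upwards [(tendsto_mk_of_im_eq_zero h2).eventually (eventually_update_mem hD hz h)]
      with t ht using hFG _ _ ht
  · rw [hFG _ z hz]

theorem conjAt_self (z : Fin n → ℂ) (h : Fin n) : conjAt h z h = (starRingEnd ℂ) (z h) := by
  simp [conjAt]

theorem conjAt_of_ne {z : Fin n → ℂ} {h j : Fin n} (hj : j ≠ h) : conjAt h z j = z j := by
  simp [conjAt, hj]

theorem IsStem.conjAt_of_mem {F : StemMap n} (hF : IsStem D F) {z : Fin n → ℂ} (hz : z ∈ D)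
    {K : Finset (Fin n)} {h : Fin n} (hK : h ∈ K) : F K (conjAt h z) = -F K z := by
  rw [hF.2 z hz, Finset.inter_singleton_of_mem hK]; simp

theorem IsStem.conjAt_of_notMem {F : StemMap n} (hF : IsStem D F) {z : Fin n → ℂ} (hz : z ∈ D)
    {K : Finset (Fin n)} {h : Fin n} (hK : h ∉ K) : F K (conjAt h z) = F K z := by
  rw [hF.2 z hz, Finset.inter_singleton_of_notMem hK]; simp

theorem isStem_of_conjAt {F : StemMap n} (hD : ConjInvariant D)
    (h1 : ∀ z ∈ D, ∀ K h, h ∈ K → F K (conjAt h z) = -F K z)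
    (h2 : ∀ z ∈ D, ∀ K h, h ∉ K → F K (conjAt h z) = F K z) : IsStem D F := by
  refine ⟨hD, fun z hz K h => ?_⟩
  by_cases hK : h ∈ K
  · rw [h1 z hz K h hK, Finset.inter_singleton_of_mem hK]; simp
  · rw [h2 z hz K h hK, Finset.inter_singleton_of_notMem hK]; simp

theorem IsStem.eq_zero_of_im_eq_zero {F : StemMap n} (hF : IsStem D F) {z : Fin n → ℂ}
    (hz : z ∈ D) {K : Finset (Fin n)} {h : Fin n} (hK : h ∈ K) (h0 : (z h).im = 0) :
    F K z = 0 := by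
  have h1 := hF.conjAt_of_mem hz hK
  have h2 : conjAt h z = z := by
    rw [conjAt, Complex.conj_eq_iff_im.2 h0, Function.update_eq_self]
  rw [h2] at h1
  have h4 : (2 : ℝ) • F K z = 0 := by rw [two_smul]; nth_rewrite 1 [h1]; simp
  simpa using h4

theorem IsStem.varMul {F : StemMap n} (hF : IsStem D F) (j : Fin n) : IsStem D (varMul j F) := by
  refine isStem_of_conjAt hF.1 (fun z hz K h hK => ?_) fun z hz K h hK => ?_
  · unfold SliceAnalysis.varMul
    rcases eq_or_ne j h with rfl | hj
    · rw [hF.conjAt_of_mem hz hK, hF.conjAt_of_notMem hz (h := j)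
        (by simp [mem_symmDiff_singleton_self, hK]), conjAt_self, Complex.conj_re, Complex.conj_im]
      module
    · rw [hF.conjAt_of_mem hz hK, hF.conjAt_of_mem hz (h := h)
        ((mem_symmDiff_singleton_of_ne hj.symm).2 hK), conjAt_of_ne hj]
      module
  · unfold SliceAnalysis.varMul
    rcases eq_or_ne j h with rfl | hj
    · rw [hF.conjAt_of_notMem hz hK, hF.conjAt_of_mem hz (h := j)
        (by simp [mem_symmDiff_singleton_self, hK]), conjAt_self, Complex.conj_re, Complex.conj_im]
      module
    · rw [hF.conjAt_of_notMem hz hK, hF.conjAt_of_notMem hz (h := h)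
        (mt (mem_symmDiff_singleton_of_ne hj.symm).1 hK), conjAt_of_ne hj]

theorem conjAt_update_of_ne {z : Fin n → ℂ} {h j : Fin n} (hj : j ≠ h) (w : ℂ) :
    Function.update (conjAt j z) h w = conjAt j (Function.update z h w) := by
  rw [conjAt, conjAt, Function.update_of_ne hj, Function.update_comm hj]

/-- The quotient of the odd functions `F_{K ∪ h}` and `β_h` is even in `β_h`, and conjugation in
another variable passes through the quotient or the derivative. -/
theorem IsStem.stemSphDeriv {F : StemMap n} (hD : IsOpen D) (hF : IsStem D F) (h : Fin n) :
    IsStem D (stemSphDeriv h F) := by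
  have hev : ∀ z ∈ D, (z h).im = 0 → ∀ᶠ t : ℝ in 𝓝 0, Function.update z h ⟨(z h).re, t⟩ ∈ D :=
    fun z hz h0 => (tendsto_mk_of_im_eq_zero h0).eventually (eventually_update_mem hD hz h)
  have hself : ∀ z ∈ D, ∀ K, h ∉ K →
      SliceAnalysis.stemSphDeriv h F K (conjAt h z) = SliceAnalysis.stemSphDeriv h F K z := by
    intro z hz K hK
    by_cases h0 : (z h).im = 0
    · rw [conjAt, Complex.conj_eq_iff_im.2 h0, Function.update_eq_self]
    · unfold SliceAnalysis.stemSphDeriv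
      rw [if_neg hK, if_neg hK, conjAt_self, Complex.conj_im, if_neg h0,
        if_neg (by simpa using h0), hF.conjAt_of_mem hz (Finset.mem_insert_self _ _), inv_neg]
      module
  refine isStem_of_conjAt hF.1 (fun z hz K j hjK => ?_) fun z hz K j hjK => ?_
  · by_cases hK : h ∈ K
    · simp [SliceAnalysis.stemSphDeriv, hK]
    have hj : j ≠ h := by rintro rfl; exact hK hjK
    unfold SliceAnalysis.stemSphDeriv
    rw [if_neg hK, if_neg hK, conjAt_of_ne hj.symm]
    split_ifs with h0
    · rw [← deriv.fun_neg]
      refine EventuallyEq.deriv_eq ?_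
      filter_upwards [hev z hz h0] with t ht
      rw [conjAt_update_of_ne hj, hF.conjAt_of_mem ht (Finset.mem_insert_of_mem hjK)]
    · rw [hF.conjAt_of_mem hz (Finset.mem_insert_of_mem hjK), smul_neg]
  · by_cases hK : h ∈ K
    · simp [SliceAnalysis.stemSphDeriv, hK]
    rcases eq_or_ne j h with rfl | hj
    · exact hself z hz K hK
    have hjK' : j ∉ insert h K := by simp [hj, hjK]
    unfold SliceAnalysis.stemSphDeriv
    rw [if_neg hK, if_neg hK, conjAt_of_ne hj.symm]
    split_ifs with h0
    · refine EventuallyEq.deriv_eq ?_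
      filter_upwards [hev z hz h0] with t ht
      rw [conjAt_update_of_ne hj, hF.conjAt_of_notMem ht hjK']
    · rw [hF.conjAt_of_notMem hz hjK']

theorem hasDerivAt_mk (r : ℝ) (t : ℝ) :
    HasDerivAt (fun t : ℝ => (⟨r, t⟩ : ℂ)) Complex.I t := by
  have : (fun t : ℝ => (⟨r, t⟩ : ℂ)) = fun t : ℝ => (r : ℂ) + t * Complex.I := by
    funext t; apply Complex.ext <;> simp
  rw [this]
  simpa using ((Complex.ofRealCLM.hasDerivAt (x := t)).mul_const Complex.I).const_add (r : ℂ)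

theorem HolIn.differentiableAt {h : Fin n} {F : StemMap n} (hF : HolIn D h F) {z : Fin n → ℂ}
    (hz : z ∈ D) (K : Finset (Fin n)) :
    DifferentiableAt ℝ (fun w => F K (Function.update z h w)) (z h) := by
  by_cases hK : h ∈ K
  · have := (hF z hz (K.erase h) (Finset.notMem_erase h K)).differentiableAt_right
    rwa [Finset.insert_erase hK] at this
  · exact (hF z hz K hK).differentiableAt_left

theorem HolIn.differentiableAt_line {h : Fin n} {F : StemMap n} (hF : HolIn D h F)
    {z : Fin n → ℂ} (hz : z ∈ D) (h0 : (z h).im = 0) (K : Finset (Fin n)) :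
    DifferentiableAt ℝ (fun t : ℝ => F K (Function.update z h ⟨(z h).re, t⟩)) 0 := by
  have h1 := hF.differentiableAt hz K
  have h3 : (⟨(z h).re, 0⟩ : ℂ) = z h := Complex.ext rfl h0.symm
  rw [← h3] at h1
  exact DifferentiableAt.comp (f := fun t : ℝ => (⟨(z h).re, t⟩ : ℂ)) (0 : ℝ) h1
    (hasDerivAt_mk _ _).differentiableAt

/-- The coefficients of `Z_j` do not involve `z_h`. Holomorphy serves only at `β_h = 0`, where the
derivative of a sum must be split. -/
theorem stemSphDeriv_varMul_of_ne {F : StemMap n} {h j : Fin n} (hj : j ≠ h)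
    (hF : HolIn D h F) :
    StemEqOn D (stemSphDeriv h (varMul j F)) (varMul j (stemSphDeriv h F)) := by
  intro L z hz
  by_cases hL : h ∈ L
  · simp [stemSphDeriv, varMul, hL, mem_symmDiff_singleton_of_ne hj.symm]
  have hins : symmDiff (insert h L) {j} = insert h (symmDiff L {j}) := by
    ext i
    simp only [Finset.mem_symmDiff, Finset.mem_insert, Finset.mem_singleton]
    by_cases hi : i = h
    · subst hi; simp [hj.symm]
    · simp [hi]
  have hmem : j ∈ insert h L ↔ j ∈ L := by simp [hj]
  simp only [stemSphDeriv, varMul, hL, mem_symmDiff_singleton_of_ne hj.symm, hins, hmem, if_false,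
    Function.update_of_ne hj]
  by_cases h0 : (z h).im = 0
  · rw [if_pos h0, if_pos h0, if_pos h0, deriv_fun_add, deriv_fun_const_smul, deriv_fun_const_smul]
    · exact hF.differentiableAt_line hz h0 _
    · exact hF.differentiableAt_line hz h0 _
    · exact (hF.differentiableAt_line hz h0 _).fun_const_smul _
    · exact (hF.differentiableAt_line hz h0 _).fun_const_smul _
  · rw [if_neg h0, if_neg h0, if_neg h0]
    module

theorem HolIn.varMul_of_ne {F : StemMap n} {h j : Fin n} (hj : j ≠ h) (hF : HolIn D h F) :
    HolIn D h (varMul j F) := by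
  intro z hz L hL
  have hins : symmDiff (insert h L) {j} = insert h (symmDiff L {j}) := by
    ext i
    simp only [Finset.mem_symmDiff, Finset.mem_insert, Finset.mem_singleton]
    by_cases hi : i = h
    · subst hi; simp [hj.symm]
    · simp [hi]
  have hmem : j ∈ insert h L ↔ j ∈ L := by simp [hj]
  simp only [varMul, hins, hmem, Function.update_of_ne hj]
  exact ((hF z hz L hL).smul _).add
    ((hF z hz _ (mt (mem_symmDiff_singleton_of_ne hj.symm).1 hL)).smul _)

theorem HolIn.varMul_self {F : StemMap n} {h : Fin n} (hF : HolIn D h F) :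
    HolIn D h (varMul h F) := by
  intro z hz L hL
  simp only [varMul_of_notMem hL, varMul_insert hL, Function.update_self]
  exact (hF z hz L hL).mul_self

theorem HolIn.varMul {F : StemMap n} {h : Fin n} (j : Fin n) (hF : HolIn D h F) :
    HolIn D h (varMul j F) := by
  rcases eq_or_ne j h with rfl | hj
  · exact hF.varMul_self
  · exact hF.varMul_of_ne hj

theorem HolIn.monMul {F : StemMap n} {h : Fin n} (K : Finset (Fin n)) (hF : HolIn D h F) :
    HolIn D h (monMul K F) := by
  induction K using Finset.induction_on with
  | empty => exact hF
  | insert a K ha ih => rw [monMul_insert ha]; exact ih.varMul a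

theorem stemSphDeriv_monMul {F : StemMap n} {h : Fin n} {K : Finset (Fin n)}
    (hK : h ∉ K) (hF : HolIn D h F) :
    StemEqOn D (stemSphDeriv h (monMul K F)) (monMul K (stemSphDeriv h F)) := by
  induction K using Finset.induction_on with
  | empty => intro K z _; rfl
  | insert a K ha ih =>
    rw [Finset.mem_insert, not_or] at hK
    rw [monMul_insert ha, monMul_insert ha]
    exact (stemSphDeriv_varMul_of_ne (Ne.symm hK.1) (hF.monMul K)).trans
      (varMul_congr (ih hK.2) a)

/-- The stem function inducing the ordered component, computed recursively. -/
def ordStem (F : StemMap n) (K : Finset (Fin n)) : ℕ → StemMap n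
  | 0 => F
  | m + 1 => if hm : m < n then
      stemSphDeriv ⟨m, hm⟩
        (if ⟨m, hm⟩ ∈ K then varMul ⟨m, hm⟩ (ordStem F K m) else ordStem F K m)
      else ordStem F K m

theorem ordStem_congr {F : StemMap n} {K K' : Finset (Fin n)} {m : ℕ}
    (h : ∀ i : Fin n, (i : ℕ) < m → (i ∈ K ↔ i ∈ K')) : ordStem F K m = ordStem F K' m := by
  induction m with
  | zero => rfl
  | succ m ih =>
    have := ih fun i hi => h i (by omega)
    simp only [ordStem, this]
    split_ifs with h1 h2 h3 h3
    · rfl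
    · exact absurd ((h ⟨m, h1⟩ (by simp)).1 h2) h3
    · exact absurd ((h ⟨m, h1⟩ (by simp)).2 h3) h2
    · rfl
    · rfl

theorem IsStem.ordStem (hD : IsOpen D) {F : StemMap n} (hF : IsStem D F) (K : Finset (Fin n))
    (m : ℕ) : IsStem D (ordStem F K m) := by
  induction m with
  | zero => exact hF
  | succ m ih =>
    rw [SliceAnalysis.ordStem]
    split_ifs with h1 h2
    · exact (ih.varMul _).stemSphDeriv hD _
    · exact ih.stemSphDeriv hD _
    · exact ih

/-- Step `i` kills the components whose index contains `i`, and later steps change indices only at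
later places. -/
theorem ordStem_eq_zero {F : StemMap n} {K L : Finset (Fin n)} {m : ℕ} {i : Fin n}
    (hi : (i : ℕ) < m) (hiL : i ∈ L) (z : Fin n → ℂ) : ordStem F K m L z = 0 := by
  induction m generalizing L z with
  | zero => omega
  | succ m ih =>
    rw [ordStem]
    by_cases h1 : m < n
    · rw [dif_pos h1]
      by_cases hmL : (⟨m, h1⟩ : Fin n) ∈ L
      · simp [stemSphDeriv, hmL]
      have him : i ≠ ⟨m, h1⟩ := by rintro rfl; exact hmL hiL
      have hi' : (i : ℕ) < m := by
        have : (i : ℕ) ≠ m := fun h => him (Fin.ext h)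
        omega
      have hz : ∀ z, (if (⟨m, h1⟩ : Fin n) ∈ K then varMul ⟨m, h1⟩ (ordStem F K m)
          else ordStem F K m) (insert ⟨m, h1⟩ L) z = 0 := by
        intro z
        split_ifs
        · rw [varMul_insert hmL, ih hi' (Finset.mem_insert_of_mem hiL), ih hi' hiL]; simp
        · exact ih hi' (Finset.mem_insert_of_mem hiL) z
      simp only [stemSphDeriv, hmL, if_false, hz]
      simp
    · rw [dif_neg h1]
      exact ih (by omega) hiL z

/-- The ordered components are given by the recursion `ordStem`, as long as the
earlier components are holomorphic in the relevant variables. -/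
theorem stemSphDerivs_monMul_eq_ordStem (hD : IsOpen D) {F : StemMap n} {m : ℕ} (hm : m ≤ n)
    (hF : ∀ i : Fin n, (i : ℕ) < m → ∀ K, HolIn D i (ordStem F K i)) (K : Finset (Fin n)) :
    StemEqOn D (stemSphDerivs (firstIndices n m) (monMul K F))
      (monMul (K \ firstIndices n m) (ordStem F K m)) := by
  induction m with
  | zero =>
    have : firstIndices n 0 = ∅ := by ext i; simp [mem_firstIndices]
    rw [stemSphDerivs_firstIndices_zero, this, Finset.sdiff_empty]
    intro L z _; rfl
  | succ m ih =>
    have hm' : m < n := hm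
    have ih := ih hm'.le fun i hi => hF i (by omega)
    rw [stemSphDerivs_firstIndices_succ hm', firstIndices_succ hm']
    refine (stemSphDeriv_congr hD ih _).trans ?_
    have hmf : (⟨m, hm'⟩ : Fin n) ∉ firstIndices n m := by simp [mem_firstIndices]
    have hH := hF ⟨m, hm'⟩ (by simp) K
    rw [ordStem, dif_pos hm']
    by_cases hK : (⟨m, hm'⟩ : Fin n) ∈ K
    · rw [if_pos hK]
      have h1 : K \ firstIndices n m
          = insert ⟨m, hm'⟩ (K \ insert ⟨m, hm'⟩ (firstIndices n m)) := by
        ext i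
        simp only [Finset.mem_sdiff, Finset.mem_insert]
        by_cases hi : i = ⟨m, hm'⟩
        · subst hi; simp [hK, hmf]
        · simp [hi]
      -- The factor `Z_m` is moved innermost, next to `ordStem F K m`; the remaining variables have
      -- larger indices and commute with the derivative in `x_m`.
      rw [h1, monMul_insert (by simp), ← monMul_varMul]
      exact stemSphDeriv_monMul (by simp) hH.varMul_self
    · rw [if_neg hK]
      have h1 : K \ firstIndices n m = K \ insert ⟨m, hm'⟩ (firstIndices n m) := by
        ext i
        simp only [Finset.mem_sdiff, Finset.mem_insert]
        by_cases hi : i = ⟨m, hm'⟩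
        · subst hi; simp [hK]
        · simp [hi]
      rw [h1]
      exact stemSphDeriv_monMul (by simp) hH

end Stem

end SliceAnalysis

noncomputable section

open Set Filter Topology

namespace SliceAnalysis

section

variable {n : ℕ} {D : Set (Fin n → ℂ)}

/-! ### The spherical derivative of a stem function -/

theorem im_smul_stemSphDeriv {F : StemMap n} (hF : IsStem D F) {h : Fin n} {L : Finset (Fin n)}
    (hL : h ∉ L) {z : Fin n → ℂ} (hz : z ∈ D) :
    (z h).im • stemSphDeriv h F L z = F (insert h L) z := by
  rw [stemSphDeriv, if_neg hL]
  split_ifs with h0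
  · rw [h0, zero_smul, hF.eq_zero_of_im_eq_zero hz (Finset.mem_insert_self _ _) h0]
  · rw [smul_smul, mul_inv_cancel₀ h0, one_smul]

/-- The relevant component of `Z_h ⊗ F` is `α_h F_{L ∪ h} + β_h F_L`; divide by `β_h`, or use the
product rule at `β_h = 0`. This is what makes `F_L` recoverable from spherical derivatives. -/
theorem stemSphDeriv_varMul_self {F : StemMap n} {h : Fin n} (hF : HolIn D h F)
    {L : Finset (Fin n)} (hL : h ∉ L) {z : Fin n → ℂ} (hz : z ∈ D) :
    stemSphDeriv h (varMul h F) L z = F L z + (z h).re • stemSphDeriv h F L z := by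
  rw [stemSphDeriv, stemSphDeriv, if_neg hL, if_neg hL]
  split_ifs with h0
  · simp only [varMul_insert hL, Function.update_self]
    have e : Function.update z h ⟨(z h).re, 0⟩ = z := by
      have : (⟨(z h).re, 0⟩ : ℂ) = z h := Complex.ext rfl h0.symm
      rw [this, Function.update_eq_self]
    have d1 := (hF.differentiableAt_line hz h0 (insert h L)).hasDerivAt.const_smul (z h).re
    have d2 := (hasDerivAt_id (0 : ℝ)).smul (hF.differentiableAt_line hz h0 L).hasDerivAt
    have d := (d1.add d2).deriv
    simp only [id, e, zero_smul, one_smul, zero_add] at d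
    rw [add_comm (F L z)]
    exact d
  · rw [varMul_insert hL, smul_add, smul_smul, smul_smul, smul_smul, inv_mul_cancel₀ h0, one_smul,
      add_comm, mul_comm]

/-- The value of the spherical derivative at a real point of the variable. -/
theorem stemSphDeriv_of_im_eq_zero {F : StemMap n} {h : Fin n} {L : Finset (Fin n)} (hL : h ∉ L)
    {z : Fin n → ℂ} (h0 : (z h).im = 0) {B' : ℂ →L[ℝ] ℍ[ℝ]}
    (hB : HasFDerivAt (fun w => F (insert h L) (Function.update z h w)) B' (z h)) :
    stemSphDeriv h F L z = B' Complex.I := by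
  rw [stemSphDeriv, if_neg hL, if_pos h0]
  have h3 : (⟨(z h).re, 0⟩ : ℂ) = z h := Complex.ext rfl h0.symm
  rw [← h3] at hB
  exact (HasFDerivAt.comp_hasDerivAt (f := fun t : ℝ => (⟨(z h).re, t⟩ : ℂ)) (0 : ℝ) hB
    (hasDerivAt_mk _ _)).deriv

theorem fderiv_one_eq_zero_of_im_eq_zero (hD : IsOpen D) {F : StemMap n} (hF : IsStem D F)
    {h : Fin n} {K : Finset (Fin n)} (hK : h ∈ K) {z : Fin n → ℂ} (hz : z ∈ D)
    (h0 : (z h).im = 0) {B' : ℂ →L[ℝ] ℍ[ℝ]}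
    (hB : HasFDerivAt (fun w => F K (Function.update z h w)) B' (z h)) : B' 1 = 0 := by
  have h1 : HasDerivAt (fun t : ℝ => z h + (t : ℂ)) 1 (0 : ℝ) :=
    (Complex.ofRealCLM.hasDerivAt (x := (0 : ℝ))).const_add (z h)
  have h2 : HasFDerivAt (fun w => F K (Function.update z h w)) B' (z h + ((0 : ℝ) : ℂ)) := by
    simpa using hB
  have h3 := h2.comp_hasDerivAt (0 : ℝ) h1
  have hlim : Tendsto (fun t : ℝ => z h + (t : ℂ)) (𝓝 0) (𝓝 (z h)) := by
    simpa using h1.continuousAt.tendsto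
  have h4 : (fun w => F K (Function.update z h w)) ∘ (fun t : ℝ => z h + (t : ℂ))
      =ᶠ[𝓝 0] fun _ => 0 := by
    filter_upwards [hlim.eventually (eventually_update_mem hD hz h)] with t ht
    exact hF.eq_zero_of_im_eq_zero ht hK (by simp [h0])
  exact (h3.congr_of_eventuallyEq h4.symm).unique (hasDerivAt_const _ _)

theorem hasDerivAt_of_cauchyRiemann {A B : ℂ → ℝ} {A' B' : ℂ →L[ℝ] ℝ} {w : ℂ}
    (hA : HasFDerivAt A A' w) (hB : HasFDerivAt B B' w) (e1 : A' 1 = B' Complex.I)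
    (e2 : A' Complex.I = -B' 1) :
    HasDerivAt (fun x => (A x : ℂ) + Complex.I * (B x : ℂ)) (A' 1 + Complex.I * B' 1) w := by
  have h1 := (HolPair.differentiableAt_complex ⟨A', B', hA, hB, e1, e2⟩).hasDerivAt
  have h2 : HasFDerivAt (fun x => (A x : ℂ) + Complex.I * (B x : ℂ))
      (Complex.ofRealCLM.comp A' + Complex.I • Complex.ofRealCLM.comp B') w :=
    (Complex.ofRealCLM.hasFDerivAt.comp w hA).add
      ((Complex.ofRealCLM.hasFDerivAt.comp w hB).const_smul Complex.I)
  have h3 := congrArg (fun T : ℂ →L[ℝ] ℂ => T 1)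
    ((h1.hasFDerivAt.restrictScalars ℝ).unique h2)
  simp at h3
  rwa [h3] at h1

/-- The spherical derivative with respect to `x_h` preserves holomorphy in the other
variables. -/
theorem HolIn.stemSphDeriv (hD : IsOpen D) {F : StemMap n} (hF : IsStem D F) {h j : Fin n}
    (hj : j ≠ h) (hh : HolIn D h F) (hjF : HolIn D j F) : HolIn D j (stemSphDeriv h F) := by
  intro z hz L hL
  by_cases hhL : h ∈ L
  · simp only [SliceAnalysis.stemSphDeriv, hhL, Finset.mem_insert_of_mem hhL, if_true]
    exact holPair_zero
  have hhL' : h ∉ insert j L := by simp [hj.symm, hhL]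
  have hjL' : j ∉ insert h L := by simp [hj, hL]
  by_cases h0 : (z h).im = 0
  swap
  · simp only [SliceAnalysis.stemSphDeriv, hhL, hhL', if_false, Function.update_of_ne hj.symm, h0,
      Finset.insert_comm h j L]
    exact (hjF z hz _ hjL').smul _
  -- At a real point of `x_h` the quotient formula is unavailable. A real functional reduces the
  -- claim to complex differentiability in `z_j` of one scalar function, to be recognised as a
  -- derivative in `z_h`.
  refine holPair_of_forall_functional fun l => holPair_of_differentiableAt_complex ?_
  set Z : ℂ → ℂ → Fin n → ℂ := fun x w => Function.update (Function.update z h x) j w with hZ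
  have hZ' : ∀ x w, Z x w = Function.update (Function.update z j w) h x := fun x w =>
    Function.update_comm hj.symm _ _ _
  set f : Finset (Fin n) → ℂ → ℂ → ℂ := fun K x w => (l (F K (Z x w)) : ℂ) with hf
  -- Both `e_h` and `e_j` are replaced by `i`. Grouping the four terms by `h` or by `j` shows that
  -- `Φ` is holomorphic in `x = z_h` and in `w = z_j`.
  set Φ : ℂ → ℂ → ℂ := fun x w => (f L x w + Complex.I * f (insert h L) x w)
    + Complex.I * (f (insert j L) x w + Complex.I * f (insert h (insert j L)) x w) with hΦ
  have hpair₁ : ∀ K, h ∉ K → ∀ x w, Z x w ∈ D →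
      DifferentiableAt ℂ (fun x => f K x w + Complex.I * f (insert h K) x w) x := by
    intro K hK x w hxw
    have := ((hh _ hxw K hK).comp l).differentiableAt_complex
    simpa only [hf, hZ', Function.update_idem, Function.update_self] using this
  have hpair₂ : ∀ K, j ∉ K → ∀ x w, Z x w ∈ D →
      DifferentiableAt ℂ (fun w => f K x w + Complex.I * f (insert j K) x w) w := by
    intro K hK x w hxw
    have := ((hjF _ hxw K hK).comp l).differentiableAt_complex
    simpa only [hf, hZ, Function.update_idem, Function.update_self] using this
  have hΦ₁ : ∀ x w, Z x w ∈ D → DifferentiableAt ℂ (fun x => Φ x w) x := fun x w hxw =>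
    (hpair₁ L hhL x w hxw).add ((hpair₁ _ hhL' x w hxw).const_mul Complex.I)
  have hΦ₂ : ∀ x w, Z x w ∈ D → DifferentiableAt ℂ (Φ x) w := fun x w hxw => by
    have h1 := (hpair₂ L hL x w hxw).add ((hpair₂ _ hjL' x w hxw).const_mul Complex.I)
    refine h1.congr_of_eventuallyEq (Eventually.of_forall fun w => ?_)
    simp only [hΦ, Pi.add_apply, Finset.insert_comm j h L]
    ring
  have hZc : Continuous fun p : ℂ × ℂ => Z p.1 p.2 := by
    have h1 : Continuous fun p : ℂ × ℂ => Function.update z h p.1 :=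
      continuous_const.update h continuous_fst
    exact h1.update j continuous_snd
  have hZ0 : Z (z h) (z j) = z := by
    simp [hZ]
  obtain ⟨R, hR, hball⟩ := Metric.mem_nhds_iff.1 ((hD.preimage hZc).mem_nhds
    (show (z h, z j) ∈ _ by rw [mem_preimage, hZ0]; exact hz))
  rw [← ball_prod_same] at hball
  have hmem : ∀ x ∈ Metric.ball (z h) R, ∀ w ∈ Metric.ball (z j) R, Z x w ∈ D :=
    fun x hx w hw => hball (mk_mem_prod hx hw)
  have hcont : ContinuousOn (fun p : ℂ × ℂ => Φ p.1 p.2)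
      (Metric.ball (z h) R ×ˢ Metric.ball (z j) R) := by
    -- Hartogs' theorem at each point gives the joint continuity required by Cauchy's formula with a
    -- parameter.
    rintro ⟨x, w⟩ ⟨hx, hw⟩
    obtain ⟨δ, hδ, hsub⟩ := Metric.isOpen_iff.1
      (Metric.isOpen_ball.prod Metric.isOpen_ball) (x, w) (mk_mem_prod hx hw)
    rw [← ball_prod_same] at hsub
    have hmem' : ∀ x' ∈ Metric.ball x δ, ∀ w' ∈ Metric.ball w δ, Z x' w' ∈ D :=
      fun x' hx' w' hw' =>
        have := hsub (mk_mem_prod hx' hw')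
        hmem x' this.1 w' this.2
    exact (differentiableAt_of_separately_holomorphic hδ
      (fun w' hw' x' hx' => (hΦ₁ x' w' (hmem' x' hx' w' hw')).differentiableWithinAt)
      (fun x' hx' w' hw' => (hΦ₂ x' w' (hmem' x' hx' w' hw')).differentiableWithinAt)
      ).continuousAt.continuousWithinAt
  have hsub : Metric.closedBall (z h) (R / 2) ⊆ Metric.ball (z h) R :=
    Metric.closedBall_subset_ball (by linarith)
  have key := differentiableAt_deriv_param (φ := Φ) (c := z h) (w₀ := z j) (r := R / 2) (s := R) 1
    (by positivity) hR (hcont.mono (prod_mono_left hsub))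
    (fun w hw x hx => (hΦ₁ x w (hmem x (hsub (Metric.ball_subset_closedBall hx)) w
      hw)).differentiableWithinAt)
    (fun x hx w hw => (hΦ₂ x w (hmem x (hsub (Metric.sphere_subset_closedBall hx)) w
      hw)).differentiableWithinAt)
  refine key.congr_of_eventuallyEq ?_
  filter_upwards [eventually_update_mem hD hz j] with w hw
  set y := Function.update z j w with hy
  have hyh : y h = z h := Function.update_of_ne hj.symm _ _
  have hyZ : ∀ x, Z x w = Function.update y h x := fun x => hZ' x w
  have hy0 : (y h).im = 0 := by rw [hyh]; exact h0
  obtain ⟨a, b, ha, hb, e1, e2⟩ := hh y hw L hhL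
  obtain ⟨a₁, b₁, ha₁, hb₁, e3, e4⟩ := hh y hw _ hhL'
  -- Odd components vanish along the real axis, so they drop out of `∂Φ/∂x`. What remains is
  -- `∂F_L/∂α_h` and `∂F_{L ∪ j}/∂α_h`, which are the two spherical derivatives by Cauchy-Riemann.
  have hb1 : b 1 = 0 :=
    fderiv_one_eq_zero_of_im_eq_zero hD hF (Finset.mem_insert_self _ _) hw hy0 hb
  have hb1' : b₁ 1 = 0 :=
    fderiv_one_eq_zero_of_im_eq_zero hD hF (Finset.mem_insert_self _ _) hw hy0 hb₁
  rw [stemSphDeriv_of_im_eq_zero hhL hy0 hb, stemSphDeriv_of_im_eq_zero hhL' hy0 hb₁, ← e1, ← e3]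
  have d1 := hasDerivAt_of_cauchyRiemann (l.hasFDerivAt.comp _ ha) (l.hasFDerivAt.comp _ hb)
    (by simp [e1]) (by simp [e2])
  have d2 := hasDerivAt_of_cauchyRiemann (l.hasFDerivAt.comp _ ha₁) (l.hasFDerivAt.comp _ hb₁)
    (by simp [e3]) (by simp [e4])
  have d := (d1.add (d2.const_mul Complex.I)).deriv
  rw [iteratedDeriv_one]
  have hfun : deriv (fun x => Φ x w) (y h) = (((l ∘SL a) 1 : ℝ) + Complex.I * ((l ∘SL b) 1 : ℝ))
      + Complex.I * (((l ∘SL a₁) 1 : ℝ) + Complex.I * ((l ∘SL b₁) 1 : ℝ)) := by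
    refine Eq.trans ?_ d
    congr 1
    funext x
    simp only [hΦ, hf, hyZ, Pi.add_apply, Function.comp]
  rw [← hyh, hfun]
  simp [hb1, hb1']

/-- Converse to `HolIn.stemSphDeriv`. -/
theorem HolIn.of_stemSphDeriv {F : StemMap n} (hD : IsOpen D) (hF : IsStem D F) {h j : Fin n}
    (hj : j ≠ h) (hh : HolIn D h F) (h₁ : HolIn D j (SliceAnalysis.stemSphDeriv h F))
    (h₂ : HolIn D j (SliceAnalysis.stemSphDeriv h (SliceAnalysis.varMul h F))) : HolIn D j F := by
  -- The components of `F` are combinations of the two spherical derivatives with coefficients `1`,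
  -- `α_h`, `β_h`, which are constant in `z_j`.
  have hleft : ∀ K, h ∉ K → ∀ y ∈ D, F K y
      = SliceAnalysis.stemSphDeriv h (SliceAnalysis.varMul h F) K y
        - (y h).re • SliceAnalysis.stemSphDeriv h F K y := fun K hK y hy => by
    rw [stemSphDeriv_varMul_self hh hK hy, add_sub_cancel_right]
  have hright : ∀ K, h ∉ K → ∀ y ∈ D, F (insert h K) y
      = (y h).im • SliceAnalysis.stemSphDeriv h F K y := fun K hK y hy =>
    (im_smul_stemSphDeriv hF hK hy).symm
  intro z hz L hL
  have hev := eventually_update_mem hD hz j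
  by_cases hhL : h ∈ L
  · obtain ⟨K, hK, rfl⟩ : ∃ K, h ∉ K ∧ insert h K = L :=
      ⟨L.erase h, Finset.notMem_erase h L, Finset.insert_erase hhL⟩
    rw [Finset.mem_insert, not_or] at hL
    have hK' : h ∉ insert j K := by simp [hj.symm, hK]
    refine ((h₁ z hz K hL.2).smul (z h).im).congr ?_ ?_
    · filter_upwards [hev] with w hw
      rw [hright K hK _ hw, Function.update_of_ne hj.symm]
    · filter_upwards [hev] with w hw
      rw [Finset.insert_comm, hright _ hK' _ hw, Function.update_of_ne hj.symm]
  · have hK' : h ∉ insert j L := by simp [hj.symm, hhL]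
    refine ((h₂ z hz L hL).sub ((h₁ z hz L hL).smul (z h).re)).congr ?_ ?_
    · filter_upwards [hev] with w hw
      rw [hleft L hhL _ hw, Function.update_of_ne hj.symm]
    · filter_upwards [hev] with w hw
      rw [hleft _ hK' _ hw, Function.update_of_ne hj.symm]

/-- The first `m` steps differentiate only in variables before the `m`-th, so holomorphy in the
later ones survives. -/
theorem HolIn.ordStem (hD : IsOpen D) {F : StemMap n} (hF : IsStem D F)
    (hol : ∀ j, HolIn D j F) (K : Finset (Fin n)) {m : ℕ} {j : Fin n} (hj : m ≤ j) :
    HolIn D j (ordStem F K m) := by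
  induction m generalizing j with
  | zero => exact hol j
  | succ m ih =>
    rw [SliceAnalysis.ordStem]
    have hm : m < n := by omega
    have hne : j ≠ ⟨m, hm⟩ := by rintro rfl; simp at hj
    rw [dif_pos hm]
    have hst := hF.ordStem hD K m
    have h1 := ih (j := ⟨m, hm⟩) le_rfl
    have h2 := ih (j := j) (by omega)
    split_ifs
    · exact (h1.varMul _).stemSphDeriv hD (hst.varMul _) hne (h2.varMul _)
    · exact h1.stemSphDeriv hD hst hne h2

/-- Descent from step `j` to step `0`: holomorphy in `z_j` at step `m` follows from step `m + 1` for
both choices, with and without the factor `Z_m`. This is why all `K` are needed. -/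
theorem HolIn.of_ordStem (hD : IsOpen D) {F : StemMap n} (hF : IsStem D F)
    (hol : ∀ m : Fin n, ∀ K, HolIn D m (SliceAnalysis.ordStem F K m)) (j : Fin n) :
    HolIn D j F := by
  have key : ∀ d m : ℕ, m + d = j → ∀ K, HolIn D j (SliceAnalysis.ordStem F K m) := by
    intro d
    induction d with
    | zero =>
      intro m hm K
      have : m = (j : ℕ) := by omega
      subst this
      exact hol j K
    | succ d ih =>
      intro m hm K
      have hmn : m < n := by omega
      set i : Fin n := ⟨m, hmn⟩ with hi
      have hne : j ≠ i := by rintro rfl; simp [hi] at hm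
      have e1 : ∀ K', (∀ k : Fin n, (k : ℕ) < m → (k ∈ K ↔ k ∈ K')) →
          SliceAnalysis.ordStem F K' m = SliceAnalysis.ordStem F K m := fun K' hK' =>
        (ordStem_congr hK').symm
      have h1 := ih (m + 1) (by omega) (K.erase i)
      have h2 := ih (m + 1) (by omega) (insert i K)
      rw [SliceAnalysis.ordStem, dif_pos hmn, if_neg (Finset.notMem_erase _ _), e1 (K.erase i) (fun k hk => by
        have : k ≠ i := by rintro rfl; simp [hi] at hk
        simp [this])] at h1
      rw [SliceAnalysis.ordStem, dif_pos hmn, if_pos (Finset.mem_insert_self _ _), e1 (insert i K) (fun k hk => by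
        have : k ≠ i := by rintro rfl; simp [hi] at hk
        simp [this])] at h2
      exact HolIn.of_stemSphDeriv hD (hF.ordStem hD K m) hne (hol i K) h1 h2
  exact key j 0 (by omega) ∅

end

end SliceAnalysis

noncomputable section

open Set Filter Topology

namespace SliceAnalysis

/-! ### Sums over sets of indices and sign changes -/

section Sign

variable {ι : Type*} [Fintype ι] [DecidableEq ι]

/-- The sign by which a component `F_L` of a stem function changes when the coordinates in `s` are
conjugated. -/
def conjSign (s L : Finset ι) : ℝ := ∏ i ∈ s, if i ∈ L then -1 else 1

/-- Orthogonality of the characters of `(ℤ/2)^ι`: the sum factors over `ι`, and a place where `L`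
and `T` differ contributes `1 - 1`. -/
theorem sum_conjSign_mul_conjSign (T L : Finset ι) :
    ∑ s : Finset ι, conjSign s T * conjSign s L = if L = T then 2 ^ Fintype.card ι else 0 := by
  have h1 : ∑ s : Finset ι, conjSign s T * conjSign s L
      = ∏ i : ι, ((1 : ℝ) + (if i ∈ T then -1 else 1) * (if i ∈ L then -1 else 1)) := by
    rw [Finset.prod_one_add]
    simp only [conjSign, Finset.prod_mul_distrib, Finset.powerset_univ]
  rw [h1]
  split_ifs with hLT
  · subst hLT
    rw [Fintype.card, ← Finset.prod_const]
    refine Finset.prod_congr rfl fun i _ => ?_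
    split_ifs <;> norm_num
  · obtain ⟨i, hi⟩ : ∃ i, ¬(i ∈ L ↔ i ∈ T) := by
      by_contra! h
      exact hLT (Finset.ext h)
    refine Finset.prod_eq_zero (Finset.mem_univ i) ?_
    by_cases h2 : i ∈ L <;> by_cases h3 : i ∈ T <;> simp_all

/-- Fourier inversion on `(ℤ/2)^ι`. It isolates a single component from sums over all of them, with
`N` the space of functions or pairs having the desired regularity. -/
theorem mem_of_forall_sum_conjSign_smul_mem {M : Type*} [AddCommGroup M] [Module ℝ M]
    (N : Submodule ℝ M) (X : Finset ι → M)
    (h : ∀ s : Finset ι, ∑ L : Finset ι, conjSign s L • X L ∈ N) (T : Finset ι) : X T ∈ N := by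
  have h1 : ∑ s : Finset ι, conjSign s T • ∑ L : Finset ι, conjSign s L • X L ∈ N :=
    N.sum_mem fun s _ => N.smul_mem _ (h s)
  have h2 : ∑ s : Finset ι, conjSign s T • ∑ L : Finset ι, conjSign s L • X L
      = (2 ^ Fintype.card ι : ℝ) • X T := by
    simp only [Finset.smul_sum, smul_smul]
    rw [Finset.sum_comm]
    simp only [← Finset.sum_smul, sum_conjSign_mul_conjSign, ite_smul, zero_smul,
      Finset.sum_ite_eq', Finset.mem_univ, if_true]
  rw [h2] at h1
  have h3 := N.smul_mem (2 ^ Fintype.card ι : ℝ)⁻¹ h1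
  rwa [smul_smul, inv_mul_cancel₀ (by positivity), one_smul] at h3

theorem sum_finset_eq_sum_notMem {M : Type*} [AddCommMonoid M] (X : Finset ι → M) (h : ι) :
    ∑ L : Finset ι, X L = ∑ L : Finset ι with h ∉ L, (X L + X (insert h L)) := by
  rw [← Finset.sum_filter_add_sum_filter_not Finset.univ (fun L : Finset ι => h ∉ L),
    Finset.sum_add_distrib]
  congr 1
  refine Finset.sum_nbij' (fun L => L.erase h) (fun L => insert h L) ?_ ?_ ?_ ?_ ?_
  · intro L _; simp
  · intro L _; simp
  · intro L hL
    simp only [Finset.mem_filter, Finset.mem_univ, true_and, not_not] at hL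
    exact Finset.insert_erase hL
  · intro L hL
    simp only [Finset.mem_filter, Finset.mem_univ, true_and] at hL
    exact Finset.erase_insert hL
  · intro L hL
    simp only [Finset.mem_filter, Finset.mem_univ, true_and, not_not] at hL
    rw [Finset.insert_erase hL]

end Sign

/-! ### Holomorphic stem functions -/

section Holomorphic

variable {n : ℕ} {D : Set (Fin n → ℂ)}

/-- Conjugation of the coordinates with index in `s`. -/
def conjOn (s : Finset (Fin n)) (z : Fin n → ℂ) : Fin n → ℂ := fun i =>
  if i ∈ s then (starRingEnd ℂ) (z i) else z i

theorem conjOn_insert {s : Finset (Fin n)} {a : Fin n} (ha : a ∉ s) (z : Fin n → ℂ) :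
    conjOn (insert a s) z = conjAt a (conjOn s z) := by
  funext i
  rcases eq_or_ne i a with rfl | hi
  · simp [conjOn, conjAt, ha]
  · simp [conjOn, conjAt, hi]

theorem IsStem.apply_conjOn {F : StemMap n} (hF : IsStem D F) {z : Fin n → ℂ} (hz : z ∈ D)
    (s L : Finset (Fin n)) : conjOn s z ∈ D ∧ F L (conjOn s z) = conjSign s L • F L z := by
  induction s using Finset.induction_on with
  | empty =>
    have : conjOn ∅ z = z := by funext i; simp [conjOn]
    rw [this]; exact ⟨hz, by simp [conjSign]⟩
  | insert a s ha ih =>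
    rw [conjOn_insert ha, conjSign, Finset.prod_insert ha]
    refine ⟨(hF.1 a _).1 ih.1, ?_⟩
    split_ifs with hL
    · rw [hF.conjAt_of_mem ih.1 hL, ih.2, neg_one_mul, neg_smul, conjSign]
    · rw [hF.conjAt_of_notMem ih.1 hL, ih.2, one_mul, conjSign]

theorem contDiff_conjOn (s : Finset (Fin n)) : ContDiff ℝ 1 (conjOn s) := by
  rw [contDiff_pi]
  intro i
  unfold conjOn
  split_ifs
  · exact Complex.conjCLE.contDiff.comp (contDiff_apply ℝ ℂ i)
  · exact contDiff_apply ℝ ℂ i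

theorem complexStr_of_mem {h : Fin n} {L : Finset (Fin n)} (hL : h ∈ L) (F : StemMap n)
    (z : Fin n → ℂ) : complexStr h F L z = F (L.erase h) z := by
  have hiff : ∀ K, symmDiff K {h} = L ↔ K = L.erase h := by
    intro K
    rw [← Finset.insert_erase hL, ← symmDiff_singleton_of_notMem (Finset.notMem_erase h L),
      symmDiff_left_inj, symmDiff_singleton_of_notMem (Finset.notMem_erase h L),
      Finset.insert_erase hL]
  unfold complexStr
  simp only [hiff, Finset.sum_ite_eq', Finset.mem_univ, if_true]
  rw [Finset.inter_singleton_of_notMem (Finset.notMem_erase h L)]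
  simp

theorem complexStr_of_notMem {h : Fin n} {L : Finset (Fin n)} (hL : h ∉ L) (F : StemMap n)
    (z : Fin n → ℂ) : complexStr h F L z = -F (insert h L) z := by
  have hiff : ∀ K, symmDiff K {h} = L ↔ K = insert h L := by
    intro K
    conv_lhs => rw [← symmDiff_singleton_insert hL, symmDiff_left_inj]
  unfold complexStr
  simp only [hiff, Finset.sum_ite_eq', Finset.mem_univ, if_true]
  rw [Finset.inter_singleton_of_mem (Finset.mem_insert_self h L)]
  simp

theorem dbarStem_eq_zero_iff {h : Fin n} {F : StemMap n} {z : Fin n → ℂ} :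
    (∀ K, dbarStem h F K z = 0) ↔ ∀ L, h ∉ L →
      dAlpha h F L z = dBeta h F (insert h L) z ∧ dBeta h F L z = -dAlpha h F (insert h L) z := by
  have h2 : ∀ q : ℍ[ℝ], (1 / 2 : ℝ) • q = 0 ↔ q = 0 := fun q => by simp
  simp only [dbarStem, h2]
  constructor
  · intro H L hL
    have e1 := H L
    have e2 := H (insert h L)
    rw [complexStr_of_notMem hL] at e1
    rw [complexStr_of_mem (Finset.mem_insert_self h L), Finset.erase_insert hL] at e2
    exact ⟨by rwa [← sub_eq_add_neg, sub_eq_zero] at e1, by rwa [eq_neg_iff_add_eq_zero, add_comm]⟩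
  · intro H K
    by_cases hK : h ∈ K
    · have e := (H (K.erase h) (Finset.notMem_erase h K)).2
      rw [Finset.insert_erase hK] at e
      rw [complexStr_of_mem hK, e, add_neg_cancel]
    · rw [complexStr_of_notMem hK, (H K hK).1, add_neg_cancel]

theorem hasFDerivAt_comp_update {V : Type*} [NormedAddCommGroup V] [NormedSpace ℝ V]
    {g : (Fin n → ℂ) → V} {z : Fin n → ℂ} (hg : DifferentiableAt ℝ g z) (h : Fin n) :
    HasFDerivAt (fun w => g (Function.update z h w))
      ((fderiv ℝ g z).comp (ContinuousLinearMap.single ℝ (fun _ : Fin n => ℂ) h)) (z h) := by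
  have h1 : HasFDerivAt g (fderiv ℝ g z) (Function.update z h (z h)) := by
    rw [Function.update_eq_self]; exact hg.hasFDerivAt
  have h2 : ContinuousLinearMap.single ℝ (fun _ : Fin n => ℂ) h
      = ContinuousLinearMap.pi (Pi.single h (ContinuousLinearMap.id ℝ ℂ)) := by
    refine ContinuousLinearMap.ext fun v => funext fun i => ?_
    rcases eq_or_ne i h with rfl | hi
    · simp
    · simp [hi]
  rw [h2]
  exact h1.comp (z h) (hasFDerivAt_update z (z h))

theorem IsHolomorphicStem.holIn (hD : IsOpen D) {F : StemMap n} (hF : IsHolomorphicStem D F)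
    (h : Fin n) : HolIn D h F := by
  intro z hz L hL
  have hd : ∀ K, DifferentiableAt ℝ (F K) z := fun K =>
    ((hF.1 K).differentiableOn one_ne_zero).differentiableAt (hD.mem_nhds hz)
  obtain ⟨e1, e2⟩ := dbarStem_eq_zero_iff.1 (fun K => hF.2 h K z hz) L hL
  exact ⟨_, _, hasFDerivAt_comp_update (hd L) h, hasFDerivAt_comp_update (hd _) h,
    by simpa [dAlpha, dBeta] using e1, by simpa [dAlpha, dBeta] using e2⟩

/-- By Hartogs' theorem, a stem function that is holomorphic in each variable is of class `C¹`. -/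
theorem contDiffOn_of_holIn (hD : IsOpen D) {F : StemMap n} (hF : IsStem D F)
    (hol : ∀ h, HolIn D h F) (T : Finset (Fin n)) : ContDiffOn ℝ 1 (F T) D := by
  have key : ∀ l : ℍ[ℝ] →L[ℝ] ℝ, ContDiffOn ℝ 1 (fun z => l (F T z)) D := by
    intro l
    -- Every `e_h` is replaced by `i`, giving one separately holomorphic function `G`. Nothing is
    -- lost: conjugating coordinates changes the sign of each term according to its index.
    set X : Finset (Fin n) → (Fin n → ℂ) → ℂ := fun L z => Complex.I ^ L.card * (l (F L z) : ℂ)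
      with hX
    set G : (Fin n → ℂ) → ℂ := fun z => ∑ L, X L z with hG
    have hsep : ∀ z ∈ D, ∀ h, DifferentiableAt ℂ (fun w => G (Function.update z h w)) (z h) := by
      intro z hz h
      have e : (fun w => G (Function.update z h w)) = fun w =>
          ∑ L : Finset (Fin n) with h ∉ L, Complex.I ^ L.card *
            ((l (F L (Function.update z h w)) : ℂ)
              + Complex.I * (l (F (insert h L) (Function.update z h w)) : ℂ)) := by
        funext w
        simp only [hG]
        rw [sum_finset_eq_sum_notMem _ h]
        refine Finset.sum_congr rfl fun L hL => ?_
        simp only [Finset.mem_filter, Finset.mem_univ, true_and] at hL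
        simp only [hX, Finset.card_insert_of_notMem hL, pow_succ]
        ring
      rw [e]
      refine DifferentiableAt.fun_sum fun L hL => ?_
      simp only [Finset.mem_filter, Finset.mem_univ, true_and] at hL
      exact (((hol h z hz L hL).comp l).differentiableAt_complex).const_mul _
    have hG1 : ContDiffOn ℝ 1 G D :=
      (contDiffOn_one_of_differentiableOn hD
        (differentiableOn_of_separately_holomorphic hD hsep)).restrict_scalars ℝ
    let N : Submodule ℝ ((Fin n → ℂ) → ℂ) :=
      { carrier := {g | ContDiffOn ℝ 1 g D}
        add_mem' := fun ha hb => ContDiffOn.add ha hb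
        zero_mem' := contDiffOn_const
        smul_mem' := fun c g hg => ContDiffOn.const_smul c hg }
    -- The functions `G ∘ conjOn s` are only real `C¹`, which suffices, and they are the signed sums
    -- of the `X L`.
    have hN : X T ∈ N := by
      refine mem_of_forall_sum_conjSign_smul_mem N X (fun s => ?_) T
      have h1 : ContDiffOn ℝ 1 (G ∘ conjOn s) D :=
        hG1.comp (contDiff_conjOn s).contDiffOn fun z hz => (hF.apply_conjOn hz s ∅).1
      refine ContDiffOn.congr h1 fun z hz => ?_
      simp only [hG, Finset.sum_apply, Pi.smul_apply, Function.comp]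
      refine Finset.sum_congr rfl fun L _ => ?_
      simp only [hX, (hF.apply_conjOn hz s L).2, map_smul, smul_eq_mul, Complex.ofReal_mul,
        Complex.real_smul]
      ring
    have h2 : ContDiffOn ℝ 1 (fun z => (Complex.I ^ T.card)⁻¹ * X T z) D :=
      ContDiffOn.mul contDiffOn_const hN
    refine (Complex.reCLM.contDiff.comp_contDiffOn h2).congr fun z _ => ?_
    simp [hX]
  set b := Module.finBasis ℝ ℍ[ℝ]
  have hsum : F T = fun z => ∑ i, (b.coord i).toContinuousLinearMap (F T z) • b i := by
    funext z
    exact (b.sum_repr (F T z)).symm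
  rw [hsum]
  exact ContDiffOn.sum fun i _ => (key _).smul contDiffOn_const

theorem isHolomorphicStem_iff (hD : IsOpen D) {F : StemMap n} (hF : IsStem D F) :
    IsHolomorphicStem D F ↔ ∀ h, HolIn D h F := by
  refine ⟨fun H h => H.holIn hD h, fun hol => ?_⟩
  have hC := contDiffOn_of_holIn hD hF hol
  refine ⟨hC, fun h K z hz => ?_⟩
  revert K
  rw [dbarStem_eq_zero_iff]
  intro L hL
  have hd : ∀ K, DifferentiableAt ℝ (F K) z := fun K =>
    ((hC K).differentiableOn one_ne_zero).differentiableAt (hD.mem_nhds hz)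
  obtain ⟨a, b, ha, hb, e1, e2⟩ := hol h z hz L hL
  have ea := ha.unique (hasFDerivAt_comp_update (hd L) h)
  have eb := hb.unique (hasFDerivAt_comp_update (hd _) h)
  rw [ea, eb] at e1 e2
  exact ⟨by simpa [dAlpha, dBeta] using e1, by simpa [dAlpha, dBeta] using e2⟩

theorem IsStem.isHolomorphicStem_congr (hD : IsOpen D) {F G : StemMap n} (hF : IsStem D F)
    (hFG : StemEqOn D G F) (hol : IsHolomorphicStem D F) : IsHolomorphicStem D G :=
  (isHolomorphicStem_iff hD (hF.congr hFG)).2 fun h => (hol.holIn hD h).congr hD hFG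

/-- Uniqueness of the stem function on `D` turns the existential in the definition into a test on
any given `F`. -/
theorem isSliceRegular_iff (hD : IsOpen D) {F : StemMap n} {f : (Fin n → ℍ[ℝ]) → ℍ[ℝ]}
    (hF : IsStem D F) (hFf : Induces D F f) : IsSliceRegular D f ↔ ∀ h, HolIn D h F := by
  rw [← isHolomorphicStem_iff hD hF]
  refine ⟨?_, fun h => ⟨F, hF, h, hFf⟩⟩
  rintro ⟨G, hG, hol, hGf⟩
  exact hG.isHolomorphicStem_congr hD (fun K z hz => hFf.unique hGf z hz K) hol

end Holomorphic

end SliceAnalysis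

end

noncomputable section

open Set Filter Topology

namespace SliceAnalysis

section Section

variable {n : ℕ} {D : Set (Fin n → ℂ)}

/-! ### Slice functions whose stem function has no components meeting the first indices -/

theorem prod_ofFn_update_of_lt {n : ℕ} (g : Fin n → ℍ[ℝ]) (m : Fin n) (h : ∀ i < m, g i = 1)
    (hm : g m = 1) (c : ℍ[ℝ]) :
    (List.ofFn (Function.update g m c)).prod = c * (List.ofFn g).prod := by
  induction n with
  | zero => exact m.elim0
  | succ n ih =>
    rw [List.ofFn_succ, List.ofFn_succ, List.prod_cons, List.prod_cons]
    induction m using Fin.cases with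
    | zero =>
      have : (fun i : Fin n => Function.update g 0 c i.succ) = fun i => g i.succ := by
        funext i; simp
      rw [this, hm]; simp
    | succ k =>
      have : (fun i : Fin n => Function.update g k.succ c i.succ)
          = Function.update (fun i : Fin n => g i.succ) k c := by
        funext i
        by_cases hik : i = k
        · subst hik; simp
        · rw [Function.update_of_ne hik, Function.update_of_ne (by simpa using hik)]
      rw [this, ih (fun i => g i.succ) k (fun i hi => h _ (by simpa using hi)) hm,
        Function.update_of_ne (Fin.succ_ne_zero k).symm, h 0 (Fin.succ_pos k), one_mul, one_mul]

theorem orderedProd_insert_of_lt (J : Fin n → ℍ[ℝ]) {L : Finset (Fin n)} {m : Fin n}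
    (h : ∀ i ∈ L, m < i) : orderedProd J (insert m L) = J m * orderedProd J L := by
  have hm : m ∉ L := fun hm => lt_irrefl m (h m hm)
  unfold orderedProd
  rw [← prod_ofFn_update_of_lt _ m (fun i hi => if_neg fun hiL => lt_asymm hi (h i hiL))
    (if_neg hm) (J m)]
  congr 2
  funext i
  rcases eq_or_ne i m with rfl | hi
  · simp
  · simp [hi]

theorem orderedProd_update_of_notMem (J : Fin n → ℍ[ℝ]) {L : Finset (Fin n)} {m : Fin n}
    (hm : m ∉ L) (j : ℍ[ℝ]) : orderedProd (Function.update J m j) L = orderedProd J L := by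
  unfold orderedProd
  congr 2
  funext i
  rcases eq_or_ne i m with rfl | hi
  · simp [hm]
  · simp [hi]

theorem orderedProd_ne_zero {J : Fin n → ℍ[ℝ]} (hJ : ∀ h, J h ∈ sphereUnits)
    (L : Finset (Fin n)) : orderedProd J L ≠ 0 := by
  unfold orderedProd
  rw [Ne, List.prod_eq_zero_iff, List.mem_ofFn]
  rintro ⟨i, hi⟩
  split_ifs at hi
  · have h1 : J i * J i = -1 := hJ i
    rw [hi] at h1
    simp at h1
  · exact one_ne_zero hi

/-- The sum of the terms of `F` with index not containing `m`, evaluated at the units `J`. -/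
def evenPart (F : StemMap n) (m : Fin n) (J : Fin n → ℍ[ℝ]) (z : Fin n → ℂ) : ℍ[ℝ] :=
  ∑ L : Finset (Fin n) with m ∉ L, orderedProd J L * F L z

/-- The sum of the terms of `F` with index containing `m`, evaluated at the units `J` and with the
factor `J m` left out. -/
def oddPart (F : StemMap n) (m : Fin n) (J : Fin n → ℍ[ℝ]) (z : Fin n → ℂ) : ℍ[ℝ] :=
  ∑ L : Finset (Fin n) with m ∉ L, orderedProd J L * F (insert m L) z

/-- The components of `F` with index meeting `{i | i < m}` vanish. -/
def VanishesBelow (F : StemMap n) (m : Fin n) : Prop :=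
  ∀ (L : Finset (Fin n)) (z : Fin n → ℂ), ∀ i ∈ L, i < m → F L z = 0

/-- With no smaller index present, the unit of `x_m` stands leftmost in every product and factors
out. An earlier unit in front would obstruct this, since quaternions do not commute. -/
theorem VanishesBelow.stemValue_update {F : StemMap n} {m : Fin n} (hF : VanishesBelow F m)
    (z : Fin n → ℂ) (J : Fin n → ℍ[ℝ]) (j : ℍ[ℝ]) :
    stemValue F z (Function.update J m j) = evenPart F m J z + j * oddPart F m J z := by
  rw [stemValue, sum_finset_eq_sum_notMem _ m, Finset.sum_add_distrib, evenPart, oddPart,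
    Finset.mul_sum]
  congr 1
  · refine Finset.sum_congr rfl fun L hL => ?_
    simp only [Finset.mem_filter, Finset.mem_univ, true_and] at hL
    rw [orderedProd_update_of_notMem J hL]
  · refine Finset.sum_congr rfl fun L hL => ?_
    simp only [Finset.mem_filter, Finset.mem_univ, true_and] at hL
    by_cases h : ∃ i ∈ L, i < m
    · obtain ⟨i, hi, him⟩ := h
      simp [hF (insert m L) z i (Finset.mem_insert_of_mem hi) him]
    · push Not at h
      rw [orderedProd_insert_of_lt _ fun i hi => lt_of_le_of_ne (h i hi) fun e => hL (e ▸ hi),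
        orderedProd_update_of_notMem J hL, Function.update_self, mul_assoc]

theorem evenPart_conjAt {F : StemMap n} (hF : IsStem D F) {m : Fin n} {z : Fin n → ℂ}
    (hz : z ∈ D) (J : Fin n → ℍ[ℝ]) : evenPart F m J (conjAt m z) = evenPart F m J z := by
  refine Finset.sum_congr rfl fun L hL => ?_
  simp only [Finset.mem_filter, Finset.mem_univ, true_and] at hL
  rw [hF.conjAt_of_notMem hz hL]

theorem oddPart_conjAt {F : StemMap n} (hF : IsStem D F) {m : Fin n} {z : Fin n → ℂ}
    (hz : z ∈ D) (J : Fin n → ℍ[ℝ]) : oddPart F m J (conjAt m z) = -oddPart F m J z := by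
  rw [oddPart, oddPart, ← Finset.sum_neg_distrib]
  refine Finset.sum_congr rfl fun L _ => ?_
  rw [hF.conjAt_of_mem hz (Finset.mem_insert_self _ _), mul_neg]

/-- The pairs of functions that are holomorphic at `w`. -/
def holPairs (w : ℂ) : Submodule ℝ ((ℂ → ℍ[ℝ]) × (ℂ → ℍ[ℝ])) where
  carrier := {p | HolPair p.1 p.2 w}
  add_mem' := fun ha hb => HolPair.add ha hb
  zero_mem' := holPair_zero
  smul_mem' := fun c _ h => HolPair.smul c h

theorem HolPair.const_mul {A B : ℂ → ℍ[ℝ]} {w : ℂ} (c : ℍ[ℝ]) (h : HolPair A B w) :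
    HolPair (fun x => c * A x) (fun x => c * B x) w :=
  h.comp (ContinuousLinearMap.mul ℝ ℍ[ℝ] c)

theorem HolPair.sum {ι : Type*} (s : Finset ι) {A B : ι → ℂ → ℍ[ℝ]} {w : ℂ}
    (h : ∀ i ∈ s, HolPair (A i) (B i) w) :
    HolPair (fun x => ∑ i ∈ s, A i x) (fun x => ∑ i ∈ s, B i x) w := by
  have h1 : ∑ i ∈ s, (A i, B i) ∈ holPairs w := (holPairs w).sum_mem h
  have h2 : HolPair (∑ i ∈ s, (A i, B i)).1 (∑ i ∈ s, (A i, B i)).2 w := h1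
  simpa only [Prod.fst_sum, Prod.snd_sum, Finset.sum_fn] using h2

theorem HolIn.holPair_parts {F : StemMap n} {m : Fin n} (hF : HolIn D m F) {z : Fin n → ℂ}
    (hz : z ∈ D) (J : Fin n → ℍ[ℝ]) :
    HolPair (fun w => evenPart F m J (Function.update z m w))
      (fun w => oddPart F m J (Function.update z m w)) (z m) := by
  refine HolPair.sum _ fun L hL => ?_
  simp only [Finset.mem_filter, Finset.mem_univ, true_and] at hL
  exact (hF z hz L hL).const_mul _

/-- Units obtained from the constant family `i` by the changes of sign in `s`. -/
def signedUnits (s : Finset (Fin n)) : Fin n → ℍ[ℝ] := fun i => if i ∈ s then -unitI else unitI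

theorem unitI_mul_self : unitI * unitI = -1 := by
  have h0 : unitI.re = 0 := rfl
  have h1 : unitI.imI = 1 := rfl
  have h2 : unitI.imJ = 0 := rfl
  have h3 : unitI.imK = 0 := rfl
  ext <;> simp [h0, h1, h2, h3]

theorem signedUnits_mem (s : Finset (Fin n)) (h : Fin n) : signedUnits s h ∈ sphereUnits := by
  change signedUnits s h * signedUnits s h = -1
  unfold signedUnits
  split_ifs
  · rw [neg_mul_neg, unitI_mul_self]
  · exact unitI_mul_self

theorem orderedProd_signedUnits (s L : Finset (Fin n)) :
    orderedProd (signedUnits s) L = conjSign s L • orderedProd (signedUnits ∅) L := by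
  induction s using Finset.induction_on with
  | empty => simp [conjSign]
  | insert a s ha ih =>
    have : signedUnits (insert a s) = Function.update (signedUnits s) a (-signedUnits s a) := by
      funext i
      rcases eq_or_ne i a with rfl | hi
      · simp [signedUnits, ha]
      · simp [signedUnits, hi]
    rw [this, orderedProd_update_neg, conjSign, Finset.prod_insert ha]
    split_ifs
    · rw [ih, neg_one_mul, neg_smul, conjSign]
    · rw [ih, one_mul, conjSign]

/-- Choosing all units among `±i` gives signed sums of the pairs `(F_L, F_{L ∪ m})`, each multiplied
on the left by a product of units. Fourier inversion isolates each pair, and the product of units is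
invertible. -/
theorem holIn_of_holPair_parts {F : StemMap n} {m : Fin n}
    (h : ∀ z ∈ D, ∀ J : Fin n → ℍ[ℝ], (∀ i, J i ∈ sphereUnits) →
      HolPair (fun w => evenPart F m J (Function.update z m w))
        (fun w => oddPart F m J (Function.update z m w)) (z m)) : HolIn D m F := by
  intro z hz L hL
  have hc := orderedProd_ne_zero (signedUnits_mem (n := n) ∅) L
  have key : (if m ∉ L then
      (fun w => orderedProd (signedUnits ∅) L * F L (Function.update z m w),
        fun w => orderedProd (signedUnits ∅) L * F (insert m L) (Function.update z m w)) else 0)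
      ∈ holPairs (z m) := by
    refine mem_of_forall_sum_conjSign_smul_mem (holPairs (z m)) (fun L => if m ∉ L then
      (fun w => orderedProd (signedUnits ∅) L * F L (Function.update z m w),
        fun w => orderedProd (signedUnits ∅) L * F (insert m L) (Function.update z m w)) else 0)
      (fun s => ?_) L
    have h1 : (fun w => evenPart F m (signedUnits s) (Function.update z m w),
        fun w => oddPart F m (signedUnits s) (Function.update z m w)) ∈ holPairs (z m) :=
      h z hz (signedUnits s) (signedUnits_mem s)
    convert h1 using 1
    simp only [smul_ite, smul_zero, ← Finset.sum_filter]
    ext1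
    · simp only [Prod.fst_sum, Prod.smul_fst]
      funext w
      simp only [evenPart, orderedProd_signedUnits s, Finset.sum_apply, Pi.smul_apply,
        smul_mul_assoc]
    · simp only [Prod.snd_sum, Prod.smul_snd]
      funext w
      simp only [oddPart, orderedProd_signedUnits s, Finset.sum_apply, Pi.smul_apply,
        smul_mul_assoc]
  rw [if_pos hL] at key
  have h2 := HolPair.const_mul (orderedProd (signedUnits ∅) L)⁻¹ (show HolPair _ _ _ from key)
  simpa only [inv_mul_cancel_left₀ hc] using h2

/-! ### Restrictions to one variable -/

theorem ConjInvariant.mem_of_forall (hD : ConjInvariant D) {z w : Fin n → ℂ} (hz : z ∈ D)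
    (h : ∀ i, w i = z i ∨ w i = (starRingEnd ℂ) (z i)) : w ∈ D := by
  classical
  have h0 : IsStem D (0 : StemMap n) := ⟨hD, fun z _ K h => by simp⟩
  have h1 : conjOn (Finset.univ.filter fun i => w i ≠ z i) z = w := by
    funext i
    simp only [conjOn, Finset.mem_filter, Finset.mem_univ, true_and]
    split_ifs with hi
    · exact ((h i).resolve_left hi).symm
    · push Not at hi
      exact hi.symm
  rw [← h1]
  exact (h0.apply_conjOn hz _ ∅).1

theorem stdCoord_slicePoint_eq_or {J : ℍ[ℝ]} (hJ : J ∈ sphereUnits) (z : ℂ) :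
    stdCoord (slicePoint z J) = z ∨ stdCoord (slicePoint z J) = (starRingEnd ℂ) z := by
  rcases stdCoord_slicePoint hJ z with h | h
  · exact Or.inl h.1
  · exact Or.inr h.1

/-- Passing to `stdCoord` at most conjugates each coordinate, which `D` does not see; the section
can be described with the given representatives `z`. -/
theorem mem_sectionBase_iff (hD : ConjInvariant D) (m : Fin n) {J : Fin n → ℍ[ℝ]}
    (hJ : ∀ i, J i ∈ sphereUnits) (z : Fin n → ℂ) (w : Fin 1 → ℂ) :
    w ∈ sectionBase D m (fun h => slicePoint (z h) (J h)) ↔ Function.update z m (w 0) ∈ D := by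
  constructor
  · intro hw
    refine hD.mem_of_forall hw fun i => ?_
    rcases eq_or_ne i m with rfl | hi
    · simp
    · rw [Function.update_of_ne hi, Function.update_of_ne hi]
      rcases stdCoord_slicePoint_eq_or (hJ i) (z i) with h | h
      · exact Or.inl h.symm
      · exact Or.inr (by rw [h, Complex.conj_conj])
  · intro hw
    refine hD.mem_of_forall hw fun i => ?_
    rcases eq_or_ne i m with rfl | hi
    · simp
    · rw [Function.update_of_ne hi, Function.update_of_ne hi]
      exact stdCoord_slicePoint_eq_or (hJ i) (z i)

theorem isOpen_sectionBase (hD : IsOpen D) (m : Fin n) (y : Fin n → ℍ[ℝ]) :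
    IsOpen (sectionBase D m y) := by
  have h1 : Continuous fun w : Fin 1 → ℂ => Function.update (fun j => stdCoord (y j)) m (w 0) :=
    continuous_const.update m (continuous_apply 0)
  exact hD.preimage h1

/-- The stem function of the restriction of `𝓘(F)` to the variable `x_m`. -/
def sectionStem (F : StemMap n) (m : Fin n) (z : Fin n → ℂ) (J : Fin n → ℍ[ℝ]) : StemMap 1 :=
  fun S w => if 0 ∈ S then oddPart F m J (Function.update z m (w 0))
    else evenPart F m J (Function.update z m (w 0))

theorem isStem_sectionStem {F : StemMap n} (hF : IsStem D F) (m : Fin n) {J : Fin n → ℍ[ℝ]}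
    (hJ : ∀ i, J i ∈ sphereUnits) (z : Fin n → ℂ) :
    IsStem (sectionBase D m fun h => slicePoint (z h) (J h)) (sectionStem F m z J) := by
  have e : ∀ w : Fin 1 → ℂ, Function.update z m (conjAt 0 w 0)
      = conjAt m (Function.update z m (w 0)) := fun w => by simp [conjAt]
  refine isStem_of_conjAt (conjInvariant_sectionBase hF.1 m _) ?_ ?_
  · intro w hw K h hK
    obtain rfl : h = 0 := Subsingleton.elim _ _
    rw [mem_sectionBase_iff hF.1 m hJ] at hw
    rw [sectionStem, sectionStem, if_pos hK, if_pos hK, e, oddPart_conjAt hF hw]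
  · intro w hw K h hK
    obtain rfl : h = 0 := Subsingleton.elim _ _
    rw [mem_sectionBase_iff hF.1 m hJ] at hw
    rw [sectionStem, sectionStem, if_neg hK, if_neg hK, e, evenPart_conjAt hF hw]

theorem stemValue_fin_one (F : StemMap 1) (w : Fin 1 → ℂ) (J : Fin 1 → ℍ[ℝ]) :
    stemValue F w J = F ∅ w + J 0 * F {0} w := by
  have h : VanishesBelow F 0 := fun L z i _ hi => absurd hi (by simp)
  have h1 := h.stemValue_update w J (J 0)
  have h2 : (Finset.univ.filter fun L : Finset (Fin 1) => 0 ∉ L) = {∅} := by decide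
  rw [Function.update_eq_self, evenPart, oddPart, h2, Finset.sum_singleton,
    Finset.sum_singleton] at h1
  simpa [orderedProd] using h1

theorem induces_sectionStem {F : StemMap n} {g : (Fin n → ℍ[ℝ]) → ℍ[ℝ]} (hF : IsStem D F)
    {m : Fin n} (hFm : VanishesBelow F m) (hFg : Induces D F g) {J : Fin n → ℍ[ℝ]}
    (hJ : ∀ i, J i ∈ sphereUnits) (z : Fin n → ℂ) :
    Induces (sectionBase D m fun h => slicePoint (z h) (J h)) (sectionStem F m z J)
      fun q => g (Function.update (fun h => slicePoint (z h) (J h)) m (q 0)) := by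
  intro w hw J' hJ'
  rw [mem_sectionBase_iff hF.1 m hJ] at hw
  have e : Function.update (fun h => slicePoint (z h) (J h)) m (slicePoint (w 0) (J' 0))
      = fun h => slicePoint (Function.update z m (w 0) h) (Function.update J m (J' 0) h) := by
    funext i
    rcases eq_or_ne i m with rfl | hi
    · simp
    · simp [hi]
  have hJu : ∀ h, Function.update J m (J' 0) h ∈ sphereUnits := by
    intro h
    rcases eq_or_ne h m with rfl | hh
    · simpa using hJ' 0
    · simpa [hh] using hJ h
  change g (Function.update _ m (slicePoint (w 0) (J' 0))) = _
  rw [e, hFg _ hw _ hJu, hFm.stemValue_update, stemValue_fin_one]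
  simp [sectionStem]

/-- Slice regularity with respect to `x_m` in terms of the stem function. -/
theorem isSliceRegularIn_iff (hD : IsOpen D) {F : StemMap n} {g : (Fin n → ℍ[ℝ]) → ℍ[ℝ]}
    (hF : IsStem D F) {m : Fin n} (hFm : VanishesBelow F m) (hFg : Induces D F g) :
    IsSliceRegularIn D m g ↔ HolIn D m F := by
  have key : ∀ (z : Fin n → ℂ) (J : Fin n → ℍ[ℝ]), (∀ i, J i ∈ sphereUnits) →
      (IsSliceRegular (sectionBase D m fun h => slicePoint (z h) (J h))
        (fun q => g (Function.update (fun h => slicePoint (z h) (J h)) m (q 0))) ↔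
      ∀ w, Function.update z m w ∈ D →
        HolPair (fun w => evenPart F m J (Function.update z m w))
          (fun w => oddPart F m J (Function.update z m w)) w) := by
    intro z J hJ
    rw [isSliceRegular_iff (isOpen_sectionBase hD m _) (isStem_sectionStem hF m hJ z)
      (induces_sectionStem hF hFm hFg hJ z)]
    constructor
    · intro h w hw
      have := h 0 (fun _ => w) ((mem_sectionBase_iff hF.1 m hJ z _).2 hw) ∅ (by simp)
      simpa [sectionStem] using this
    · intro h i w hw L hL
      obtain rfl : i = 0 := Subsingleton.elim _ _
      have := h (w 0) ((mem_sectionBase_iff hF.1 m hJ z _).1 hw)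
      simpa [sectionStem, hL] using this
  constructor
  · rintro ⟨-, h⟩
    refine holIn_of_holPair_parts fun z hz J hJ => ?_
    refine (key z J hJ).1 (h _ ⟨z, hz, J, hJ, rfl⟩) (z m) ?_
    rwa [Function.update_eq_self]
  · refine fun h => ⟨⟨F, hF, hFg⟩, ?_⟩
    rintro y ⟨z, hz, J, hJ, rfl⟩
    refine (key z J hJ).2 fun w hw => ?_
    simpa using h.holPair_parts hw J

end Section

end SliceAnalysis

end

noncomputable section

open Set Filter Topology

namespace SliceAnalysis

/-! ### The Cauchy-Riemann-Fueter operator on functions of one slice variable -/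

section OneVariable

/-- The Cauchy-Riemann-Fueter operator on differentials. -/
def fueter (T : ℍ[ℝ] →L[ℝ] ℍ[ℝ]) : ℍ[ℝ] :=
  (1 / 2 : ℝ) • (T 1 + unitI * T unitI + unitJ * T unitJ + unitK * T unitK)

@[simp] theorem unitI_re : unitI.re = 0 := rfl

@[simp] theorem unitI_imI : unitI.imI = 1 := rfl

@[simp] theorem unitI_imJ : unitI.imJ = 0 := rfl

@[simp] theorem unitI_imK : unitI.imK = 0 := rfl

@[simp] theorem unitJ_re : unitJ.re = 0 := rfl

@[simp] theorem unitJ_imI : unitJ.imI = 0 := rfl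

@[simp] theorem unitJ_imJ : unitJ.imJ = 1 := rfl

@[simp] theorem unitJ_imK : unitJ.imK = 0 := rfl

@[simp] theorem unitK_re : unitK.re = 0 := rfl

@[simp] theorem unitK_imI : unitK.imI = 0 := rfl

@[simp] theorem unitK_imJ : unitK.imJ = 0 := rfl

@[simp] theorem unitK_imK : unitK.imK = 1 := rfl

theorem unitJ_mul_self : unitJ * unitJ = -1 := by ext <;> simp

theorem unitK_mul_self : unitK * unitK = -1 := by ext <;> simp

theorem im_unitI : unitI.im = unitI := by ext <;> simp

theorem im_unitJ : unitJ.im = unitJ := by ext <;> simp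

theorem im_unitK : unitK.im = unitK := by ext <;> simp

theorem im_eq_sum (q : ℍ[ℝ]) : q.imI • unitI + q.imJ • unitJ + q.imK • unitK = q.im := by
  ext <;> simp

theorem norm_of_mem_sphereUnits {J : ℍ[ℝ]} (hJ : J ∈ sphereUnits) : ‖J‖ = 1 := by
  have h : ‖J‖ * ‖J‖ = 1 := by rw [← norm_mul, show J * J = -1 from hJ]; simp
  nlinarith [norm_nonneg J]

theorem stdUnit_mul_norm_im (q : ℍ[ℝ]) : ‖q.im‖ • stdUnit q = q.im := by
  unfold stdUnit
  split_ifs with h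
  · rw [h, norm_zero, zero_smul]
  · rw [smul_smul, mul_inv_cancel₀ (norm_ne_zero_iff.2 h), one_smul]

/-- The real part as a continuous linear map. -/
def reL : ℍ[ℝ] →L[ℝ] ℝ := LinearMap.toContinuousLinearMap
  { toFun := fun q => q.re, map_add' := fun _ _ => by simp, map_smul' := fun _ _ => by simp }

/-- The imaginary part as a continuous linear map. -/
def imL : ℍ[ℝ] →L[ℝ] ℍ[ℝ] := LinearMap.toContinuousLinearMap
  { toFun := fun q => q.im, map_add' := fun _ _ => by simp, map_smul' := fun _ _ => by simp }

theorem reL_apply (q : ℍ[ℝ]) : reL q = q.re := rfl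

theorem imL_apply (q : ℍ[ℝ]) : imL q = q.im := rfl

theorem continuous_stdCoord : Continuous stdCoord := by
  have : stdCoord = fun q => (q.re : ℂ) + (‖q.im‖ : ℂ) * Complex.I := by
    funext q; apply Complex.ext <;> simp [stdCoord]
  rw [this]
  have h1 : Continuous fun q : ℍ[ℝ] => q.re := Quaternion.continuous_re
  have h2 : Continuous fun q : ℍ[ℝ] => q.im := Quaternion.continuous_im
  fun_prop

theorem norm_stdCoord (q : ℍ[ℝ]) : ‖stdCoord q‖ = ‖q‖ := by
  have h1 : ‖stdCoord q‖ ^ 2 = q.re ^ 2 + ‖q.im‖ ^ 2 := by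
    rw [← Complex.normSq_eq_norm_sq, Complex.normSq_apply]
    simp only [stdCoord]; ring
  have h2 : ‖q‖ ^ 2 = q.re ^ 2 + ‖q.im‖ ^ 2 := by
    rw [pow_two, pow_two ‖q.im‖, ← Quaternion.normSq_eq_norm_mul_self,
      ← Quaternion.normSq_eq_norm_mul_self, Quaternion.normSq_def', Quaternion.normSq_def']
    simp
    ring
  rw [← h2] at h1
  exact (pow_left_inj₀ (norm_nonneg _) (norm_nonneg _) two_ne_zero).1 h1

/-- The derivative of `stdCoord` at a point with non-zero imaginary part. -/
theorem hasFDerivAt_stdCoord {q₀ : ℍ[ℝ]} (h0 : q₀.im ≠ 0) :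
    ∃ T : ℍ[ℝ] →L[ℝ] ℂ, HasFDerivAt stdCoord T q₀ ∧
      ∀ v : ℍ[ℝ], T v = (v.re : ℂ) + ((‖q₀.im‖⁻¹ * inner ℝ q₀.im v.im : ℝ) : ℂ) * Complex.I := by
  have h1 : HasFDerivAt (fun q : ℍ[ℝ] => ‖imL q‖ ^ 2) _ q₀ := imL.hasFDerivAt.norm_sq
  have hn : ‖imL q₀‖ ≠ 0 := norm_ne_zero_iff.2 h0
  have h2 := h1.sqrt (pow_ne_zero 2 hn)
  simp only [Real.sqrt_sq (norm_nonneg _)] at h2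
  have h3 := (Complex.ofRealCLM.hasFDerivAt.comp q₀ reL.hasFDerivAt).add
    ((Complex.ofRealCLM.hasFDerivAt.comp q₀ h2).mul_const Complex.I)
  refine ⟨_, h3.congr_of_eventuallyEq (Eventually.of_forall fun q => ?_), fun v => ?_⟩
  · apply Complex.ext <;> simp [stdCoord, reL_apply, imL_apply]
  · simp [reL_apply, imL_apply]
    rw [imL_apply] at hn
    field_simp

variable {A B : ℂ → ℍ[ℝ]} {A' B' : ℂ →L[ℝ] ℍ[ℝ]} {q₀ : ℍ[ℝ]}

/-- Oddness of `B` and Cauchy-Riemann give `B' 1 = 0 = A' I`. With `c = B' I = A' 1` the linear part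
is `Re (q - q₀) c + Im q c = (q - q₀) c`; the arbitrary unit at real points causes no discontinuity.
-/
theorem hasFDerivAt_slice_of_im_eq_zero (hA : HasFDerivAt A A' (stdCoord q₀))
    (hB : HasFDerivAt B B' (stdCoord q₀)) (e1 : A' 1 = B' Complex.I)
    (e2 : A' Complex.I = -B' 1) (h0 : q₀.im = 0)
    (hodd : ∀ᶠ w in 𝓝 (stdCoord q₀), B ((starRingEnd ℂ) w) = -B w) :
    HasFDerivAt (fun q => A (stdCoord q) + stdUnit q * B (stdCoord q))
      ((ContinuousLinearMap.mul ℝ ℍ[ℝ]).flip (B' Complex.I)) q₀ := by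
  set w₀ := stdCoord q₀ with hw₀
  have hconj : (starRingEnd ℂ) w₀ = w₀ := Complex.conj_eq_iff_im.2 (by simp [hw₀, stdCoord, h0])
  have hself : ∀ q : ℍ[ℝ], q = -q → q = 0 := fun q hq => by
    have h4 : (2 : ℝ) • q = 0 := by rw [two_smul]; nth_rewrite 1 [hq]; simp
    simpa using h4
  have hB0 : B w₀ = 0 := hself _ (by simpa [hconj] using hodd.self_of_nhds)
  have hB1 : B' 1 = 0 := by
    have h1 : HasFDerivAt (fun w => B ((starRingEnd ℂ) w))
        (B'.comp (Complex.conjCLE : ℂ →L[ℝ] ℂ)) w₀ := by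
      refine HasFDerivAt.comp w₀ (g := B) (f := fun w => (starRingEnd ℂ) w) ?_
        (Complex.conjCLE : ℂ →L[ℝ] ℂ).hasFDerivAt
      rwa [hconj]
    have h2 := (h1.congr_of_eventuallyEq (hodd.mono fun _ h => h.symm)).unique hB.neg
    have h3 := congrArg (fun T : ℂ →L[ℝ] ℍ[ℝ] => T 1) h2
    exact hself _ (by simpa using h3)
  have hA1 : A' Complex.I = 0 := by rw [e2, hB1, neg_zero]
  have hlin : ∀ (T : ℂ →L[ℝ] ℍ[ℝ]) (w : ℂ), T w = w.re • T 1 + w.im • T Complex.I := by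
    intro T w
    rw [← map_smul, ← map_smul, ← map_add]
    congr 1
    apply Complex.ext <;> simp
  have hto : Tendsto stdCoord (𝓝 q₀) (𝓝 w₀) := continuous_stdCoord.tendsto q₀
  -- Valid because `q₀` is real; with `norm_stdCoord` it carries the remainder estimates of `A` and
  -- `B` over to `q`.
  have hsub : ∀ q, stdCoord q - w₀ = stdCoord (q - q₀) := by
    intro q
    apply Complex.ext <;> simp [hw₀, stdCoord, h0]
  have hbig : (fun q => stdCoord q - w₀) =O[𝓝 q₀] fun q => q - q₀ :=
    Asymptotics.IsBigO.of_bound 1 (Eventually.of_forall fun q => by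
      rw [hsub, norm_stdCoord, one_mul])
  have hA2 := (hA.isLittleO.comp_tendsto hto).trans_isBigO hbig
  have hB2 := (hB.isLittleO.comp_tendsto hto).trans_isBigO hbig
  have hB3 : (fun q => stdUnit q * (B (stdCoord q) - B w₀ - B' (stdCoord q - w₀)))
      =o[𝓝 q₀] fun q => q - q₀ := by
    refine (Asymptotics.IsBigO.of_bound 1 (Eventually.of_forall fun q => ?_)).trans_isLittleO hB2
    rw [one_mul, norm_mul, norm_of_mem_sphereUnits (stdUnit_mem q), one_mul]
    rfl
  refine HasFDerivAt.of_isLittleO ((hA2.add hB3).congr_left fun q => ?_)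
  have hq : q - q₀ = ((q - q₀).re : ℍ[ℝ]) + q.im := by
    have h1 := Quaternion.re_add_im (q - q₀)
    rw [Quaternion.im_sub, h0, sub_zero] at h1
    exact h1.symm
  have him : (stdCoord (q - q₀)).im = ‖q.im‖ := by simp [stdCoord, h0]
  have hre : (stdCoord (q - q₀)).re = (q - q₀).re := rfl
  rw [← hw₀]
  simp only [Function.comp, hB0, hsub, hlin A' (stdCoord (q - q₀)), hlin B' (stdCoord (q - q₀)),
    hA1, hB1, e1, him, hre, smul_zero, add_zero, zero_add, sub_zero, mul_zero,
    ContinuousLinearMap.flip_apply, ContinuousLinearMap.mul_apply', mul_sub, mul_smul_comm]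
  rw [← smul_mul_assoc, stdUnit_mul_norm_im]
  conv_rhs => rw [hq, add_mul, Quaternion.coe_mul_eq_smul]
  abel

/-- Write `J B = Im q · C` with `C = B / β`, smooth away from the reals. The Cauchy-Riemann
equations cancel all derivatives of `A` and `B`. Differentiating `1 / β` leaves `C`, differentiating
`Im q` leaves `(i² + j² + k²) C = -3 C`; half of the total is `-C`. -/
theorem hasFDerivAt_slice_of_im_ne_zero (hA : HasFDerivAt A A' (stdCoord q₀))
    (hB : HasFDerivAt B B' (stdCoord q₀)) (e1 : A' 1 = B' Complex.I)
    (e2 : A' Complex.I = -B' 1) (h0 : q₀.im ≠ 0) :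
    ∃ T, HasFDerivAt (fun q => A (stdCoord q) + stdUnit q * B (stdCoord q)) T q₀ ∧
      fueter T = -(‖q₀.im‖⁻¹ • B (stdCoord q₀)) := by
  obtain ⟨S, hS, hSv⟩ := hasFDerivAt_stdCoord h0
  set w₀ := stdCoord q₀ with hw₀
  set β := ‖q₀.im‖ with hβ
  have hβ0 : β ≠ 0 := norm_ne_zero_iff.2 h0
  have hw : w₀.im = β := rfl
  have hinv : HasFDerivAt (fun w : ℂ => (w.im)⁻¹) (-((β ^ 2)⁻¹ • Complex.imCLM)) w₀ := by
    have h1 := (hasDerivAt_inv (x := Complex.imCLM w₀) (by simpa [hw] using hβ0)).comp_hasFDerivAt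
      w₀ Complex.imCLM.hasFDerivAt
    simpa [hw, Function.comp_def] using h1
  have hC := hinv.smul hB
  have hφ := (hA.comp q₀ hS).add (imL.hasFDerivAt.mul' (hC.comp q₀ hS))
  refine ⟨_, hφ.congr_of_eventuallyEq ?_, ?_⟩
  · have hne : ∀ᶠ q : ℍ[ℝ] in 𝓝 q₀, q.im ≠ 0 :=
      Quaternion.continuous_im.continuousAt.eventually_ne h0
    filter_upwards [hne] with q hq
    have : stdUnit q * B (stdCoord q) = q.im * ((‖q.im‖)⁻¹ • B (stdCoord q)) := by
      rw [stdUnit, if_neg hq, smul_mul_assoc, mul_smul_comm]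
    simp only [this]
    rfl
  · have r1 : (1 : ℍ[ℝ]).im = 0 := by simp
    have hinner : ∀ a b : ℍ[ℝ], (inner ℝ a b : ℝ)
        = a.re * b.re + a.imI * b.imI + a.imJ * b.imJ + a.imK * b.imK := fun a b => by
      rw [Quaternion.inner_def]; simp
    have S1 : S 1 = 1 := by rw [hSv, r1]; simp
    have SI : S unitI = ((β⁻¹ * q₀.imI : ℝ) : ℂ) * Complex.I := by
      rw [hSv, hinner, im_unitI]; simp
    have SJ : S unitJ = ((β⁻¹ * q₀.imJ : ℝ) : ℂ) * Complex.I := by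
      rw [hSv, hinner, im_unitJ]; simp
    have SK : S unitK = ((β⁻¹ * q₀.imK : ℝ) : ℂ) * Complex.I := by
      rw [hSv, hinner, im_unitK]; simp
    have hlin : ∀ (T : ℂ →L[ℝ] ℍ[ℝ]) (r : ℝ), T ((r : ℂ) * Complex.I) = r • T Complex.I := by
      intro T r
      rw [← map_smul]; simp
    have iI : imL unitI = unitI := im_unitI
    have iJ : imL unitJ = unitJ := im_unitJ
    have iK : imL unitK = unitK := im_unitK
    have i1 : imL 1 = 0 := r1
    have hpp : q₀.im * q₀.im = -((β ^ 2) • (1 : ℍ[ℝ])) := by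
      have h1 := stdUnit_mul_norm_im q₀
      rw [← h1, smul_mul_smul_comm, show stdUnit q₀ * stdUnit q₀ = -1 from stdUnit_mem q₀,
        smul_neg, ← hβ, ← pow_two]
    simp only [fueter, add_apply, ContinuousLinearMap.comp_apply, S1, SI, SJ, SK, hlin,
      smul_apply, i1, iI, iJ, iK, imL_apply, hw, ContinuousLinearMap.smulRight_apply,
      neg_apply, Complex.imCLM_apply, Complex.one_im, Complex.I_im, smul_zero, add_zero, smul_eq_mul, mul_one, op_smul_eq_mul, Function.comp, Pi.smul_apply', e1,
      e2, ← hw₀, neg_smul]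
    have hsum : ∀ X Y C : ℍ[ℝ],
        unitI * ((β⁻¹ * q₀.imI) • X + (q₀.im * ((β⁻¹ * q₀.imI) • Y) + unitI * C))
          + unitJ * ((β⁻¹ * q₀.imJ) • X + (q₀.im * ((β⁻¹ * q₀.imJ) • Y) + unitJ * C))
          + unitK * ((β⁻¹ * q₀.imK) • X + (q₀.im * ((β⁻¹ * q₀.imK) • Y) + unitK * C))
        = β⁻¹ • (q₀.im * X + q₀.im * q₀.im * Y) - (3 : ℝ) • C := by
      intro X Y C
      -- Only the left factors on the right-hand side are expanded in `i, j, k`; the inner `q₀.im`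
      -- stays intact so that both sides match term by term.
      nth_rewrite 4 [← im_eq_sum q₀]
      nth_rewrite 4 [← im_eq_sum q₀]
      simp only [mul_add, add_mul, ← mul_assoc, unitI_mul_self, unitJ_mul_self, unitK_mul_self,
        smul_mul_assoc, mul_smul_comm, smul_add, smul_smul, neg_mul, one_mul]
      module
    rw [show ∀ P a b c : ℍ[ℝ], P + a + b + c = P + (a + b + c) from fun _ _ _ _ => by abel, hsum,
      hpp]
    simp only [mul_zero, zero_smul, neg_zero, add_zero, mul_smul_comm, neg_mul, smul_mul_assoc,
      one_mul, mul_neg]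
    match_scalars <;> field_simp <;> ring

end OneVariable

end SliceAnalysis

end

noncomputable section

open Set Filter Topology

namespace SliceAnalysis

/-! ### The Cauchy-Riemann-Fueter derivative of an induced function -/

section Fueter

variable {n : ℕ} {D : Set (Fin n → ℂ)}

theorem VanishesBelow.varMul {F : StemMap n} {h : Fin n} (hF : VanishesBelow F h) :
    VanishesBelow (varMul h F) h := by
  intro L z i hi hih
  rw [SliceAnalysis.varMul, hF L z i hi hih,
    hF _ z i ((mem_symmDiff_singleton_of_ne hih.ne).2 hi) hih, smul_zero, smul_zero, add_zero]

theorem VanishesBelow.stemSphDeriv {F : StemMap n} {h : Fin n} (hF : VanishesBelow F h) :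
    VanishesBelow (stemSphDeriv h F) h := by
  intro L z i hi hih
  have h1 : ∀ w, F (insert h L) w = 0 := fun w => hF _ w i (Finset.mem_insert_of_mem hi) hih
  simp [SliceAnalysis.stemSphDeriv, h1]

theorem vanishesBelow_ordStem (F : StemMap n) (K : Finset (Fin n)) (m : Fin n) :
    VanishesBelow (ordStem F K m) m := fun _ z _ hi him => ordStem_eq_zero him hi z

theorem VanishesBelow.inducedFun_update {F : StemMap n} {h : Fin n} (hF : VanishesBelow F h)
    (x : Fin n → ℍ[ℝ]) (q : ℍ[ℝ]) :
    inducedFun F (Function.update x h q)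
      = evenPart F h (fun i => stdUnit (x i))
          (Function.update (fun i => stdCoord (x i)) h (stdCoord q))
        + stdUnit q * oddPart F h (fun i => stdUnit (x i))
          (Function.update (fun i => stdCoord (x i)) h (stdCoord q)) := by
  rw [← hF.stemValue_update, inducedFun]
  congr 1
  · funext i
    rcases eq_or_ne i h with rfl | hi
    · simp
    · simp [hi]
  · funext i
    rcases eq_or_ne i h with rfl | hi
    · simp
    · simp [hi]

theorem VanishesBelow.inducedFun_eq {F : StemMap n} {h : Fin n} (hF : VanishesBelow F h)
    (x : Fin n → ℍ[ℝ]) :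
    inducedFun F x = evenPart F h (fun i => stdUnit (x i)) (fun i => stdCoord (x i))
        + stdUnit (x h) * oddPart F h (fun i => stdUnit (x i)) (fun i => stdCoord (x i)) := by
  have := hF.inducedFun_update x (x h)
  rwa [Function.update_eq_self, Function.update_eq_self_iff.2 rfl] at this

theorem evenPart_varMul (F : StemMap n) (h : Fin n) (J : Fin n → ℍ[ℝ]) (z : Fin n → ℂ) :
    evenPart (varMul h F) h J z = (z h).re • evenPart F h J z - (z h).im • oddPart F h J z := by
  rw [evenPart, evenPart, oddPart, Finset.smul_sum, Finset.smul_sum, ← Finset.sum_sub_distrib]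
  refine Finset.sum_congr rfl fun L hL => ?_
  simp only [Finset.mem_filter, Finset.mem_univ, true_and] at hL
  rw [varMul_of_notMem hL, mul_sub, mul_smul_comm, mul_smul_comm]

theorem oddPart_varMul (F : StemMap n) (h : Fin n) (J : Fin n → ℍ[ℝ]) (z : Fin n → ℂ) :
    oddPart (varMul h F) h J z = (z h).re • oddPart F h J z + (z h).im • evenPart F h J z := by
  rw [oddPart, evenPart, oddPart, Finset.smul_sum, Finset.smul_sum, ← Finset.sum_add_distrib]
  refine Finset.sum_congr rfl fun L hL => ?_
  simp only [Finset.mem_filter, Finset.mem_univ, true_and] at hL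
  rw [varMul_insert hL, mul_add, mul_smul_comm, mul_smul_comm]

/-- The stem function `Z_h ⊗ F` induces the function `x_h 𝓘(F)`, if `F` has no components meeting
the indices below `h`. -/
theorem VanishesBelow.inducedFun_varMul {F : StemMap n} {h : Fin n} (hF : VanishesBelow F h)
    (x : Fin n → ℍ[ℝ]) : inducedFun (SliceAnalysis.varMul h F) x = x h * inducedFun F x := by
  rw [hF.varMul.inducedFun_eq, hF.inducedFun_eq, evenPart_varMul, oddPart_varMul]
  have hx : x h = (stdCoord (x h)).re • (1 : ℍ[ℝ]) + (stdCoord (x h)).im • stdUnit (x h) := by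
    conv_lhs => rw [← slicePoint_std (x h)]
    rw [slicePoint, Quaternion.mul_coe_eq_smul, ← mul_one ((stdCoord (x h)).re : ℍ[ℝ]),
      Quaternion.coe_mul_eq_smul]
  have hJ : stdUnit (x h) * stdUnit (x h) = -1 := stdUnit_mem (x h)
  generalize evenPart F h _ _ = E
  generalize oddPart F h _ _ = O
  generalize stdUnit (x h) = J at hx hJ ⊢
  generalize stdCoord (x h) = w at hx ⊢
  rw [hx]
  simp only [add_mul, mul_add, smul_mul_assoc, mul_smul_comm, one_mul, ← mul_assoc, hJ, neg_mul]
  module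

theorem oddPart_stemSphDeriv (F : StemMap n) (h : Fin n) (J : Fin n → ℍ[ℝ]) (z : Fin n → ℂ) :
    oddPart (stemSphDeriv h F) h J z = 0 :=
  Finset.sum_eq_zero fun L _ => by simp [stemSphDeriv]

theorem evenPart_stemSphDeriv_of_im_ne_zero (F : StemMap n) {h : Fin n} (J : Fin n → ℍ[ℝ])
    {z : Fin n → ℂ} (h0 : (z h).im ≠ 0) :
    evenPart (stemSphDeriv h F) h J z = ((z h).im)⁻¹ • oddPart F h J z := by
  rw [evenPart, oddPart, Finset.smul_sum]
  refine Finset.sum_congr rfl fun L hL => ?_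
  simp only [Finset.mem_filter, Finset.mem_univ, true_and] at hL
  rw [stemSphDeriv, if_neg hL, if_neg h0, mul_smul_comm]

theorem HolIn.evenPart_stemSphDeriv_of_im_eq_zero {F : StemMap n} {h : Fin n} (hF : HolIn D h F)
    (J : Fin n → ℍ[ℝ]) {z : Fin n → ℂ} (hz : z ∈ D) (h0 : (z h).im = 0) {B' : ℂ →L[ℝ] ℍ[ℝ]}
    (hB : HasFDerivAt (fun w => oddPart F h J (Function.update z h w)) B' (z h)) :
    evenPart (SliceAnalysis.stemSphDeriv h F) h J z = B' Complex.I := by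
  have h1 : HasFDerivAt (fun w => oddPart F h J (Function.update z h w)) _ (z h) :=
    HasFDerivAt.fun_sum fun L _ =>
      (hF.differentiableAt hz (insert h L)).hasFDerivAt.const_mul (orderedProd J L)
  rw [hB.unique h1, evenPart, sum_apply]
  refine Finset.sum_congr rfl fun L hL => ?_
  simp only [Finset.mem_filter, Finset.mem_univ, true_and] at hL
  rw [stemSphDeriv_of_im_eq_zero hL h0 (hF.differentiableAt hz (insert h L)).hasFDerivAt,
    smul_apply, smul_eq_mul]

/-- `(1 + i² + j² + k²) / 2 = -1`. -/
theorem fueter_mul_flip (c : ℍ[ℝ]) : fueter ((ContinuousLinearMap.mul ℝ ℍ[ℝ]).flip c) = -c := by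
  simp only [fueter, ContinuousLinearMap.flip_apply, ContinuousLinearMap.mul_apply', one_mul,
    ← mul_assoc, unitI_mul_self, unitJ_mul_self, unitK_mul_self, neg_mul]
  module

theorem fueter_smul (c : ℝ) (T : ℍ[ℝ] →L[ℝ] ℍ[ℝ]) : fueter (c • T) = c • fueter T := by
  simp only [fueter, smul_apply, mul_smul_comm]
  module

/-- The spherical derivative as a Cauchy-Riemann-Fueter derivative. -/
theorem HolIn.exists_hasFDerivAt_inducedFun (hD : IsOpen D) {F : StemMap n} (hF : IsStem D F)
    {h : Fin n} (hFh : VanishesBelow F h) (hol : HolIn D h F) {x : Fin n → ℍ[ℝ]}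
    (hx : x ∈ circularization D) :
    ∃ T, HasFDerivAt (fun q => inducedFun F (Function.update x h q)) T (x h) ∧
      fueter T = -inducedFun (SliceAnalysis.stemSphDeriv h F) x := by
  rw [mem_circularization_iff hF.1] at hx
  simp only [hFh.inducedFun_update, hFh.stemSphDeriv.inducedFun_eq, oddPart_stemSphDeriv, mul_zero,
    add_zero]
  set z : Fin n → ℂ := fun i => stdCoord (x i) with hz
  set J : Fin n → ℍ[ℝ] := fun i => stdUnit (x i)
  obtain ⟨A', B', hA, hB, e1, e2⟩ := hol.holPair_parts hx J
  have hB0 : oddPart F h J z = oddPart F h J (Function.update z h (stdCoord (x h))) :=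
    congrArg _ (Function.update_eq_self h z).symm
  set A : ℂ → ℍ[ℝ] := fun w => evenPart F h J (Function.update z h w)
  set B : ℂ → ℍ[ℝ] := fun w => oddPart F h J (Function.update z h w) with hBdef
  change ∃ T, HasFDerivAt (fun q => A (stdCoord q) + stdUnit q * B (stdCoord q)) T (x h) ∧ _
  by_cases h0 : (x h).im = 0
  · have h0' : (z h).im = 0 := by simp [hz, stdCoord, h0]
    refine ⟨_, hasFDerivAt_slice_of_im_eq_zero hA hB e1 e2 h0 ?_, ?_⟩
    · filter_upwards [eventually_update_mem hD hx h] with w hw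
      have := oddPart_conjAt (m := h) hF hw J
      simpa only [hBdef, conjAt, Function.update_idem, Function.update_self] using this
    · rw [fueter_mul_flip, hol.evenPart_stemSphDeriv_of_im_eq_zero J hx h0' hB]
  · have h0' : (z h).im ≠ 0 := norm_ne_zero_iff.2 h0
    obtain ⟨T, hT, hT'⟩ := hasFDerivAt_slice_of_im_ne_zero hA hB e1 e2 h0
    refine ⟨T, hT, ?_⟩
    rw [hT', evenPart_stemSphDeriv_of_im_ne_zero F J h0', hB0]
    rfl

theorem crfBar_eq_fueter {g : (Fin n → ℍ[ℝ]) → ℍ[ℝ]} {h : Fin n} {x : Fin n → ℍ[ℝ]}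
    {T : ℍ[ℝ] →L[ℝ] ℍ[ℝ]} (hT : HasFDerivAt (fun q => g (Function.update x h q)) T (x h)) :
    crfBar h g x = fueter T := by
  have key : ∀ v : ℍ[ℝ], lineDeriv ℝ g x (Pi.single h v : Fin n → ℍ[ℝ]) = T v := by
    intro v
    have h1 : (fun t : ℝ => g (x + t • (Pi.single h v : Fin n → ℍ[ℝ])))
        = fun t : ℝ => g (Function.update x h (x h + t • v)) := by
      funext t
      congr 1
      funext i
      rcases eq_or_ne i h with rfl | hi
      · simp
      · simp [hi]
    rw [lineDeriv, h1]
    exact (hT.hasLineDerivAt v).deriv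
  simp only [crfBar, key, fueter]

theorem isOpen_circularization (hD : IsOpen D) (hc : ConjInvariant D) :
    IsOpen (circularization D) := by
  have h1 : circularization D = (fun (x : Fin n → ℍ[ℝ]) i => stdCoord (x i)) ⁻¹' D := by
    ext x
    exact mem_circularization_iff hc x
  rw [h1]
  exact hD.preimage (continuous_pi fun i => continuous_stdCoord.comp (continuous_apply i))

/-- Form suited to iteration: `c` carries the accumulated sign, and agreement on the open set `Ω_D`
is enough to differentiate. -/
theorem HolIn.crfBar_inducedFun (hD : IsOpen D) {F : StemMap n} (hF : IsStem D F)
    {h : Fin n} (hFh : VanishesBelow F h) (hol : HolIn D h F) {g : (Fin n → ℍ[ℝ]) → ℍ[ℝ]} {c : ℝ}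
    (hg : ∀ x ∈ circularization D, g x = c • inducedFun F x) {x : Fin n → ℍ[ℝ]}
    (hx : x ∈ circularization D) :
    DifferentiableAt ℝ (fun q => g (Function.update x h q)) (x h) ∧
      crfBar h g x = (-c) • inducedFun (SliceAnalysis.stemSphDeriv h F) x := by
  obtain ⟨T, hT, hT'⟩ := hol.exists_hasFDerivAt_inducedFun hD hF hFh hx
  have hev : ∀ᶠ q in 𝓝 (x h), Function.update x h q ∈ circularization D := by
    have hc : Continuous fun q => Function.update x h q := continuous_const.update h continuous_id
    refine ((isOpen_circularization hD hF.1).preimage hc).mem_nhds ?_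
    rw [mem_preimage, Function.update_eq_self]; exact hx
  have h1 : HasFDerivAt (fun q => g (Function.update x h q)) (c • T) (x h) :=
    (hT.const_smul c).congr_of_eventuallyEq (hev.mono fun q hq => hg _ hq)
  refine ⟨h1.differentiableAt, ?_⟩
  rw [crfBar_eq_fueter h1, fueter_smul, hT', smul_neg, neg_smul]

end Fueter

/-! ### The ordered components -/

section Components

variable {n : ℕ} {D : Set (Fin n → ℂ)}

theorem stemOf_spec {f : (Fin n → ℍ[ℝ]) → ℍ[ℝ]} (hf : IsSlice D f) :
    IsStem D (stemOf D f) ∧ Induces D (stemOf D f) f := Classical.epsilon_spec hf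

theorem inducedFun_congr {F G : StemMap n} (hF : IsStem D F) (hFG : StemEqOn D F G)
    {x : Fin n → ℍ[ℝ]} (hx : x ∈ circularization D) : inducedFun F x = inducedFun G x := by
  rw [mem_circularization_iff hF.1] at hx
  rw [inducedFun, inducedFun, stemValue, stemValue]
  exact Finset.sum_congr rfl fun L _ => by rw [hFG L _ hx]

theorem Induces.inducedFun_eq {F : StemMap n} {f : (Fin n → ℍ[ℝ]) → ℍ[ℝ]} (hF : IsStem D F)
    (hf : Induces D F f) {x : Fin n → ℍ[ℝ]} (hx : x ∈ circularization D) :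
    f x = inducedFun F x := by
  obtain ⟨z, hz, J, hJ, rfl⟩ := hx
  rw [hf z hz J hJ, induces_inducedFun hF z hz J hJ]

theorem Induces.congr {F G : StemMap n} {f : (Fin n → ℍ[ℝ]) → ℍ[ℝ]} (hf : Induces D F f)
    (hFG : StemEqOn D F G) : Induces D G f := by
  intro z hz J hJ
  rw [hf z hz J hJ]
  exact Finset.sum_congr rfl fun L _ => by rw [hFG L z hz]

/-- The stem function of an ordered component, when the previous components are holomorphic in the
respective variables. -/
theorem stemEqOn_orderedComponent (hD : IsOpen D) {F : StemMap n} {m : ℕ} (hm : m ≤ n)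
    (hF : ∀ i : Fin n, (i : ℕ) < m → ∀ K, HolIn D i (ordStem F K i)) {K : Finset (Fin n)}
    (hK : K ⊆ firstIndices n m) :
    StemEqOn D (stemSphDerivs (firstIndices n m) (stemMul (stemMonomial K) F))
      (ordStem F K m) := by
  have := stemSphDerivs_monMul_eq_ordStem hD hm hF K
  rwa [Finset.sdiff_eq_empty_iff_subset.2 hK, monMul_empty, ← stemMul_stemMonomial] at this

theorem ordStem_inter_firstIndices (F : StemMap n) (K : Finset (Fin n)) (m : ℕ) :
    ordStem F (K ∩ firstIndices n m) m = ordStem F K m :=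
  ordStem_congr fun i hi => by simp [mem_firstIndices, hi]

/-- Holomorphy at the earlier steps is what identifies the stem function of the component with
`ordStem`: it lets the remaining variables pass the derivatives at real points. -/
theorem isSliceRegularIn_orderedComponent_iff (hD : IsOpen D) {f : (Fin n → ℍ[ℝ]) → ℍ[ℝ]}
    (hf : IsSlice D f) {m : Fin n}
    (hF : ∀ i < m, ∀ K, HolIn D i (ordStem (stemOf D f) K i))
    {K : Finset (Fin n)} (hK : K ⊆ firstIndices n m) :
    IsSliceRegularIn D m (orderedComponent D m K f) ↔ HolIn D m (ordStem (stemOf D f) K m) := by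
  have hst := (stemOf_spec hf).1.ordStem hD K m
  have heq := stemEqOn_orderedComponent hD m.2.le hF hK
  exact isSliceRegularIn_iff hD hst (vanishesBelow_ordStem _ K m)
    ((induces_inducedFun (hst.congr heq)).congr heq)

theorem isSliceRegular_iff_orderedComponent (hD : IsOpen D) {f : (Fin n → ℍ[ℝ]) → ℍ[ℝ]}
    (hf : IsSlice D f) :
    IsSliceRegular D f ↔ ∀ m : Fin n, ∀ K ⊆ firstIndices n m,
      IsSliceRegularIn D m (orderedComponent D m K f) := by
  obtain ⟨hF, hFf⟩ := stemOf_spec hf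
  rw [isSliceRegular_iff hD hF hFf]
  constructor
  · intro hol m K hK
    exact (isSliceRegularIn_orderedComponent_iff hD hf
      (fun i _ K => HolIn.ordStem hD hF hol K le_rfl) hK).2 (HolIn.ordStem hD hF hol K le_rfl)
  · intro h
    refine HolIn.of_ordStem hD hF fun m => ?_
    -- Strong induction, since reading off step `m` presupposes holomorphy at all earlier steps.
    induction m using WellFoundedLT.induction with
    | _ m ih =>
      intro K
      rw [← ordStem_inter_firstIndices]
      exact (isSliceRegularIn_orderedComponent_iff hD hf (fun i hi => ih i hi)
        Finset.inter_subset_right).1 (h m _ Finset.inter_subset_right)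

/-- The function to which the operator of the `m`-th step is applied. -/
theorem mulVar_eq {K : Finset (Fin n)} {F : StemMap n} {m : Fin n} (hF : VanishesBelow F m)
    {g : (Fin n → ℍ[ℝ]) → ℍ[ℝ]} {c : ℝ} {x : Fin n → ℍ[ℝ]} (hg : g x = c • inducedFun F x) :
    mulVar K m g x = c • inducedFun (if m ∈ K then varMul m F else F) x := by
  rw [mulVar, hg]
  split_ifs
  · rw [pow_one, hF.inducedFun_varMul, mul_smul_comm]
  · rw [pow_zero, one_mul]

/-- Differentiability and the value are proved together because both come from the same differential
of the function at step `m`. -/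
theorem crfIter_step (hD : IsOpen D) {F : StemMap n} (hF : IsStem D F)
    {f : (Fin n → ℍ[ℝ]) → ℍ[ℝ]} (hol : ∀ j, HolIn D j F) {K : Finset (Fin n)} {m : ℕ}
    (ih : ∀ x ∈ circularization D, crfIter K f m x = (-1 : ℝ) ^ m • inducedFun (ordStem F K m) x)
    (hm : m < n) {x : Fin n → ℍ[ℝ]} (hx : x ∈ circularization D) :
    DifferentiableAt ℝ
      (fun q => mulVar K ⟨m, hm⟩ (crfIter K f m) (Function.update x ⟨m, hm⟩ q)) (x ⟨m, hm⟩) ∧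
      crfIter K f (m + 1) x = (-1 : ℝ) ^ (m + 1) • inducedFun (ordStem F K (m + 1)) x := by
  have hst := hF.ordStem hD K m
  have hvan := vanishesBelow_ordStem F K ⟨m, hm⟩
  have hh := HolIn.ordStem hD hF hol K (m := m) (j := ⟨m, hm⟩) le_rfl
  have hg := fun y (hy : y ∈ circularization D) => mulVar_eq (K := K) hvan (ih y hy)
  rw [crfIter, dif_pos hm, ordStem, dif_pos hm, pow_succ, mul_neg_one]
  split_ifs at hg ⊢
  · exact (hh.varMul _).crfBar_inducedFun hD (hst.varMul _) hvan.varMul hg hx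
  · exact hh.crfBar_inducedFun hD hst hvan hg hx

theorem crfIter_eq (hD : IsOpen D) {F : StemMap n} (hF : IsStem D F)
    {f : (Fin n → ℍ[ℝ]) → ℍ[ℝ]} (hFf : Induces D F f) (hol : ∀ j, HolIn D j F)
    (K : Finset (Fin n)) {m : ℕ} (hm : m ≤ n) {x : Fin n → ℍ[ℝ]} (hx : x ∈ circularization D) :
    crfIter K f m x = (-1 : ℝ) ^ m • inducedFun (ordStem F K m) x := by
  induction m generalizing x with
  | zero => rw [pow_zero, one_smul]; exact hFf.inducedFun_eq hF hx
  | succ m ih => exact (crfIter_step hD hF hol (fun y hy => ih (by omega) hy) hm hx).2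

end Components

end SliceAnalysis

end

theorem proposition3p6 {n : ℕ} (D : Set (Fin n → ℂ)) (hD : IsOpen D)
    (f : (Fin n → ℍ[ℝ]) → ℍ[ℝ]) (hf : SliceAnalysis.IsSlice D f) :
    (SliceAnalysis.IsSliceRegular D f ↔
      ∀ m : Fin n, ∀ K ⊆ SliceAnalysis.firstIndices n m,
        SliceAnalysis.IsSliceRegularIn D m (SliceAnalysis.orderedComponent D m K f)) ∧
    (SliceAnalysis.IsSliceRegular D f →
      (∀ m ≤ n, ∀ K ⊆ SliceAnalysis.firstIndices n m,
        ∀ x ∈ SliceAnalysis.circularization D,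
          SliceAnalysis.orderedComponent D m K f x
            = (-1) ^ m * SliceAnalysis.crfIter K f m x) ∧
      -- the functions to which the operators are applied are differentiable in the variable concerned
      (∀ m : Fin n, ∀ K ⊆ SliceAnalysis.firstIndices n (m + 1),
        ∀ x ∈ SliceAnalysis.circularization D,
          DifferentiableAt ℝ
            (fun q : ℍ[ℝ] => SliceAnalysis.mulVar K m (SliceAnalysis.crfIter K f m)
              (Function.update x m q)) (x m))) := by
  refine ⟨SliceAnalysis.isSliceRegular_iff_orderedComponent hD hf, fun hreg => ?_⟩
  obtain ⟨hF, hFf⟩ := SliceAnalysis.stemOf_spec hf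
  have hol := (SliceAnalysis.isSliceRegular_iff hD hF hFf).1 hreg
  refine ⟨fun m hm K hK x hx => ?_, fun m K _ x hx => ?_⟩
  · have heq := SliceAnalysis.stemEqOn_orderedComponent hD hm
      (fun i _ K => SliceAnalysis.HolIn.ordStem hD hF hol K le_rfl) hK
    have hst := (hF.ordStem hD K m).congr heq
    -- The iterated operator produces `(-1)^m` times the component, and multiplying again by
    -- `(-1)^m` cancels the sign.
    rw [SliceAnalysis.crfIter_eq hD hF hFf hol K hm hx, SliceAnalysis.orderedComponent,
      SliceAnalysis.component, SliceAnalysis.inducedFun_congr hst heq hx, mul_smul_comm,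
      ← smul_mul_assoc, ← smul_pow, neg_one_smul, neg_neg, one_pow, one_mul]
  · exact (SliceAnalysis.crfIter_step hD hF hol
      (fun y hy => SliceAnalysis.crfIter_eq hD hF hFf hol K m.2.le hy) m.2 hx).1
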